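/- **Language.** Fix a linearly ordered set $\mathcal R$ of *quantum variables*. *Indices* are $\sigma ::= x \mid \mathsf{bool} \mid \sigma\times\sigma$ ($x$ an index variable); every $r\in\mathcal R$ has a given index $\sigma_r$. *Registers* are $R ::= r \mid (R,R)$; the pairing $(R,R')$ is valid if $R,R'$ are valid and their sets of variables $\mathrm{var}(R),\mathrm{var}(R')$ are disjoint; $r$ has index $\sigma_r$ and $(R,R')$ has the product of the indices of $R$ and $R'$. *Types* are $\mathrm{Basis}(\sigma)$, $\mathcal S$ (scalars), $\mathcal K(\sigma)$ (kets), $\mathcal B(\sigma)$ (bras), $\mathcal O(\sigma,\tau)$ (operators from $\tau$ to $\sigma$), $\mathsf{SET}(\sigma)$, $T\to U$, $\forall x.T$ ($x$ an index variable), and the *labelled types* $\mathcal D(s,s')$ for finite $s,s'\subseteq\mathcal R$ (codomain $s$, domain $s'$). *Plain terms* are the well-typed terms built from variables, $\lambda x{:}T.e$, application, abstraction over and application to indices, $0,1:\mathrm{Basis}(\mathsf{bool})$, pairs of basis terms, scalars $0,1,a\times b,a^*,\delta_{i,j}$, zero kets, bras and operators, the identity operators, $|i\rangle$, $\langle i|$,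 $e^\dagger$, $a.e$, $e+e'$, $e\otimes e'$, $e\cdot e'$ (bra–ket, operator–ket, bra–operator, ket–bra, operator–operator), the full set $\mathbf U(\sigma)$, $M\star N$, and $\sum_{M}f$ ($M:\mathsf{SET}(\sigma)$, $f:\mathrm{Basis}(\sigma)\to T$ with $T$ a scalar, ket, bra or operator type); all subterms of a plain term have types in which no $\mathcal D(\cdot,\cdot)$ occurs. *Labelled Dirac terms* add: $|i\rangle_r:\mathcal D(\{r\},\emptyset)$ and ${}_r\langle i|:\mathcal D(\emptyset,\{r\})$ for $i:\mathrm{Basis}(\sigma_r)$; $K_R:\mathcal D(\mathrm{var}(R),\emptyset)$, $B_R:\mathcal D(\emptyset,\mathrm{var}(R))$, $O_{R;R'}:\mathcal D(\mathrm{var}(R),\mathrm{var}(R'))$ for valid $R,R'$ of indices $\sigma,\tau$ and $K:\mathcal K(\sigma)$, $B:\mathcal B(\sigma)$, $O:\mathcal O(\sigma,\tau)$; $D^\dagger:\mathcal D(s',s)$, $a.D$, $D+D'$ and $\sum_M f$ for $\mathcal D(s,s')$; the tensor $D_1\otimes D_2:\mathcal D(s_1\cup s_2,s_1'\cup s_2')$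 of $D_i:\mathcal D(s_i,s_i')$ when $s_1\cap s_2=s_1'\cap s_2'=\emptyset$ (and the empty tensor, of type $\mathcal D(\emptyset,\emptyset)$); and the composition $D_1\cdot D_2:\mathcal D(s_1\cup(s_2\setminus s_1'),\,s_2'\cup(s_1'\setminus s_2))$ when $s_1\cap(s_2\setminus s_1')=s_2'\cap(s_1'\setminus s_2)=\emptyset$. **Semantics.** A context $\Gamma$ consists of finitely many index variables, the indices $\sigma_r$, and a list of assumptions $x:T$ and definitions $x:=t:T$. A valuation $v$ interprets index variables as finite sets ($\mathsf{bool}$ has two elements, $\times$ is the Cartesian product) and term variables as elements of their types, and is valid if it satisfies all definitions in $\Gamma$. Kets, bras and operators denote vectors, dual vectors and linear maps over the spaces $\mathcal H_\sigma$ with orthonormal basis $[\![\sigma]\!]_v$; functions denote functions, sets denote finite subsets, and $\sum_M f$ denotes the finite sum. $\mathcal D(s,s')$ denotes the linear maps $\mathcal H_{s'}\to\mathcal H_s$, where $\mathcal H_s=\bigotimes_{r\in s}\mathcal H_{\sigma_r}$; $|i\rangle_r$, ${}_r\langle i|$ denote $|i\rangle$, $\langle i|$; $K_R,B_R,O_{R;R'}$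 denote $\mathrm{SWAP}_R K$, $B\,\mathrm{SWAP}_R^\dagger$, $\mathrm{SWAP}_R\,O\,\mathrm{SWAP}_{R'}^\dagger$, where $\mathrm{SWAP}_R:\mathcal H_\sigma\to\mathcal H_{\mathrm{var}(R)}$ is the canonical reordering of tensor factors; $D_1\otimes D_2$ denotes the tensor product up to the canonical reorderings; and $D_1\cdot D_2$ denotes the composition of $D_1\otimes 1_{s_2\setminus s_1'}$ and $D_2\otimes 1_{s_1'\setminus s_2}$. $\Gamma\vDash e=e'$ means that $e$ and $e'$ have the same value under all valuations valid for $\Gamma$. **Normalization procedure** on a term $D:\mathcal D(s,s')$. All rules may be applied to any subterm, in any order, finitely often. 1. *Expansion.* $O_{R;R'}$ is replaced by $$\sum_{i_{r_1}\in\mathbf U(\sigma_{r_1})}\!\!\cdots\!\!\sum_{i_{r_k}\in\mathbf U(\sigma_{r_k})}\ \sum_{i'_{r'_1}\in\mathbf U(\sigma_{r'_1})}\!\!\cdots\!\!\sum_{i'_{r'_l}\in\mathbf U(\sigma_{r'_l})} (\langle i_R|\cdot O\cdot|i'_{R'}\rangle).\bigl(|i_{r_1}\rangle_{r_1}\otimes\cdots\otimes|i_{r_k}\rangle_{r_k}\otimes{}_{r'_1}\langle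 i'_{r'_1}|\otimes\cdots\otimes{}_{r'_l}\langle i'_{r'_l}|\bigr),$$ where $r_1<\dots<r_k$ and $r'_1<\dots<r'_l$ are the variables of $R$ and $R'$, and $|i_R\rangle$, $\langle i_R|$ are the tensors of basis vectors built along the structure of $R$; $K_R$ and $B_R$ are expanded likewise, with coefficients $\langle i_R|\cdot K$ and $B\cdot|i_R\rangle$. 2. *Rewriting to normal form*, with the labelled $\otimes$ treated modulo associativity, commutativity and removal of empty tensors: $\beta$-reduction of terms and indices; for labelled terms, $(|i\rangle_r)^\dagger\to{}_r\langle i|$, $({}_r\langle i|)^\dagger\to|i\rangle_r$, $(D_1\otimes D_2)^\dagger\to D_1^\dagger\otimes D_2^\dagger$ (and the empty tensor is its own adjoint), $(D_1\cdot D_2)^\dagger\to D_2^\dagger\cdot D_1^\dagger$, $D^{\dagger\dagger}\to D$, $(a.D)^\dagger\to a^*.D^\dagger$, distribution of $\dagger$ over $+$ and $\sum$; $1.D\to D$, $a.(b.D)\to(a\times b).D$, distribution of $a.(\cdot)$ over $+$ and $\sum$, $(\sum_{i\in M} a).D\to\sum_{i\in M} a.D$; associativity of $+$ and $\sum_{i\in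 M}(D+D')\to\sum_{i\in M}D+\sum_{i\in M}D'$; scalars, $+$ and $\sum$ are pulled out of both arguments of $\otimes$ and of $\cdot$; and - $A\cdot B\to A\otimes B$ if $A:\mathcal D(s_1,s_1')$, $B:\mathcal D(s_2,s_2')$, $s_1'\cap s_2=\emptyset$; - ${}_r\langle i|\cdot|j\rangle_r\to\delta_{i,j}$ (times the empty tensor); - ${}_r\langle i|\cdot(|j\rangle_r\otimes Y)\to\delta_{i,j}.Y$; - $({}_r\langle i|\otimes X)\cdot|j\rangle_r\to\delta_{i,j}.X$; - $({}_r\langle i|\otimes X)\cdot(|j\rangle_r\otimes Y)\to\delta_{i,j}.(X\cdot Y)$. The result has to be in *normal form*: an addition of iterated sums $\sum_i\cdots\sum_j a.X$, with $a$ a scalar (possibly omitted) and $X$ a tensor of labelled basis kets $|i\rangle_r$ and bras ${}_r\langle j|$. 3. *Sorting and dropping labels.* In every summand, $X$ is sorted (by associativity, commutativity and removal of empty tensors) into $(|i_1\rangle_{r_1}\otimes\cdots\otimes|i_k\rangle_{r_k})\otimes({}_{r'_1}\langle j_1|\otimes\cdots\otimes{}_{r'_l}\langle j_l|)$ with $r_1<\dots<r_k$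 the elements of $s$ and $r'_1<\dots<r'_l$ those of $s'$, and is then replaced by $(|i_1\rangle\otimes\cdots\otimes|i_k\rangle)\cdot(\langle j_1|\otimes\cdots\otimes\langle j_l|)$. If $s'=\emptyset$ or $s=\emptyset$, only the tensor of kets or of bras remains; if $s=s'=\emptyset$, then $a.X$ is replaced by $a$ (and $X$ by $1$). So the result has the type $\mathcal O(\sigma_{r_1}\times\cdots\times\sigma_{r_k},\ \sigma_{r'_1}\times\cdots\times\sigma_{r'_l})$, or the corresponding $\mathcal K$, $\mathcal B$ or $\mathcal S$. **Theorem (Label Elimination).** Let $\Gamma\vdash D_1:\mathcal D(s,s')$ and $\Gamma\vdash D_2:\mathcal D(s,s')$, and suppose that no variable, free or bound, whose type involves a labelled type $\mathcal D(\cdot,\cdot)$ appears in $D_1$ or $D_2$. Then the normalization procedure can be carried out on $D_1$ and on $D_2$. Moreover, for all terms $e_1$ and $e_2$ obtained by the procedure from $D_1$ and $D_2$, the terms $e_1$ and $e_2$ are plain terms of the same type in context $\Gamma$, so that $e_1=e_2$ is an equation in plain Dirac notation, and $$\Gamma\vDash D_1=D_2\quad\text{if and only if}\quad\Gamma\vDash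 e_1=e_2 .$$ -/

import Mathlib

namespace LabelledDirac

/-! ### Indices, types, registers -/

/-- Type indices `σ ::= x | bool | σ × τ` over `n` index variables (de Bruijn: variable `0` is the
most recently bound one). -/
inductive Idx (n : ℕ) : Type
  | var (i : Fin n) : Idx n
  | bool : Idx n
  | prod (σ τ : Idx n) : Idx n

/-- Types of Dirac terms that can be added and summed: scalars `S`, kets `K(σ)`, bras `B(σ)`,
operators `O(σ, τ)` from `τ` to `σ`, and labelled Dirac terms `D(s, s')`, where `s` (codomain) and
`s'` (domain) are finite sets of quantum variables. -/
inductive LTy (Q : Type) (n : ℕ) : Type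
  | S : LTy Q n
  | K (σ : Idx n) : LTy Q n
  | B (σ : Idx n) : LTy Q n
  | O (σ τ : Idx n) : LTy Q n
  | D (s s' : Finset Q) : LTy Q n

/-- All types: `Basis(σ)`, the types above, `SET(σ)`, `T → U`, and `∀ x. T` (`x` an index). -/
inductive Ty (Q : Type) : ℕ → Type
  | basis {n : ℕ} (σ : Idx n) : Ty Q n
  | lin {n : ℕ} (L : LTy Q n) : Ty Q n
  | set {n : ℕ} (σ : Idx n) : Ty Q n
  | arr {n : ℕ} (T U : Ty Q n) : Ty Q n
  | all {n : ℕ} (T : Ty Q (n + 1)) : Ty Q n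

/-- Quantum registers `R ::= r | (R, R)`. -/
inductive Reg (Q : Type) : Type
  | var (r : Q) : Reg Q
  | pair (R R' : Reg Q) : Reg Q

/-- Substitution of indices for index variables. -/
def Idx.subst {n k : ℕ} (f : Fin n → Idx k) : Idx n → Idx k
  | .var i => f i
  | .bool => .bool
  | .prod σ τ => .prod (σ.subst f) (τ.subst f)

/-- The substitution that shifts all index variables by one. -/
def shiftI {n : ℕ} : Fin n → Idx (n + 1) := fun i => .var i.succ

/-- The substitution of `σ` for the index variable `0`. -/
def instI {n : ℕ} (σ : Idx n) : Fin (n + 1) → Idx n := Fin.cases σ Idx.var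

/-- A substitution carried under an index binder. -/
def liftI {n k : ℕ} (f : Fin n → Idx k) : Fin (n + 1) → Idx (k + 1) :=
  Fin.cases (.var 0) (fun i => (f i).subst shiftI)

def LTy.subst {Q : Type} {n k : ℕ} (f : Fin n → Idx k) : LTy Q n → LTy Q k
  | .S => .S
  | .K σ => .K (σ.subst f)
  | .B σ => .B (σ.subst f)
  | .O σ τ => .O (σ.subst f) (τ.subst f)
  | .D s s' => .D s s'

def Ty.subst {Q : Type} : {n k : ℕ} → (Fin n → Idx k) → Ty Q n → Ty Q k
  | _, _, f, .basis σ => .basis (σ.subst f)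
  | _, _, f, .lin L => .lin (L.subst f)
  | _, _, f, .set σ => .set (σ.subst f)
  | _, _, f, .arr T U => .arr (T.subst f) (U.subst f)
  | _, _, f, .all T => .all (T.subst (liftI f))

/-- A type is plain if no labelled type `D(s, s')` occurs in it. -/
def Ty.Plain {Q : Type} : {n : ℕ} → Ty Q n → Prop
  | _, .lin (.D _ _) => False
  | _, .arr T U => T.Plain ∧ U.Plain
  | _, .all T => T.Plain
  | _, _ => True

theorem Idx.subst_subst {n k l : ℕ} (f : Fin n → Idx k) (g : Fin k → Idx l) (σ : Idx n) :
    (σ.subst f).subst g = σ.subst (fun i => (f i).subst g) := by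
  induction σ with
  | var i => rfl
  | bool => rfl
  | prod σ τ h1 h2 => simp [Idx.subst, h1, h2]

theorem Idx.subst_var {n : ℕ} (σ : Idx n) : σ.subst Idx.var = σ := by
  induction σ with
  | var i => rfl
  | bool => rfl
  | prod σ τ h1 h2 => simp [Idx.subst, h1, h2]

theorem Idx.shift_lift {n k : ℕ} (f : Fin n → Idx k) (σ : Idx n) :
    (σ.subst shiftI).subst (liftI f) = (σ.subst f).subst shiftI := by
  rw [Idx.subst_subst, Idx.subst_subst]; rfl

theorem Idx.shift_inst {n : ℕ} (τ : Idx n) (σ : Idx n) :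
    (σ.subst shiftI).subst (instI τ) = σ := by
  rw [Idx.subst_subst]; exact Idx.subst_var σ

theorem LTy.subst_subst {Q : Type} {n k l : ℕ} (f : Fin n → Idx k) (g : Fin k → Idx l)
    (L : LTy Q n) : (L.subst f).subst g = L.subst (fun i => (f i).subst g) := by
  cases L <;> simp [LTy.subst, Idx.subst_subst]

theorem liftI_comp {n k l : ℕ} (f : Fin n → Idx k) (g : Fin k → Idx l) :
    (fun i => (liftI f i).subst (liftI g)) = liftI (fun i => (f i).subst g) := by
  funext i
  refine Fin.cases rfl (fun j => ?_) i
  exact Idx.shift_lift g (f j)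

theorem Ty.subst_subst {Q : Type} {n : ℕ} (T : Ty Q n) :
    ∀ {k l : ℕ} (f : Fin n → Idx k) (g : Fin k → Idx l),
      (T.subst f).subst g = T.subst (fun i => (f i).subst g) := by
  induction T with
  | basis σ => intro k l f g; simp [Ty.subst, Idx.subst_subst]
  | lin L => intro k l f g; simp [Ty.subst, LTy.subst_subst]
  | set σ => intro k l f g; simp [Ty.subst, Idx.subst_subst]
  | arr T U h1 h2 => intro k l f g; simp [Ty.subst, h1, h2]
  | all T h => intro k l f g; simp [Ty.subst, h, liftI_comp]

theorem Ty.shift_lift {Q : Type} {n k : ℕ} (f : Fin n → Idx k) (T : Ty Q n) :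
    (T.subst shiftI).subst (liftI f) = (T.subst f).subst shiftI := by
  rw [Ty.subst_subst, Ty.subst_subst]; rfl

theorem LTy.subst_var {Q : Type} {n : ℕ} (L : LTy Q n) : L.subst Idx.var = L := by
  cases L <;> simp [LTy.subst, Idx.subst_var]

theorem liftI_var {n : ℕ} : liftI (Idx.var : Fin n → Idx n) = Idx.var := by
  funext i
  exact Fin.cases rfl (fun j => rfl) i

theorem Ty.subst_var {Q : Type} {n : ℕ} (T : Ty Q n) : T.subst Idx.var = T := by
  induction T with
  | basis σ => simp [Ty.subst, Idx.subst_var]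
  | lin L => simp [Ty.subst, LTy.subst_var]
  | set σ => simp [Ty.subst, Idx.subst_var]
  | arr T U h1 h2 => simp [Ty.subst, h1, h2]
  | all T h => simp [Ty.subst, h, liftI_var]

theorem Ty.shift_inst {Q : Type} {n : ℕ} (τ : Idx n) (T : Ty Q n) :
    (T.subst shiftI).subst (instI τ) = T := by
  rw [Ty.subst_subst]; exact Ty.subst_var T

theorem Ty.inst_subst {Q : Type} {n k : ℕ} (f : Fin n → Idx k) (σ : Idx n) (T : Ty Q (n + 1)) :
    (T.subst (liftI f)).subst (instI (σ.subst f)) = (T.subst (instI σ)).subst f := by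
  rw [Ty.subst_subst, Ty.subst_subst]
  congr 1
  funext i
  refine Fin.cases rfl (fun j => ?_) i
  exact Idx.shift_inst (σ.subst f) (f j)

theorem D_ne_S {Q : Type} {n : ℕ} {s s' : Finset Q} : (LTy.D s s' : LTy Q n) ≠ .S := nofun

section

variable {Q : Type} [LinearOrder Q]

/-- The set of quantum variables of a register. -/
def Reg.vars : Reg Q → Finset Q
  | .var r => {r}
  | .pair R R' => R.vars ∪ R'.vars

/-- No quantum variable is repeated in the register. -/
def Reg.Valid : Reg Q → Prop
  | .var _ => True
  | .pair R R' => R.Valid ∧ R'.Valid ∧ Disjoint R.vars R'.vars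

/-- The index of a register, given the indices `q r` of the quantum variables `r`. -/
def Reg.idx {n : ℕ} (q : Q → Idx n) : Reg Q → Idx n
  | .var r => q r
  | .pair R R' => .prod (R.idx q) (R'.idx q)

/-- The typing judgement `R : Reg(σ)`. -/
def Reg.HasType {n : ℕ} (q : Q → Idx n) (R : Reg Q) (σ : Idx n) : Prop :=
  R.Valid ∧ R.idx q = σ

theorem Reg.HasType.subst {n k : ℕ} {q : Q → Idx n} {q' : Q → Idx k} {f : Fin n → Idx k}
    (hq : ∀ r, q' r = (q r).subst f) {R : Reg Q} {σ : Idx n} (h : R.HasType q σ) :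
    R.HasType q' (σ.subst f) := by
  refine ⟨h.1, ?_⟩
  rw [← h.2]
  clear h
  induction R with
  | var r => exact hq r
  | pair R R' h1 h2 => simp [Reg.idx, Idx.subst, h1, h2]

/-! ### Terms

Terms are intrinsically typed: an element of `Tm q Γ T` is a term together with a derivation of
`Γ ⊢ t : T`.  A context consists of `n` index variables, the indices `q r` of the quantum variables
`r` (the declarations `r : Reg(q r)`) and the types `Γ 0, …, Γ (m - 1)` of the `m` term
variables (de Bruijn: variable `0` is the most recently bound one).  Symbols of indefinite arity
(`+`, `×`, labelled `⊗`) are iterated binary symbols; `lone` is the empty labelled tensor. -/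

/-- The typing side conditions of the labelled tensor of terms of types `D(s₁, s₁')` and
`D(s₂, s₂')`, with result type `D(s, s')`. -/
def TsrOK (s₁ s₁' s₂ s₂' s s' : Finset Q) : Prop :=
  Disjoint s₁ s₂ ∧ Disjoint s₁' s₂' ∧ s = s₁ ∪ s₂ ∧ s' = s₁' ∪ s₂'

/-- The typing side conditions of the generalized composition of terms of types `D(s₁, s₁')` and
`D(s₂, s₂')`, with result type `D(s, s')`. -/
def DotOK (s₁ s₁' s₂ s₂' s s' : Finset Q) : Prop :=
  s₁ ∩ (s₂ \ s₁') = ∅ ∧ s₂' ∩ (s₁' \ s₂) = ∅ ∧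
    s = s₁ ∪ (s₂ \ s₁') ∧ s' = s₂' ∪ (s₁' \ s₂)

/-- Constants. -/
inductive Op0 (Q : Type) [LinearOrder Q] {n : ℕ} : Ty Q n → Type
  | b0 : Op0 Q (.basis .bool)
  | b1 : Op0 Q (.basis .bool)
  | zeroS : Op0 Q (.lin .S)
  | oneS : Op0 Q (.lin .S)
  | zeroK (σ : Idx n) : Op0 Q (.lin (.K σ))
  | zeroB (σ : Idx n) : Op0 Q (.lin (.B σ))
  | zeroO (σ τ : Idx n) : Op0 Q (.lin (.O σ τ))
  | oneO (σ : Idx n) : Op0 Q (.lin (.O σ σ))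
  | univ (σ : Idx n) : Op0 Q (.set σ)
  | lone {s s' : Finset Q} (hs : s = ∅) (hs' : s' = ∅) : Op0 Q (.lin (.D s s'))

/-- Unary symbols: `a^*`, the adjoints, `|t⟩`, `⟨t|`, the labelled bases `|t⟩_r`, `_r⟨t|`, and the
lifted terms `K_R`, `B_R`, `O_{R;R'}`. -/
inductive Op1 {n : ℕ} (q : Q → Idx n) : Ty Q n → Ty Q n → Type
  | conj : Op1 q (.lin .S) (.lin .S)
  | adjK (σ : Idx n) : Op1 q (.lin (.K σ)) (.lin (.B σ))
  | adjB (σ : Idx n) : Op1 q (.lin (.B σ)) (.lin (.K σ))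
  | adjO (σ τ : Idx n) : Op1 q (.lin (.O σ τ)) (.lin (.O τ σ))
  | adjD (s s' : Finset Q) : Op1 q (.lin (.D s s')) (.lin (.D s' s))
  | ket (σ : Idx n) : Op1 q (.basis σ) (.lin (.K σ))
  | bra (σ : Idx n) : Op1 q (.basis σ) (.lin (.B σ))
  | lket (r : Q) {σ : Idx n} (hr : q r = σ) {s s' : Finset Q} (hs : s = {r}) (hs' : s' = ∅) :
      Op1 q (.basis σ) (.lin (.D s s'))
  | lbra (r : Q) {σ : Idx n} (hr : q r = σ) {s s' : Finset Q} (hs : s = ∅) (hs' : s' = {r}) :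
      Op1 q (.basis σ) (.lin (.D s s'))
  | liftK (R : Reg Q) {σ : Idx n} (hR : R.HasType q σ) {s s' : Finset Q} (hs : s = R.vars)
      (hs' : s' = ∅) : Op1 q (.lin (.K σ)) (.lin (.D s s'))
  | liftB (R : Reg Q) {σ : Idx n} (hR : R.HasType q σ) {s s' : Finset Q} (hs : s = ∅)
      (hs' : s' = R.vars) : Op1 q (.lin (.B σ)) (.lin (.D s s'))
  | liftO (R R' : Reg Q) {σ τ : Idx n} (hR : R.HasType q σ) (hR' : R'.HasType q τ)
      {s s' : Finset Q} (hs : s = R.vars) (hs' : s' = R'.vars) :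
      Op1 q (.lin (.O σ τ)) (.lin (.D s s'))

/-- Binary symbols: pairs of basis terms, `a × b`, `δ_{s,t}`, `X + Y`, `a.X`, `⊗` and `·` of plain
kets, bras and operators, `A ⋆ B` on sets, and the labelled `⊗` and `·`. -/
inductive Op2 (Q : Type) [LinearOrder Q] {n : ℕ} : Ty Q n → Ty Q n → Ty Q n → Type
  | pair (σ τ : Idx n) : Op2 Q (.basis σ) (.basis τ) (.basis (.prod σ τ))
  | mul : Op2 Q (.lin .S) (.lin .S) (.lin .S)
  | delta (σ : Idx n) : Op2 Q (.basis σ) (.basis σ) (.lin .S)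
  | add (L : LTy Q n) : Op2 Q (.lin L) (.lin L) (.lin L)
  | smul {L : LTy Q n} (hL : L ≠ .S) : Op2 Q (.lin .S) (.lin L) (.lin L)
  | tsrK (σ τ : Idx n) : Op2 Q (.lin (.K σ)) (.lin (.K τ)) (.lin (.K (.prod σ τ)))
  | tsrB (σ τ : Idx n) : Op2 Q (.lin (.B σ)) (.lin (.B τ)) (.lin (.B (.prod σ τ)))
  | tsrO (σ τ σ' τ' : Idx n) :
      Op2 Q (.lin (.O σ τ)) (.lin (.O σ' τ')) (.lin (.O (.prod σ σ') (.prod τ τ')))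
  | dotBK (σ : Idx n) : Op2 Q (.lin (.B σ)) (.lin (.K σ)) (.lin .S)
  | dotOK (σ τ : Idx n) : Op2 Q (.lin (.O σ τ)) (.lin (.K τ)) (.lin (.K σ))
  | dotBO (σ τ : Idx n) : Op2 Q (.lin (.B σ)) (.lin (.O σ τ)) (.lin (.B τ))
  | dotKB (σ τ : Idx n) : Op2 Q (.lin (.K σ)) (.lin (.B τ)) (.lin (.O σ τ))
  | dotOO (σ τ υ : Idx n) : Op2 Q (.lin (.O σ τ)) (.lin (.O τ υ)) (.lin (.O σ υ))
  | star (σ τ : Idx n) : Op2 Q (.set σ) (.set τ) (.set (.prod σ τ))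
  | ltsr {s₁ s₁' s₂ s₂' s s' : Finset Q} (h : TsrOK s₁ s₁' s₂ s₂' s s') :
      Op2 Q (.lin (.D s₁ s₁')) (.lin (.D s₂ s₂')) (.lin (.D s s'))
  | ldot {s₁ s₁' s₂ s₂' s s' : Finset Q} (h : DotOK s₁ s₁' s₂ s₂' s s') :
      Op2 Q (.lin (.D s₁ s₁')) (.lin (.D s₂ s₂')) (.lin (.D s s'))

/-- Extension of a context by a term variable. -/
def ext {n m : ℕ} (T : Ty Q n) (Γ : Fin m → Ty Q n) : Fin (m + 1) → Ty Q n :=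
  @Fin.cons m (fun _ => Ty Q n) T Γ

/-- The indices of the quantum variables after extending the context by an index variable. -/
def qI {n : ℕ} (q : Q → Idx n) : Q → Idx (n + 1) := fun r => (q r).subst shiftI

/-- The types of the term variables after extending the context by an index variable. -/
def extI {n m : ℕ} (Γ : Fin m → Ty Q n) : Fin m → Ty Q (n + 1) := fun i => (Γ i).subst shiftI

/-- Well-typed terms. -/
inductive Tm : {n : ℕ} → (Q → Idx n) → {m : ℕ} → (Fin m → Ty Q n) → Ty Q n → Type
  | var {n : ℕ} {q : Q → Idx n} {m : ℕ} {Γ : Fin m → Ty Q n} {T : Ty Q n} (i : Fin m)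
      (h : Γ i = T) : Tm q Γ T
  | lam {n : ℕ} {q : Q → Idx n} {m : ℕ} {Γ : Fin m → Ty Q n} {T U : Ty Q n}
      (t : Tm q (ext T Γ) U) : Tm q Γ (.arr T U)
  | app {n : ℕ} {q : Q → Idx n} {m : ℕ} {Γ : Fin m → Ty Q n} {T U : Ty Q n}
      (t : Tm q Γ (.arr T U)) (u : Tm q Γ T) : Tm q Γ U
  | lamI {n : ℕ} {q : Q → Idx n} {m : ℕ} {Γ : Fin m → Ty Q n} {T : Ty Q (n + 1)}
      (t : Tm (qI q) (extI Γ) T) : Tm q Γ (.all T)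
  | appI {n : ℕ} {q : Q → Idx n} {m : ℕ} {Γ : Fin m → Ty Q n} {T : Ty Q (n + 1)} {U : Ty Q n}
      (t : Tm q Γ (.all T)) (σ : Idx n) (h : T.subst (instI σ) = U) : Tm q Γ U
  | sum {n : ℕ} {q : Q → Idx n} {m : ℕ} {Γ : Fin m → Ty Q n} {σ : Idx n} {L : LTy Q n}
      (M : Tm q Γ (.set σ)) (f : Tm q Γ (.arr (.basis σ) (.lin L))) : Tm q Γ (.lin L)
  | const {n : ℕ} {q : Q → Idx n} {m : ℕ} {Γ : Fin m → Ty Q n} {T : Ty Q n}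
      (c : Op0 Q T) : Tm q Γ T
  | un {n : ℕ} {q : Q → Idx n} {m : ℕ} {Γ : Fin m → Ty Q n} {T U : Ty Q n}
      (o : Op1 q T U) (t : Tm q Γ T) : Tm q Γ U
  | bin {n : ℕ} {q : Q → Idx n} {m : ℕ} {Γ : Fin m → Ty Q n} {T U V : Ty Q n}
      (o : Op2 Q T U V) (t : Tm q Γ T) (u : Tm q Γ U) : Tm q Γ V

/-- No variable whose type involves a labelled type `D(·,·)` appears (free or bound). -/
def Tm.NoLabelledVars : {n : ℕ} → {q : Q → Idx n} → {m : ℕ} → {Γ : Fin m → Ty Q n} →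
    {T : Ty Q n} → Tm q Γ T → Prop
  | _, _, _, Γ, _, .var i _ => (Γ i).Plain
  | _, _, _, _, _, .lam (T := T) t => T.Plain ∧ t.NoLabelledVars
  | _, _, _, _, _, .app t u => t.NoLabelledVars ∧ u.NoLabelledVars
  | _, _, _, _, _, .lamI t => t.NoLabelledVars
  | _, _, _, _, _, .appI t _ _ => t.NoLabelledVars
  | _, _, _, _, _, .sum M f => M.NoLabelledVars ∧ f.NoLabelledVars
  | _, _, _, _, _, .const _ => True
  | _, _, _, _, _, .un _ t => t.NoLabelledVars
  | _, _, _, _, _, .bin _ t u => t.NoLabelledVars ∧ u.NoLabelledVars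

/-- Terms of plain Dirac notation: the term and all its subterms have a plain type.  In particular,
no labelled symbol and no register occurs. -/
def Tm.IsPlain : {n : ℕ} → {q : Q → Idx n} → {m : ℕ} → {Γ : Fin m → Ty Q n} →
    {T : Ty Q n} → Tm q Γ T → Prop
  | _, _, _, _, T, .var _ _ => T.Plain
  | _, _, _, _, _, .lam (T := T) t => T.Plain ∧ t.IsPlain
  | _, _, _, _, T, .app t u => T.Plain ∧ t.IsPlain ∧ u.IsPlain
  | _, _, _, _, _, .lamI t => t.IsPlain
  | _, _, _, _, T, .appI t _ _ => T.Plain ∧ t.IsPlain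
  | _, _, _, _, _, .sum (L := L) M f => (Ty.lin L).Plain ∧ M.IsPlain ∧ f.IsPlain
  | _, _, _, _, T, .const _ => T.Plain
  | _, _, _, _, T, .un _ t => T.Plain ∧ t.IsPlain
  | _, _, _, _, T, .bin _ t u => T.Plain ∧ t.IsPlain ∧ u.IsPlain

/-! ### Renaming and substitution -/

/-- Renaming of term variables. -/
def Tm.ren : {n : ℕ} → {q : Q → Idx n} → {m : ℕ} → {Γ : Fin m → Ty Q n} → {T : Ty Q n} →
    Tm q Γ T → {m' : ℕ} → {Γ' : Fin m' → Ty Q n} → (g : Fin m → Fin m') →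
    (∀ i, Γ' (g i) = Γ i) → Tm q Γ' T
  | _, _, _, _, _, .var i h, _, _, g, hg => .var (g i) ((hg i).trans h)
  | _, _, _, _, _, .lam t, _, _, g, hg =>
      .lam (t.ren (Fin.cases 0 (fun i => (g i).succ)) (Fin.cases rfl hg))
  | _, _, _, _, _, .app t u, _, _, g, hg => .app (t.ren g hg) (u.ren g hg)
  | _, _, _, _, _, .lamI t, _, _, g, hg =>
      .lamI (t.ren g (fun i => congrArg (Ty.subst shiftI) (hg i)))
  | _, _, _, _, _, .appI t σ h, _, _, g, hg => .appI (t.ren g hg) σ h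
  | _, _, _, _, _, .sum M f, _, _, g, hg => .sum (M.ren g hg) (f.ren g hg)
  | _, _, _, _, _, .const c, _, _, _, _ => .const c
  | _, _, _, _, _, .un o t, _, _, g, hg => .un o (t.ren g hg)
  | _, _, _, _, _, .bin o t u, _, _, g, hg => .bin o (t.ren g hg) (u.ren g hg)

/-- Weakening by one term variable. -/
def Tm.wk {n : ℕ} {q : Q → Idx n} {m : ℕ} {Γ : Fin m → Ty Q n} {T : Ty Q n} (U : Ty Q n)
    (t : Tm q Γ T) : Tm q (ext U Γ) T :=
  t.ren Fin.succ (fun _ => rfl)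

def Op0.subst {n k : ℕ} (f : Fin n → Idx k) : {T : Ty Q n} → Op0 Q T → Op0 Q (T.subst f)
  | _, .b0 => .b0
  | _, .b1 => .b1
  | _, .zeroS => .zeroS
  | _, .oneS => .oneS
  | _, .zeroK σ => .zeroK (σ.subst f)
  | _, .zeroB σ => .zeroB (σ.subst f)
  | _, .zeroO σ τ => .zeroO (σ.subst f) (τ.subst f)
  | _, .oneO σ => .oneO (σ.subst f)
  | _, .univ σ => .univ (σ.subst f)
  | _, .lone hs hs' => .lone hs hs'

def Op1.subst {n k : ℕ} {q : Q → Idx n} {q' : Q → Idx k} (f : Fin n → Idx k)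
    (hq : ∀ r, q' r = (q r).subst f) :
    {T U : Ty Q n} → Op1 q T U → Op1 q' (T.subst f) (U.subst f)
  | _, _, .conj => .conj
  | _, _, .adjK σ => .adjK (σ.subst f)
  | _, _, .adjB σ => .adjB (σ.subst f)
  | _, _, .adjO σ τ => .adjO (σ.subst f) (τ.subst f)
  | _, _, .adjD s s' => .adjD s s'
  | _, _, .ket σ => .ket (σ.subst f)
  | _, _, .bra σ => .bra (σ.subst f)
  | _, _, .lket r hr hs hs' => .lket r ((hq r).trans (congrArg (Idx.subst f) hr)) hs hs'
  | _, _, .lbra r hr hs hs' => .lbra r ((hq r).trans (congrArg (Idx.subst f) hr)) hs hs'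
  | _, _, .liftK R hR hs hs' => .liftK R (hR.subst hq) hs hs'
  | _, _, .liftB R hR hs hs' => .liftB R (hR.subst hq) hs hs'
  | _, _, .liftO R R' hR hR' hs hs' => .liftO R R' (hR.subst hq) (hR'.subst hq) hs hs'

theorem LTy.subst_ne_S {Q : Type} {n k : ℕ} (f : Fin n → Idx k) {L : LTy Q n} (hL : L ≠ .S) :
    L.subst f ≠ .S := by
  cases L <;> simp [LTy.subst] at hL ⊢

def Op2.subst {n k : ℕ} (f : Fin n → Idx k) :
    {T U V : Ty Q n} → Op2 Q T U V → Op2 Q (T.subst f) (U.subst f) (V.subst f)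
  | _, _, _, .pair σ τ => .pair (σ.subst f) (τ.subst f)
  | _, _, _, .mul => .mul
  | _, _, _, .delta σ => .delta (σ.subst f)
  | _, _, _, .add L => .add (L.subst f)
  | _, _, _, .smul hL => .smul (LTy.subst_ne_S f hL)
  | _, _, _, .tsrK σ τ => .tsrK (σ.subst f) (τ.subst f)
  | _, _, _, .tsrB σ τ => .tsrB (σ.subst f) (τ.subst f)
  | _, _, _, .tsrO σ τ σ' τ' => .tsrO (σ.subst f) (τ.subst f) (σ'.subst f) (τ'.subst f)
  | _, _, _, .dotBK σ => .dotBK (σ.subst f)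
  | _, _, _, .dotOK σ τ => .dotOK (σ.subst f) (τ.subst f)
  | _, _, _, .dotBO σ τ => .dotBO (σ.subst f) (τ.subst f)
  | _, _, _, .dotKB σ τ => .dotKB (σ.subst f) (τ.subst f)
  | _, _, _, .dotOO σ τ υ => .dotOO (σ.subst f) (τ.subst f) (υ.subst f)
  | _, _, _, .star σ τ => .star (σ.subst f) (τ.subst f)
  | _, _, _, .ltsr h => .ltsr h
  | _, _, _, .ldot h => .ldot h

/-- Substitution of indices for index variables in a term. -/
def Tm.substI : {n : ℕ} → {q : Q → Idx n} → {m : ℕ} → {Γ : Fin m → Ty Q n} → {T : Ty Q n} →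
    Tm q Γ T → {k : ℕ} → {q' : Q → Idx k} → {Γ' : Fin m → Ty Q k} → (f : Fin n → Idx k) →
    (∀ r, q' r = (q r).subst f) → (∀ i, Γ' i = (Γ i).subst f) → Tm q' Γ' (T.subst f)
  | _, _, _, _, _, .var i h, _, _, _, f, _, hΓ =>
      .var i ((hΓ i).trans (congrArg (Ty.subst f) h))
  | _, _, _, _, _, .lam t, _, _, _, f, hq, hΓ => .lam (t.substI f hq (Fin.cases rfl hΓ))
  | _, _, _, _, _, .app t u, _, _, _, f, hq, hΓ => .app (t.substI f hq hΓ) (u.substI f hq hΓ)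
  | _, _, _, _, _, .lamI t, _, _, _, f, hq, hΓ =>
      .lamI (t.substI (liftI f)
        (fun r => (congrArg (Idx.subst shiftI) (hq r)).trans (Idx.shift_lift f _).symm)
        (fun i => (congrArg (Ty.subst shiftI) (hΓ i)).trans (Ty.shift_lift f _).symm))
  | _, _, _, _, _, .appI t σ h, _, _, _, f, hq, hΓ =>
      .appI (t.substI f hq hΓ) (σ.subst f)
        ((Ty.inst_subst f σ _).trans (congrArg (Ty.subst f) h))
  | _, _, _, _, _, .sum M g, _, _, _, f, hq, hΓ => .sum (M.substI f hq hΓ) (g.substI f hq hΓ)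
  | _, _, _, _, _, .const c, _, _, _, f, _, _ => .const (c.subst f)
  | _, _, _, _, _, .un o t, _, _, _, f, hq, hΓ => .un (o.subst f hq) (t.substI f hq hΓ)
  | _, _, _, _, _, .bin o t u, _, _, _, f, hq, hΓ =>
      .bin (o.subst f) (t.substI f hq hΓ) (u.substI f hq hΓ)

/-- Simultaneous substitution of terms for term variables. -/
def Tm.sub : {n : ℕ} → {q : Q → Idx n} → {m : ℕ} → {Γ : Fin m → Ty Q n} → {T : Ty Q n} →
    Tm q Γ T → {m' : ℕ} → {Γ' : Fin m' → Ty Q n} → ((i : Fin m) → Tm q Γ' (Γ i)) → Tm q Γ' T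
  | _, _, _, _, _, .var i h, _, _, θ => h ▸ θ i
  | _, _, _, _, _, .lam (T := T) t, _, _, θ =>
      .lam (t.sub (Fin.cases (.var 0 rfl) (fun i => (θ i).wk T)))
  | _, _, _, _, _, .app t u, _, _, θ => .app (t.sub θ) (u.sub θ)
  | _, _, _, _, _, .lamI t, _, _, θ =>
      .lamI (t.sub (fun i => (θ i).substI shiftI (fun _ => rfl) (fun _ => rfl)))
  | _, _, _, _, _, .appI t σ h, _, _, θ => .appI (t.sub θ) σ h
  | _, _, _, _, _, .sum M f, _, _, θ => .sum (M.sub θ) (f.sub θ)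
  | _, _, _, _, _, .const c, _, _, _ => .const c
  | _, _, _, _, _, .un o t, _, _, θ => .un o (t.sub θ)
  | _, _, _, _, _, .bin o t u, _, _, θ => .bin o (t.sub θ) (u.sub θ)

/-- `t{x/u}` for the term variable `x` with de Bruijn index `0`. -/
def Tm.inst {n : ℕ} {q : Q → Idx n} {m : ℕ} {Γ : Fin m → Ty Q n} {T U : Ty Q n}
    (t : Tm q (ext U Γ) T) (u : Tm q Γ U) : Tm q Γ T :=
  t.sub (Fin.cases u (fun i => .var i rfl))

/-- `t{x/σ}` for the index variable `x` with de Bruijn index `0`. -/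
def Tm.instIdx {n : ℕ} {q : Q → Idx n} {m : ℕ} {Γ : Fin m → Ty Q n} {T : Ty Q (n + 1)}
    (t : Tm (qI q) (extI Γ) T) (σ : Idx n) : Tm q Γ (T.subst (instI σ)) :=
  t.substI (instI σ) (fun _ => (Idx.shift_inst σ _).symm) (fun _ => (Ty.shift_inst σ _).symm)

end

section

variable {Q : Type}

/-! ### Denotational semantics -/

/-- Finite sets, the values of indices. -/
structure FinSet : Type 1 where
  carrier : Type
  [fintype : Fintype carrier]
  [deceq : DecidableEq carrier]

instance : CoeSort FinSet Type := ⟨FinSet.carrier⟩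
instance (A : FinSet) : Fintype A := A.fintype
instance (A : FinSet) : DecidableEq A := A.deceq

def FinSet.prod (A B : FinSet) : FinSet := ⟨A × B⟩

def Idx.den {n : ℕ} (ρ : Fin n → FinSet) : Idx n → FinSet
  | .var i => ρ i
  | .bool => ⟨Bool⟩
  | .prod σ τ => (σ.den ρ).prod (τ.den ρ)

/-- The standard basis of `H_s`, the tensor product of the spaces `H_r` for `r ∈ s`, where `H_r` has
the standard basis `κ r`: the families of basis elements indexed by `s`. -/
abbrev Cfg (κ : Q → FinSet) (s : Finset Q) : Type := (r : {r // r ∈ s}) → κ r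

/-- Restriction of a basis element of `H_s` to `t ⊆ s`. -/
def Cfg.restrict {κ : Q → FinSet} {s : Finset Q} (f : Cfg κ s) (t : Finset Q) (h : t ⊆ s) :
    Cfg κ t :=
  fun r => f ⟨r, h r.2⟩

/-- Kets are column vectors, bras are row vectors, operators and labelled terms are matrices
(rows are indexed by the codomain). -/
def LTy.den (κ : Q → FinSet) {n : ℕ} (ρ : Fin n → FinSet) : LTy Q n → Type
  | .S => ℂ
  | .K σ => σ.den ρ → ℂ
  | .B σ => σ.den ρ → ℂ
  | .O σ τ => Matrix (σ.den ρ) (τ.den ρ) ℂ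
  | .D s s' => Matrix (Cfg κ s) (Cfg κ s') ℂ

noncomputable instance LTy.instAddCommMonoid (κ : Q → FinSet) {n : ℕ} (ρ : Fin n → FinSet) :
    (L : LTy Q n) → AddCommMonoid (L.den κ ρ)
  | .S => inferInstanceAs (AddCommMonoid ℂ)
  | .K σ => inferInstanceAs (AddCommMonoid (σ.den ρ → ℂ))
  | .B σ => inferInstanceAs (AddCommMonoid (σ.den ρ → ℂ))
  | .O σ τ => inferInstanceAs (AddCommMonoid (Matrix (σ.den ρ) (τ.den ρ) ℂ))
  | .D s s' => inferInstanceAs (AddCommMonoid (Matrix (Cfg κ s) (Cfg κ s') ℂ))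

noncomputable instance LTy.instModule (κ : Q → FinSet) {n : ℕ} (ρ : Fin n → FinSet) :
    (L : LTy Q n) → Module ℂ (L.den κ ρ)
  | .S => inferInstanceAs (Module ℂ ℂ)
  | .K σ => inferInstanceAs (Module ℂ (σ.den ρ → ℂ))
  | .B σ => inferInstanceAs (Module ℂ (σ.den ρ → ℂ))
  | .O σ τ => inferInstanceAs (Module ℂ (Matrix (σ.den ρ) (τ.den ρ) ℂ))
  | .D s s' => inferInstanceAs (Module ℂ (Matrix (Cfg κ s) (Cfg κ s') ℂ))

/-- The values of the indices of the quantum variables. -/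
def denQ {n : ℕ} (q : Q → Idx n) (ρ : Fin n → FinSet) : Q → FinSet := fun r => (q r).den ρ

/-- Extension of a valuation of index variables. -/
def consI {n : ℕ} (A : FinSet) (ρ : Fin n → FinSet) : Fin (n + 1) → FinSet :=
  @Fin.cons n (fun _ => FinSet) A ρ

def Ty.den : {n : ℕ} → (Q → Idx n) → (Fin n → FinSet) → Ty Q n → Type 1
  | _, _, ρ, .basis σ => ULift.{1} (σ.den ρ)
  | _, q, ρ, .lin L => ULift.{1} (L.den (denQ q ρ) ρ)
  | _, _, ρ, .set σ => ULift.{1} (Finset (σ.den ρ))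
  | _, q, ρ, .arr T U => T.den q ρ → U.den q ρ
  | _, q, ρ, .all T => (A : FinSet) → T.den (qI q) (consI A ρ)

theorem Idx.den_subst {n k : ℕ} (f : Fin n → Idx k) (ρ : Fin k → FinSet) (σ : Idx n) :
    (σ.subst f).den ρ = σ.den (fun i => (f i).den ρ) := by
  induction σ with
  | var i => rfl
  | bool => rfl
  | prod σ τ h1 h2 => simp [Idx.subst, Idx.den, h1, h2]

theorem LTy.den_subst (κ : Q → FinSet) {n k : ℕ} (f : Fin n → Idx k) (ρ : Fin k → FinSet)
    (L : LTy Q n) : (L.subst f).den κ ρ = L.den κ (fun i => (f i).den ρ) := by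
  cases L <;> simp [LTy.subst, LTy.den, Idx.den_subst]

theorem den_liftI {n k : ℕ} (f : Fin n → Idx k) (ρ : Fin k → FinSet) (A : FinSet) :
    (fun i => (liftI f i).den (consI A ρ)) = consI A (fun i => (f i).den ρ) := by
  funext i
  refine Fin.cases rfl (fun j => ?_) i
  exact Idx.den_subst shiftI (consI A ρ) (f j)

theorem Ty.den_subst {n : ℕ} (T : Ty Q n) :
    ∀ {k : ℕ} (q : Q → Idx n) (q' : Q → Idx k) (f : Fin n → Idx k) (_ : ∀ r, q' r = (q r).subst f)
      (ρ : Fin k → FinSet), (T.subst f).den q' ρ = T.den q (fun i => (f i).den ρ) := by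
  induction T with
  | basis σ => intro k q q' f hq ρ; simp [Ty.subst, Ty.den, Idx.den_subst]
  | lin L =>
    intro k q q' f hq ρ
    have : denQ q' ρ = denQ q (fun i => (f i).den ρ) := by
      funext r; simp only [denQ, hq, Idx.den_subst]
    simp only [Ty.subst, Ty.den, LTy.den_subst, this]
  | set σ => intro k q q' f hq ρ; simp [Ty.subst, Ty.den, Idx.den_subst]
  | arr T U h1 h2 => intro k q q' f hq ρ; simp only [Ty.subst, Ty.den, h1 q q' f hq, h2 q q' f hq]
  | all T h =>
    intro k q q' f hq ρ
    simp only [Ty.subst, Ty.den]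
    refine pi_congr fun A => ?_
    rw [h (qI q) (qI q') (liftI f)
      (fun r => (congrArg (Idx.subst shiftI) (hq r)).trans (Idx.shift_lift f _).symm), den_liftI]

theorem Ty.den_shift {n : ℕ} (q : Q → Idx n) (ρ : Fin n → FinSet) (A : FinSet) (T : Ty Q n) :
    T.den q ρ = (T.subst shiftI).den (qI q) (consI A ρ) :=
  (Ty.den_subst T q (qI q) shiftI (fun _ => rfl) (consI A ρ)).symm

theorem Ty.den_inst {n : ℕ} (q : Q → Idx n) (ρ : Fin n → FinSet) (σ : Idx n) {T : Ty Q (n + 1)}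
    {U : Ty Q n} (h : T.subst (instI σ) = U) :
    T.den (qI q) (consI (σ.den ρ) ρ) = U.den q ρ := by
  subst h
  rw [Ty.den_subst T (qI q) q (instI σ) (fun r => (Idx.shift_inst σ (q r)).symm) ρ]
  congr 1
  funext i
  exact Fin.cases rfl (fun j => rfl) i

end

section

variable {Q : Type} [LinearOrder Q]

/-- The basis element `i_R` of `H_σ` given by a register `R : Reg(σ)` and a basis element of
`H_{var(R)}`. -/
def Reg.tuple {n : ℕ} (q : Q → Idx n) (ρ : Fin n → FinSet) :
    (R : Reg Q) → Cfg (denQ q ρ) R.vars → (R.idx q).den ρ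
  | .var r, f => f ⟨r, Finset.mem_singleton_self r⟩
  | .pair R R', f =>
      (R.tuple q ρ (f.restrict R.vars Finset.subset_union_left),
        R'.tuple q ρ (f.restrict R'.vars Finset.subset_union_right))

/-- The operator `SWAP_R` from `H_σ` to `H_{var(R)}`, that is `∑_i |i⟩⟨i_R|`. -/
def Reg.swap {n : ℕ} {q : Q → Idx n} (ρ : Fin n → FinSet) (R : Reg Q) {σ : Idx n}
    (hR : R.HasType q σ) {s : Finset Q} (hs : s = R.vars) :
    Matrix (Cfg (denQ q ρ) s) (σ.den ρ) ℂ :=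
  Matrix.of fun f x => if hR.2 ▸ R.tuple q ρ (f.restrict R.vars hs.symm.subset) = x then 1 else 0

/-- The labelled tensor product of two linear maps: the Kronecker product, where
`H_{s₁} ⊗ H_{s₂}` is identified with `H_{s₁ ∪ s₂}` by merging `s₁` and `s₂`. -/
def tsrMat {κ : Q → FinSet} {s₁ s₁' s₂ s₂' s s' : Finset Q} (hs : s = s₁ ∪ s₂)
    (hs' : s' = s₁' ∪ s₂') (A : Matrix (Cfg κ s₁) (Cfg κ s₁') ℂ)
    (B : Matrix (Cfg κ s₂) (Cfg κ s₂') ℂ) : Matrix (Cfg κ s) (Cfg κ s') ℂ :=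
  Matrix.of fun f g =>
    A (f.restrict s₁ (hs ▸ Finset.subset_union_left))
        (g.restrict s₁' (hs' ▸ Finset.subset_union_left)) *
      B (f.restrict s₂ (hs ▸ Finset.subset_union_right))
        (g.restrict s₂' (hs' ▸ Finset.subset_union_right))

/-- The cylindrical extension `A ⊗ 1_t`. -/
def cyl {κ : Q → FinSet} {s₁ s₁' s s' : Finset Q} (A : Matrix (Cfg κ s₁) (Cfg κ s₁') ℂ)
    (t : Finset Q) (hs : s = s₁ ∪ t) (hs' : s' = s₁' ∪ t) : Matrix (Cfg κ s) (Cfg κ s') ℂ :=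
  tsrMat hs hs' A (1 : Matrix (Cfg κ t) (Cfg κ t) ℂ)

/-- Generalized composition: both factors are extended as little as possible and composed. -/
def dotMat {κ : Q → FinSet} {s₁ s₁' s₂ s₂' s s' : Finset Q} (hs : s = s₁ ∪ (s₂ \ s₁'))
    (hs' : s' = s₂' ∪ (s₁' \ s₂)) (A : Matrix (Cfg κ s₁) (Cfg κ s₁') ℂ)
    (B : Matrix (Cfg κ s₂) (Cfg κ s₂') ℂ) : Matrix (Cfg κ s) (Cfg κ s') ℂ :=
  cyl A (s₂ \ s₁') hs (Finset.union_sdiff_self_eq_union (s := s₁') (t := s₂)).symm *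
    cyl B (s₁' \ s₂)
      ((Finset.union_comm s₁' s₂).trans (Finset.union_sdiff_self_eq_union (s := s₂) (t := s₁')).symm)
      hs'

def Op0.eval {n : ℕ} (q : Q → Idx n) (ρ : Fin n → FinSet) :
    {T : Ty Q n} → Op0 Q T → T.den q ρ
  | _, .b0 => ⟨false⟩
  | _, .b1 => ⟨true⟩
  | _, .zeroS => ⟨(0 : ℂ)⟩
  | _, .oneS => ⟨(1 : ℂ)⟩
  | _, .zeroK σ => ⟨(0 : σ.den ρ → ℂ)⟩
  | _, .zeroB σ => ⟨(0 : σ.den ρ → ℂ)⟩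
  | _, .zeroO σ τ => ⟨(0 : Matrix (σ.den ρ) (τ.den ρ) ℂ)⟩
  | _, .oneO σ => ⟨(1 : Matrix (σ.den ρ) (σ.den ρ) ℂ)⟩
  | _, .univ σ => ⟨(Finset.univ : Finset (σ.den ρ))⟩
  | _, .lone (s := s) (s' := s') _ _ =>
      ⟨(Matrix.of fun _ _ => 1 : Matrix (Cfg (denQ q ρ) s) (Cfg (denQ q ρ) s') ℂ)⟩

/-- The standard basis vector at `x`. -/
def basisVec {A : FinSet} (x : A) : A → ℂ := fun y => if y = x then 1 else 0

/-- The value of the quantum variable `r` in a basis element of `H_s`, if `s = {r}`. -/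
def Cfg.at {n : ℕ} {q : Q → Idx n} {ρ : Fin n → FinSet} {s : Finset Q} {r : Q} {σ : Idx n}
    (hr : q r = σ) (hs : s = {r}) (f : Cfg (denQ q ρ) s) : σ.den ρ :=
  hr ▸ (f ⟨r, hs ▸ Finset.mem_singleton_self r⟩ : (q r).den ρ)

noncomputable def Op1.eval {n : ℕ} {q : Q → Idx n} (ρ : Fin n → FinSet) :
    {T U : Ty Q n} → Op1 q T U → T.den q ρ → U.den q ρ
  | _, _, .conj => fun a => ⟨(starRingEnd ℂ a.down : ℂ)⟩
  | _, _, .adjK σ => fun v => ⟨(fun x => starRingEnd ℂ (v.down x) : σ.den ρ → ℂ)⟩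
  | _, _, .adjB σ => fun v => ⟨(fun x => starRingEnd ℂ (v.down x) : σ.den ρ → ℂ)⟩
  | _, _, .adjO σ τ => fun A => ⟨Matrix.conjTranspose (A.down : Matrix (σ.den ρ) (τ.den ρ) ℂ)⟩
  | _, _, .adjD s s' => fun A =>
      ⟨Matrix.conjTranspose (A.down : Matrix (Cfg (denQ q ρ) s) (Cfg (denQ q ρ) s') ℂ)⟩
  | _, _, .ket _ => fun x => ⟨basisVec x.down⟩
  | _, _, .bra _ => fun x => ⟨basisVec x.down⟩
  | _, _, .lket (s := s) (s' := s') _ hr hs _ => fun x =>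
      ⟨(Matrix.of fun f _ => basisVec x.down (f.at hr hs) :
        Matrix (Cfg (denQ q ρ) s) (Cfg (denQ q ρ) s') ℂ)⟩
  | _, _, .lbra (s := s) (s' := s') _ hr _ hs' => fun x =>
      ⟨(Matrix.of fun _ g => basisVec x.down (g.at hr hs') :
        Matrix (Cfg (denQ q ρ) s) (Cfg (denQ q ρ) s') ℂ)⟩
  | _, _, .liftK (s := s) (s' := s') R hR hs _ => fun v =>
      ⟨(Matrix.of fun f _ => Matrix.mulVec (R.swap ρ hR hs) v.down f :
        Matrix (Cfg (denQ q ρ) s) (Cfg (denQ q ρ) s') ℂ)⟩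
  | _, _, .liftB (s := s) (s' := s') R hR _ hs' => fun v =>
      ⟨(Matrix.of fun _ g => Matrix.vecMul v.down (R.swap ρ hR hs').conjTranspose g :
        Matrix (Cfg (denQ q ρ) s) (Cfg (denQ q ρ) s') ℂ)⟩
  | _, _, .liftO (σ := σ) (τ := τ) R R' hR hR' hs hs' =>
      fun (A : ULift.{1} (Matrix (σ.den ρ) (τ.den ρ) ℂ)) =>
      ⟨R.swap ρ hR hs * A.down * (R'.swap ρ hR' hs').conjTranspose⟩

noncomputable def Op2.eval {n : ℕ} (q : Q → Idx n) (ρ : Fin n → FinSet) :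
    {T U V : Ty Q n} → Op2 Q T U V → T.den q ρ → U.den q ρ → V.den q ρ
  | _, _, _, .pair _ _ => fun x y => ⟨(x.down, y.down)⟩
  | _, _, _, .mul => fun (a b : ULift.{1} ℂ) => ⟨a.down * b.down⟩
  | _, _, _, .delta σ => fun x y => ⟨(if (x.down : σ.den ρ) = y.down then 1 else 0 : ℂ)⟩
  | _, _, _, .add L => fun x y => ⟨(x.down + y.down : L.den (denQ q ρ) ρ)⟩
  | _, _, _, .smul (L := L) _ => fun (a : ULift.{1} ℂ) (x : ULift.{1} (L.den (denQ q ρ) ρ)) =>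
      ⟨a.down • x.down⟩
  | _, _, _, .tsrK σ τ => fun v w => ⟨(fun p => v.down p.1 * w.down p.2 : σ.den ρ × τ.den ρ → ℂ)⟩
  | _, _, _, .tsrB σ τ => fun v w => ⟨(fun p => v.down p.1 * w.down p.2 : σ.den ρ × τ.den ρ → ℂ)⟩
  | _, _, _, .tsrO σ τ σ' τ' => fun A B =>
      ⟨Matrix.kroneckerMap (· * ·) (A.down : Matrix (σ.den ρ) (τ.den ρ) ℂ)
        (B.down : Matrix (σ'.den ρ) (τ'.den ρ) ℂ)⟩
  | _, _, _, .dotBK σ => fun (v w : ULift.{1} (σ.den ρ → ℂ)) => ⟨(dotProduct v.down w.down : ℂ)⟩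
  | _, _, _, .dotOK σ τ => fun A v =>
      ⟨Matrix.mulVec (A.down : Matrix (σ.den ρ) (τ.den ρ) ℂ) (v.down : τ.den ρ → ℂ)⟩
  | _, _, _, .dotBO σ τ => fun v A =>
      ⟨Matrix.vecMul (v.down : σ.den ρ → ℂ) (A.down : Matrix (σ.den ρ) (τ.den ρ) ℂ)⟩
  | _, _, _, .dotKB σ τ => fun v w =>
      ⟨Matrix.vecMulVec (v.down : σ.den ρ → ℂ) (w.down : τ.den ρ → ℂ)⟩
  | _, _, _, .dotOO σ τ υ =>
      fun (A : ULift.{1} (Matrix (σ.den ρ) (τ.den ρ) ℂ))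
        (B : ULift.{1} (Matrix (τ.den ρ) (υ.den ρ) ℂ)) => ⟨A.down * B.down⟩
  | _, _, _, .star σ τ => fun M N =>
      ⟨((M.down : Finset (σ.den ρ)) ×ˢ (N.down : Finset (τ.den ρ)) : Finset (σ.den ρ × τ.den ρ))⟩
  | _, _, _, .ltsr h => fun A B => ⟨tsrMat h.2.2.1 h.2.2.2 A.down B.down⟩
  | _, _, _, .ldot h => fun A B => ⟨dotMat h.2.2.1 h.2.2.2 A.down B.down⟩

/-- Values for the term variables of a context. -/
abbrev Env {n m : ℕ} (q : Q → Idx n) (ρ : Fin n → FinSet) (Γ : Fin m → Ty Q n) : Type 1 :=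
  (i : Fin m) → (Γ i).den q ρ

/-- The interpretation of a term under a valuation of the index and term variables. -/
noncomputable def Tm.eval : {n : ℕ} → {q : Q → Idx n} → {m : ℕ} → {Γ : Fin m → Ty Q n} →
    {T : Ty Q n} → Tm q Γ T → (ρ : Fin n → FinSet) → Env q ρ Γ → T.den q ρ
  | _, _, _, _, _, .var i h, _, v => h ▸ v i
  | _, _, _, _, _, .lam t, ρ, v => fun x => t.eval ρ (Fin.cases x v)
  | _, _, _, _, _, .app t u, ρ, v => t.eval ρ v (u.eval ρ v)
  | _, _, _, _, _, .lamI t, ρ, v => fun A =>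
      t.eval (consI A ρ) (fun i => cast (Ty.den_shift _ ρ A _) (v i))
  | _, _, _, _, _, .appI t σ h, ρ, v => cast (Ty.den_inst _ ρ σ h) (t.eval ρ v (σ.den ρ))
  | _, q, _, _, _, .sum (L := L) M f, ρ, v =>
      ⟨(∑ x ∈ (M.eval ρ v).down, (f.eval ρ v ⟨x⟩).down : L.den (denQ q ρ) ρ)⟩
  | _, q, _, _, _, .const c, ρ, _ => c.eval q ρ
  | _, _, _, _, _, .un o t, ρ, v => o.eval ρ (t.eval ρ v)
  | _, q, _, _, _, .bin o t u, ρ, v => o.eval q ρ (t.eval ρ v) (u.eval ρ v)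

/-- The declarations of the term variables of a context, in order: assumptions `x : T` and
definitions `x := t : T`. -/
inductive Decls {n : ℕ} (q : Q → Idx n) : {m : ℕ} → (Fin m → Ty Q n) → Type
  | nil {Γ : Fin 0 → Ty Q n} : Decls q Γ
  | assum {m : ℕ} {Γ : Fin m → Ty Q n} (Δ : Decls q Γ) (T : Ty Q n) : Decls q (ext T Γ)
  | defn {m : ℕ} {Γ : Fin m → Ty Q n} (Δ : Decls q Γ) {T : Ty Q n} (t : Tm q Γ T) :
      Decls q (ext T Γ)

/-- A valuation is valid if it satisfies all definitions of the context. -/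
def Decls.Valid {n : ℕ} {q : Q → Idx n} (ρ : Fin n → FinSet) :
    {m : ℕ} → {Γ : Fin m → Ty Q n} → Decls q Γ → Env q ρ Γ → Prop
  | _, _, .nil, _ => True
  | _, _, .assum Δ _, v => Δ.Valid ρ (fun i => v i.succ)
  | _, _, .defn Δ t, v =>
      Δ.Valid ρ (fun i => v i.succ) ∧ v 0 = t.eval ρ (fun i => v i.succ)

/-- `Γ ⊨ e₁ = e₂`: both terms have the same value under all valid valuations. -/
def Decls.Entails {n : ℕ} {q : Q → Idx n} {m : ℕ} {Γ : Fin m → Ty Q n} (Δ : Decls q Γ)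
    {T : Ty Q n} (e₁ e₂ : Tm q Γ T) : Prop :=
  ∀ (ρ : Fin n → FinSet) (v : Env q ρ Γ), Δ.Valid ρ v → e₁.eval ρ v = e₂.eval ρ v

/-! ### Step 1: expansion of lifted terms into labelled bases -/

/-- The iterated sum `∑_{i_{r₁} ∈ U(q r₁)} ⋯ ∑_{i_{rₖ} ∈ U(q rₖ)} body` for `l = [r₁, …, rₖ]`.  The
body is given in any context `Γ'` into which `Γ` is renamed (by `g`), together with the bound
variables `i_r`. -/
def sumOver {n : ℕ} {q : Q → Idx n} {L : LTy Q n} : (l : List Q) → {m : ℕ} →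
    (Γ : Fin m → Ty Q n) →
    (body : (m' : ℕ) → (Γ' : Fin m' → Ty Q n) → (g : Fin m → Fin m') →
      (∀ j, Γ' (g j) = Γ j) → ((r : Q) → r ∈ l → Tm q Γ' (.basis (q r))) → Tm q Γ' (.lin L)) →
    Tm q Γ (.lin L)
  | [], m, Γ, body => body m Γ id (fun _ => rfl) (fun _ h => absurd h List.not_mem_nil)
  | r :: l, _, Γ, body =>
      .sum (.const (.univ (q r))) (.lam (sumOver l (ext (.basis (q r)) Γ) fun m' Γ' g hg i =>
        body m' Γ' (fun j => g j.succ) (fun j => hg j.succ) fun r' hr' =>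
          if h : r' = r then .var (g 0) (h ▸ hg 0)
          else i r' ((List.mem_cons.mp hr').resolve_left h)))

/-- The bra `⟨i_R|` of a register. -/
def Reg.braTm {n : ℕ} {q : Q → Idx n} {m : ℕ} {Γ : Fin m → Ty Q n} : (R : Reg Q) →
    ((r : Q) → r ∈ R.vars → Tm q Γ (.basis (q r))) → Tm q Γ (.lin (.B (R.idx q)))
  | .var r, i => .un (.bra (q r)) (i r (Finset.mem_singleton_self r))
  | .pair R R', i =>
      .bin (.tsrB _ _) (R.braTm fun r h => i r (Finset.mem_union_left _ h))
        (R'.braTm fun r h => i r (Finset.mem_union_right _ h))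

/-- The ket `|i_R⟩` of a register. -/
def Reg.ketTm {n : ℕ} {q : Q → Idx n} {m : ℕ} {Γ : Fin m → Ty Q n} : (R : Reg Q) →
    ((r : Q) → r ∈ R.vars → Tm q Γ (.basis (q r))) → Tm q Γ (.lin (.K (R.idx q)))
  | .var r, i => .un (.ket (q r)) (i r (Finset.mem_singleton_self r))
  | .pair R R', i =>
      .bin (.tsrK _ _) (R.ketTm fun r h => i r (Finset.mem_union_left _ h))
        (R'.ketTm fun r h => i r (Finset.mem_union_right _ h))

theorem TsrOK.cons_ket {r : Q} {l : List Q} (hl : (r :: l).Nodup) {s s' : Finset Q}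
    (hs : s = (r :: l).toFinset) (hs' : s' = ∅) : TsrOK {r} ∅ l.toFinset ∅ s s' := by
  refine ⟨?_, by simp, ?_, by simp [hs']⟩
  · simpa using (List.nodup_cons.mp hl).1
  · rw [hs, List.toFinset_cons, Finset.insert_eq]

theorem TsrOK.cons_bra {r : Q} {l : List Q} (hl : (r :: l).Nodup) {s s' : Finset Q}
    (hs : s = ∅) (hs' : s' = (r :: l).toFinset) : TsrOK ∅ {r} ∅ l.toFinset s s' := by
  obtain ⟨h1, h2, h3, h4⟩ := TsrOK.cons_ket hl hs' hs
  exact ⟨h2, h1, h4, h3⟩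

/-- The labelled tensor `|i_{r₁}⟩_{r₁} ⊗ ⋯ ⊗ |i_{rₖ}⟩_{rₖ}` for `l = [r₁, …, rₖ]`. -/
def ketsTm {n : ℕ} {q : Q → Idx n} {m : ℕ} {Γ : Fin m → Ty Q n} : (l : List Q) → l.Nodup →
    {s s' : Finset Q} → s = l.toFinset → s' = ∅ →
    ((r : Q) → r ∈ l → Tm q Γ (.basis (q r))) → Tm q Γ (.lin (.D s s'))
  | [], _, _, _, hs, hs', _ => .const (.lone hs hs')
  | r :: l, hl, _, _, hs, hs', i =>
      .bin (.ltsr (TsrOK.cons_ket hl hs hs'))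
        (.un (.lket r rfl rfl rfl) (i r List.mem_cons_self))
        (ketsTm l (List.nodup_cons.mp hl).2 rfl rfl (fun r' h => i r' (List.mem_cons_of_mem r h)))

/-- The labelled tensor `_{r₁}⟨i_{r₁}| ⊗ ⋯ ⊗ _{rₖ}⟨i_{rₖ}|` for `l = [r₁, …, rₖ]`. -/
def brasTm {n : ℕ} {q : Q → Idx n} {m : ℕ} {Γ : Fin m → Ty Q n} : (l : List Q) → l.Nodup →
    {s s' : Finset Q} → s = ∅ → s' = l.toFinset →
    ((r : Q) → r ∈ l → Tm q Γ (.basis (q r))) → Tm q Γ (.lin (.D s s'))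
  | [], _, _, _, hs, hs', _ => .const (.lone hs hs')
  | r :: l, hl, _, _, hs, hs', i =>
      .bin (.ltsr (TsrOK.cons_bra hl hs hs'))
        (.un (.lbra r rfl rfl rfl) (i r List.mem_cons_self))
        (brasTm l (List.nodup_cons.mp hl).2 rfl rfl (fun r' h => i r' (List.mem_cons_of_mem r h)))

/-- The sorted list of the quantum variables of a register. -/
def Reg.list (R : Reg Q) : List Q := R.vars.sort

theorem Reg.mem_list {R : Reg Q} {r : Q} (h : r ∈ R.vars) : r ∈ R.list :=
  (Finset.mem_sort _).mpr h

theorem Reg.list_nodup (R : Reg Q) : R.list.Nodup := Finset.sort_nodup _ _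

theorem Reg.vars_eq (R : Reg Q) : R.vars = R.list.toFinset := (Finset.sort_toFinset _ _).symm

/-- The expansion
`K_R ⟶ ∑_i (⟨i_R| · K) . (|i_{r₁}⟩_{r₁} ⊗ ⋯ ⊗ |i_{rₖ}⟩_{rₖ})`. -/
def expandK {n : ℕ} {q : Q → Idx n} {m : ℕ} {Γ : Fin m → Ty Q n} (R : Reg Q) {s s' : Finset Q}
    (hs : s = R.vars) (hs' : s' = ∅) (K : Tm q Γ (.lin (.K (R.idx q)))) :
    Tm q Γ (.lin (.D s s')) :=
  sumOver R.list Γ fun _ _ g hg i =>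
    .bin (.smul D_ne_S)
      (.bin (.dotBK _) (R.braTm fun r h => i r (Reg.mem_list h)) (K.ren g hg))
      (ketsTm R.list R.list_nodup (hs.trans R.vars_eq) hs' i)

/-- The expansion
`B_R ⟶ ∑_i (B · |i_R⟩) . (_{r₁}⟨i_{r₁}| ⊗ ⋯ ⊗ _{rₖ}⟨i_{rₖ}|)`. -/
def expandB {n : ℕ} {q : Q → Idx n} {m : ℕ} {Γ : Fin m → Ty Q n} (R : Reg Q) {s s' : Finset Q}
    (hs : s = ∅) (hs' : s' = R.vars) (B : Tm q Γ (.lin (.B (R.idx q)))) :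
    Tm q Γ (.lin (.D s s')) :=
  sumOver R.list Γ fun _ _ g hg i =>
    .bin (.smul D_ne_S)
      (.bin (.dotBK _) (B.ren g hg) (R.ketTm fun r h => i r (Reg.mem_list h)))
      (brasTm R.list R.list_nodup hs (hs'.trans R.vars_eq) i)

/-- The expansion `O_{R;R'} ⟶ ∑_i ∑_{i'} (⟨i_R| · O · |i'_{R'}⟩) .
(|i_{r₁}⟩_{r₁} ⊗ ⋯ ⊗ |i_{rₖ}⟩_{rₖ} ⊗ _{r'₁}⟨i'_{r'₁}| ⊗ ⋯ ⊗ _{r'ₗ}⟨i'_{r'ₗ}|)`. -/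
def expandO {n : ℕ} {q : Q → Idx n} {m : ℕ} {Γ : Fin m → Ty Q n} (R R' : Reg Q)
    {s s' : Finset Q} (hs : s = R.vars) (hs' : s' = R'.vars)
    (O : Tm q Γ (.lin (.O (R.idx q) (R'.idx q)))) : Tm q Γ (.lin (.D s s')) :=
  sumOver R.list Γ fun _ Γ₁ g hg i =>
    sumOver R'.list Γ₁ fun _ _ g' hg' i' =>
      .bin (.smul D_ne_S)
        (.bin (.dotBK _)
          (.bin (.dotBO _ _) (R.braTm fun r h => (i r (Reg.mem_list h)).ren g' hg')
            ((O.ren g hg).ren g' hg'))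
          (R'.ketTm fun r h => i' r (Reg.mem_list h)))
        (.bin (.ltsr (s₁ := s) (s₁' := ∅) (s₂ := ∅) (s₂' := s') (by simp [TsrOK]))
          (ketsTm R.list R.list_nodup (hs.trans R.vars_eq) rfl fun r h => (i r h).ren g' hg')
          (brasTm R'.list R'.list_nodup rfl (hs'.trans R'.vars_eq) i'))

section

variable {n : ℕ} {q : Q → Idx n} {m : ℕ} {Γ : Fin m → Ty Q n}

/-- The rules of step 1. -/
inductive Expand : {T : Ty Q n} → Tm q Γ T → Tm q Γ T → Prop
  | ket (R : Reg Q) {s s' : Finset Q} (hR : R.HasType q (R.idx q)) (hs : s = R.vars)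
      (hs' : s' = ∅) (K : Tm q Γ (.lin (.K (R.idx q)))) :
      Expand (.un (.liftK R hR hs hs') K) (expandK R hs hs' K)
  | bra (R : Reg Q) {s s' : Finset Q} (hR : R.HasType q (R.idx q)) (hs : s = ∅)
      (hs' : s' = R.vars) (B : Tm q Γ (.lin (.B (R.idx q)))) :
      Expand (.un (.liftB R hR hs hs') B) (expandB R hs hs' B)
  | opt (R R' : Reg Q) {s s' : Finset Q} (hR : R.HasType q (R.idx q))
      (hR' : R'.HasType q (R'.idx q)) (hs : s = R.vars) (hs' : s' = R'.vars)
      (O : Tm q Γ (.lin (.O (R.idx q) (R'.idx q)))) :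
      Expand (.un (.liftO R R' hR hR' hs hs') O) (expandO R R' hs hs' O)

/-! ### Step 2: rewriting -/

/-- `X + Y`. -/
abbrev Tm.add {L : LTy Q n} (X Y : Tm q Γ (.lin L)) : Tm q Γ (.lin L) := .bin (.add L) X Y

/-- `a.X` for a labelled term `X`. -/
abbrev Tm.smul {s s' : Finset Q} (a : Tm q Γ (.lin .S)) (X : Tm q Γ (.lin (.D s s'))) :
    Tm q Γ (.lin (.D s s')) := .bin (.smul D_ne_S) a X

/-- `∑_{i ∈ M} X`. -/
abbrev Tm.bigSum {L : LTy Q n} {σ : Idx n} (M : Tm q Γ (.set σ))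
    (X : Tm q (ext (.basis σ) Γ) (.lin L)) : Tm q Γ (.lin L) := .sum M (.lam X)

/-- The labelled tensor `X ⊗ Y`. -/
abbrev Tm.tsr {s₁ s₁' s₂ s₂' s s' : Finset Q} (h : TsrOK s₁ s₁' s₂ s₂' s s')
    (X : Tm q Γ (.lin (.D s₁ s₁'))) (Y : Tm q Γ (.lin (.D s₂ s₂'))) : Tm q Γ (.lin (.D s s')) :=
  .bin (.ltsr h) X Y

/-- The generalized composition `X · Y`. -/
abbrev Tm.dot {s₁ s₁' s₂ s₂' s s' : Finset Q} (h : DotOK s₁ s₁' s₂ s₂' s s')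
    (X : Tm q Γ (.lin (.D s₁ s₁'))) (Y : Tm q Γ (.lin (.D s₂ s₂'))) : Tm q Γ (.lin (.D s s')) :=
  .bin (.ldot h) X Y

/-- The adjoint `X^†` of a labelled term. -/
abbrev Tm.adj {s s' : Finset Q} (X : Tm q Γ (.lin (.D s s'))) : Tm q Γ (.lin (.D s' s)) :=
  .un (.adjD s s') X

/-- The labelled basis ket `|i⟩_r`. -/
abbrev Tm.lket (r : Q) {σ : Idx n} (hr : q r = σ) {s s' : Finset Q} (hs : s = {r}) (hs' : s' = ∅)
    (i : Tm q Γ (.basis σ)) : Tm q Γ (.lin (.D s s')) := .un (.lket r hr hs hs') i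

/-- The labelled basis bra `_r⟨i|`. -/
abbrev Tm.lbra (r : Q) {σ : Idx n} (hr : q r = σ) {s s' : Finset Q} (hs : s = ∅) (hs' : s' = {r})
    (i : Tm q Γ (.basis σ)) : Tm q Γ (.lin (.D s s')) := .un (.lbra r hr hs hs') i

/-- The empty labelled tensor. -/
abbrev Tm.lone {s s' : Finset Q} (hs : s = ∅) (hs' : s' = ∅) : Tm q Γ (.lin (.D s s')) :=
  .const (.lone hs hs')

/-- The scalar `δ_{i,j}`. -/
abbrev Tm.delta {σ : Idx n} (i j : Tm q Γ (.basis σ)) : Tm q Γ (.lin .S) := .bin (.delta σ) i j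

/-- The labelled tensor is associative and commutative, and empty tensors can be dropped. -/
inductive TsrAC : {T : Ty Q n} → Tm q Γ T → Tm q Γ T → Prop
  | comm {s₁ s₁' s₂ s₂' s s' : Finset Q} (h : TsrOK s₁ s₁' s₂ s₂' s s')
      (h' : TsrOK s₂ s₂' s₁ s₁' s s') (X : Tm q Γ (.lin (.D s₁ s₁')))
      (Y : Tm q Γ (.lin (.D s₂ s₂'))) : TsrAC (.tsr h X Y) (.tsr h' Y X)
  | assoc {s₁ s₁' s₂ s₂' s₃ s₃' t t' u u' s s' : Finset Q}
      (h₁ : TsrOK s₁ s₁' s₂ s₂' t t') (h₂ : TsrOK t t' s₃ s₃' s s')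
      (h₃ : TsrOK s₂ s₂' s₃ s₃' u u') (h₄ : TsrOK s₁ s₁' u u' s s')
      (X : Tm q Γ (.lin (.D s₁ s₁'))) (Y : Tm q Γ (.lin (.D s₂ s₂')))
      (Z : Tm q Γ (.lin (.D s₃ s₃'))) :
      TsrAC (.tsr h₂ (.tsr h₁ X Y) Z) (.tsr h₄ X (.tsr h₃ Y Z))
  | one {s₁ s₁' s s' : Finset Q} (h : TsrOK s₁ s₁' s s' s s') (hs : s₁ = ∅) (hs' : s₁' = ∅)
      (X : Tm q Γ (.lin (.D s s'))) : TsrAC (.tsr h (.lone hs hs') X) X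

/-- The rules of step 2. -/
inductive Rewrite : {T : Ty Q n} → Tm q Γ T → Tm q Γ T → Prop
  /- function application -/
  | beta {T U : Ty Q n} (t : Tm q (ext T Γ) U) (u : Tm q Γ T) :
      Rewrite (.app (.lam t) u) (t.inst u)
  | betaI {T : Ty Q (n + 1)} (t : Tm (qI q) (extI Γ) T) (σ : Idx n) :
      Rewrite (.appI (.lamI t) σ rfl) (t.instIdx σ)
  /- labelled tensors are rewritten modulo associativity and commutativity -/
  | ac {T : Ty Q n} {t u : Tm q Γ T} (h : TsrAC t u) : Rewrite t u
  /- adjoint -/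
  | adjKet (r : Q) {σ : Idx n} (hr : q r = σ) {s s' : Finset Q} (hs : s = {r}) (hs' : s' = ∅)
      (i : Tm q Γ (.basis σ)) : Rewrite (.adj (.lket r hr hs hs' i)) (.lbra r hr hs' hs i)
  | adjBra (r : Q) {σ : Idx n} (hr : q r = σ) {s s' : Finset Q} (hs : s = ∅) (hs' : s' = {r})
      (i : Tm q Γ (.basis σ)) : Rewrite (.adj (.lbra r hr hs hs' i)) (.lket r hr hs' hs i)
  | adjOne {s s' : Finset Q} (hs : s = ∅) (hs' : s' = ∅) :
      Rewrite (.adj (.lone hs hs' : Tm q Γ _)) (.lone hs' hs)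
  | adjTsr {s₁ s₁' s₂ s₂' s s' : Finset Q} (h : TsrOK s₁ s₁' s₂ s₂' s s')
      (h' : TsrOK s₁' s₁ s₂' s₂ s' s) (X : Tm q Γ (.lin (.D s₁ s₁')))
      (Y : Tm q Γ (.lin (.D s₂ s₂'))) : Rewrite (.adj (.tsr h X Y)) (.tsr h' X.adj Y.adj)
  | adjDot {s₁ s₁' s₂ s₂' s s' : Finset Q} (h : DotOK s₁ s₁' s₂ s₂' s s')
      (h' : DotOK s₂' s₂ s₁' s₁ s' s) (X : Tm q Γ (.lin (.D s₁ s₁')))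
      (Y : Tm q Γ (.lin (.D s₂ s₂'))) : Rewrite (.adj (.dot h X Y)) (.dot h' Y.adj X.adj)
  | adjAdj {s s' : Finset Q} (X : Tm q Γ (.lin (.D s s'))) : Rewrite (.adj X.adj) X
  | adjSmul {s s' : Finset Q} (a : Tm q Γ (.lin .S)) (X : Tm q Γ (.lin (.D s s'))) :
      Rewrite (.adj (.smul a X)) (.smul (.un .conj a) X.adj)
  | adjAdd {s s' : Finset Q} (X Y : Tm q Γ (.lin (.D s s'))) :
      Rewrite (.adj (X.add Y)) (.add X.adj Y.adj)
  | adjSum {s s' : Finset Q} {σ : Idx n} (M : Tm q Γ (.set σ))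
      (X : Tm q (ext (.basis σ) Γ) (.lin (.D s s'))) :
      Rewrite (.adj (M.bigSum X)) (M.bigSum X.adj)
  /- scaling -/
  | smulOne {s s' : Finset Q} (X : Tm q Γ (.lin (.D s s'))) :
      Rewrite (.smul (.const .oneS) X) X
  | smulSmul {s s' : Finset Q} (a b : Tm q Γ (.lin .S)) (X : Tm q Γ (.lin (.D s s'))) :
      Rewrite (.smul a (.smul b X)) (.smul (.bin .mul a b) X)
  | smulAdd {s s' : Finset Q} (a : Tm q Γ (.lin .S)) (X Y : Tm q Γ (.lin (.D s s'))) :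
      Rewrite (.smul a (X.add Y)) (.add (.smul a X) (.smul a Y))
  | smulSum {s s' : Finset Q} {σ : Idx n} (a : Tm q Γ (.lin .S)) (M : Tm q Γ (.set σ))
      (X : Tm q (ext (.basis σ) Γ) (.lin (.D s s'))) :
      Rewrite (.smul a (M.bigSum X)) (M.bigSum (.smul (a.wk _) X))
  | sumSmul {s s' : Finset Q} {σ : Idx n} (M : Tm q Γ (.set σ))
      (a : Tm q (ext (.basis σ) Γ) (.lin .S)) (X : Tm q Γ (.lin (.D s s'))) :
      Rewrite (.smul (M.bigSum a) X) (M.bigSum (.smul a (X.wk _)))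
  /- addition and sums -/
  | addAssoc {s s' : Finset Q} (X Y Z : Tm q Γ (.lin (.D s s'))) :
      Rewrite (.add (X.add Y) Z) (.add X (Y.add Z))
  | sumAdd {s s' : Finset Q} {σ : Idx n} (M : Tm q Γ (.set σ))
      (X Y : Tm q (ext (.basis σ) Γ) (.lin (.D s s'))) :
      Rewrite (M.bigSum (X.add Y)) (.add (M.bigSum X) (M.bigSum Y))
  /- labelled tensor -/
  | tsrSmul {s₁ s₁' s₂ s₂' s s' : Finset Q} (h : TsrOK s₁ s₁' s₂ s₂' s s')
      (a : Tm q Γ (.lin .S)) (X : Tm q Γ (.lin (.D s₁ s₁'))) (Y : Tm q Γ (.lin (.D s₂ s₂'))) :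
      Rewrite (.tsr h (.smul a X) Y) (.smul a (.tsr h X Y))
  | tsrAdd {s₁ s₁' s₂ s₂' s s' : Finset Q} (h : TsrOK s₁ s₁' s₂ s₂' s s')
      (X X' : Tm q Γ (.lin (.D s₁ s₁'))) (Y : Tm q Γ (.lin (.D s₂ s₂'))) :
      Rewrite (.tsr h (X.add X') Y) (.add (.tsr h X Y) (.tsr h X' Y))
  | tsrSum {s₁ s₁' s₂ s₂' s s' : Finset Q} (h : TsrOK s₁ s₁' s₂ s₂' s s') {σ : Idx n}
      (M : Tm q Γ (.set σ)) (X : Tm q (ext (.basis σ) Γ) (.lin (.D s₁ s₁')))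
      (Y : Tm q Γ (.lin (.D s₂ s₂'))) :
      Rewrite (.tsr h (M.bigSum X) Y) (M.bigSum (.tsr h X (Y.wk _)))
  /- generalized composition -/
  | dotSmulL {s₁ s₁' s₂ s₂' s s' : Finset Q} (h : DotOK s₁ s₁' s₂ s₂' s s')
      (a : Tm q Γ (.lin .S)) (X : Tm q Γ (.lin (.D s₁ s₁'))) (Y : Tm q Γ (.lin (.D s₂ s₂'))) :
      Rewrite (.dot h (.smul a X) Y) (.smul a (.dot h X Y))
  | dotSmulR {s₁ s₁' s₂ s₂' s s' : Finset Q} (h : DotOK s₁ s₁' s₂ s₂' s s')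
      (a : Tm q Γ (.lin .S)) (X : Tm q Γ (.lin (.D s₁ s₁'))) (Y : Tm q Γ (.lin (.D s₂ s₂'))) :
      Rewrite (.dot h X (.smul a Y)) (.smul a (.dot h X Y))
  | dotAddL {s₁ s₁' s₂ s₂' s s' : Finset Q} (h : DotOK s₁ s₁' s₂ s₂' s s')
      (X X' : Tm q Γ (.lin (.D s₁ s₁'))) (Y : Tm q Γ (.lin (.D s₂ s₂'))) :
      Rewrite (.dot h (X.add X') Y) (.add (.dot h X Y) (.dot h X' Y))
  | dotAddR {s₁ s₁' s₂ s₂' s s' : Finset Q} (h : DotOK s₁ s₁' s₂ s₂' s s')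
      (X : Tm q Γ (.lin (.D s₁ s₁'))) (Y Y' : Tm q Γ (.lin (.D s₂ s₂'))) :
      Rewrite (.dot h X (Y.add Y')) (.add (.dot h X Y) (.dot h X Y'))
  | dotSumL {s₁ s₁' s₂ s₂' s s' : Finset Q} (h : DotOK s₁ s₁' s₂ s₂' s s') {σ : Idx n}
      (M : Tm q Γ (.set σ)) (X : Tm q (ext (.basis σ) Γ) (.lin (.D s₁ s₁')))
      (Y : Tm q Γ (.lin (.D s₂ s₂'))) :
      Rewrite (.dot h (M.bigSum X) Y) (M.bigSum (.dot h X (Y.wk _)))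
  | dotSumR {s₁ s₁' s₂ s₂' s s' : Finset Q} (h : DotOK s₁ s₁' s₂ s₂' s s') {σ : Idx n}
      (X : Tm q Γ (.lin (.D s₁ s₁'))) (M : Tm q Γ (.set σ))
      (Y : Tm q (ext (.basis σ) Γ) (.lin (.D s₂ s₂'))) :
      Rewrite (.dot h X (M.bigSum Y)) (M.bigSum (.dot h (X.wk _) Y))
  /- elimination of compositions and of bra-ket pairs -/
  | sort0 {s₁ s₁' s₂ s₂' s s' : Finset Q} (h : DotOK s₁ s₁' s₂ s₂' s s')
      (h' : TsrOK s₁ s₁' s₂ s₂' s s') (hd : s₁' ∩ s₂ = ∅) (X : Tm q Γ (.lin (.D s₁ s₁')))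
      (Y : Tm q Γ (.lin (.D s₂ s₂'))) : Rewrite (.dot h X Y) (.tsr h' X Y)
  | sort1 (r : Q) {σ : Idx n} (hr hr' : q r = σ) {s₁ s₁' s₂ s₂' s s' : Finset Q}
      (h₁ : s₁ = ∅) (h₁' : s₁' = {r}) (h₂ : s₂ = {r}) (h₂' : s₂' = ∅) (hs : s = ∅) (hs' : s' = ∅)
      (h : DotOK s₁ s₁' s₂ s₂' s s') (i j : Tm q Γ (.basis σ)) :
      Rewrite (.dot h (.lbra r hr h₁ h₁' i) (.lket r hr' h₂ h₂' j))
        (.smul (.delta i j) (.lone hs hs'))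
  | sort2 (r : Q) {σ : Idx n} (hr hr' : q r = σ) {s₁ s₁' s₂ s₂' t t' s s' : Finset Q}
      (h₁ : s₁ = ∅) (h₁' : s₁' = {r}) (h₂ : s₂ = {r}) (h₂' : s₂' = ∅)
      (hY : TsrOK s₂ s₂' s s' t t') (h : DotOK s₁ s₁' t t' s s')
      (i j : Tm q Γ (.basis σ)) (Y : Tm q Γ (.lin (.D s s'))) :
      Rewrite (.dot h (.lbra r hr h₁ h₁' i) (.tsr hY (.lket r hr' h₂ h₂' j) Y))
        (.smul (.delta i j) Y)
  | sort3 (r : Q) {σ : Idx n} (hr hr' : q r = σ) {s₁ s₁' s₂ s₂' t t' s s' : Finset Q}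
      (h₁ : s₁ = ∅) (h₁' : s₁' = {r}) (h₂ : s₂ = {r}) (h₂' : s₂' = ∅)
      (hX : TsrOK s₁ s₁' s s' t t') (h : DotOK t t' s₂ s₂' s s')
      (i j : Tm q Γ (.basis σ)) (X : Tm q Γ (.lin (.D s s'))) :
      Rewrite (.dot h (.tsr hX (.lbra r hr h₁ h₁' i) X) (.lket r hr' h₂ h₂' j))
        (.smul (.delta i j) X)
  | sort4 (r : Q) {σ : Idx n} (hr hr' : q r = σ)
      {s₁ s₁' s₂ s₂' t t' u u' v v' w w' s s' : Finset Q}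
      (h₁ : s₁ = ∅) (h₁' : s₁' = {r}) (h₂ : s₂ = {r}) (h₂' : s₂' = ∅)
      (hX : TsrOK s₁ s₁' t t' v v') (hY : TsrOK s₂ s₂' u u' w w')
      (h : DotOK v v' w w' s s') (h' : DotOK t t' u u' s s')
      (i j : Tm q Γ (.basis σ)) (X : Tm q Γ (.lin (.D t t'))) (Y : Tm q Γ (.lin (.D u u'))) :
      Rewrite (.dot h (.tsr hX (.lbra r hr h₁ h₁' i) X) (.tsr hY (.lket r hr' h₂ h₂' j) Y))
        (.smul (.delta i j) (.dot h' X Y))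

end

/-- Relations between terms of the same type in the same context. -/
abbrev Rule (Q : Type) [LinearOrder Q] : Type :=
  (n : ℕ) → (q : Q → Idx n) → (m : ℕ) → (Γ : Fin m → Ty Q n) → (T : Ty Q n) →
    Tm q Γ T → Tm q Γ T → Prop

/-- Application of a rule `R` at one position of a term (congruence closure). -/
inductive Cong (R : Rule Q) :
    ∀ {n : ℕ} {q : Q → Idx n} {m : ℕ} {Γ : Fin m → Ty Q n} {T : Ty Q n},
      Tm q Γ T → Tm q Γ T → Prop
  | base {n : ℕ} {q : Q → Idx n} {m : ℕ} {Γ : Fin m → Ty Q n} {T : Ty Q n} {t t' : Tm q Γ T}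
      (h : R n q m Γ T t t') : Cong R t t'
  | lam {n : ℕ} {q : Q → Idx n} {m : ℕ} {Γ : Fin m → Ty Q n} {T U : Ty Q n}
      {t t' : Tm q (ext T Γ) U} (h : Cong R t t') : Cong R (.lam t) (.lam t')
  | appL {n : ℕ} {q : Q → Idx n} {m : ℕ} {Γ : Fin m → Ty Q n} {T U : Ty Q n}
      {t t' : Tm q Γ (.arr T U)} (h : Cong R t t') (u : Tm q Γ T) : Cong R (.app t u) (.app t' u)
  | appR {n : ℕ} {q : Q → Idx n} {m : ℕ} {Γ : Fin m → Ty Q n} {T U : Ty Q n}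
      (t : Tm q Γ (.arr T U)) {u u' : Tm q Γ T} (h : Cong R u u') : Cong R (.app t u) (.app t u')
  | lamI {n : ℕ} {q : Q → Idx n} {m : ℕ} {Γ : Fin m → Ty Q n} {T : Ty Q (n + 1)}
      {t t' : Tm (qI q) (extI Γ) T} (h : Cong R t t') : Cong R (.lamI t) (.lamI t')
  | appI {n : ℕ} {q : Q → Idx n} {m : ℕ} {Γ : Fin m → Ty Q n} {T : Ty Q (n + 1)} {U : Ty Q n}
      {t t' : Tm q Γ (.all T)} (h : Cong R t t') (σ : Idx n) (hU : T.subst (instI σ) = U) :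
      Cong R (.appI t σ hU) (.appI t' σ hU)
  | sumL {n : ℕ} {q : Q → Idx n} {m : ℕ} {Γ : Fin m → Ty Q n} {σ : Idx n} {L : LTy Q n}
      {M M' : Tm q Γ (.set σ)} (h : Cong R M M') (f : Tm q Γ (.arr (.basis σ) (.lin L))) :
      Cong R (.sum M f) (.sum M' f)
  | sumR {n : ℕ} {q : Q → Idx n} {m : ℕ} {Γ : Fin m → Ty Q n} {σ : Idx n} {L : LTy Q n}
      (M : Tm q Γ (.set σ)) {f f' : Tm q Γ (.arr (.basis σ) (.lin L))} (h : Cong R f f') :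
      Cong R (.sum M f) (.sum M f')
  | un {n : ℕ} {q : Q → Idx n} {m : ℕ} {Γ : Fin m → Ty Q n} {T U : Ty Q n} (o : Op1 q T U)
      {t t' : Tm q Γ T} (h : Cong R t t') : Cong R (.un o t) (.un o t')
  | binL {n : ℕ} {q : Q → Idx n} {m : ℕ} {Γ : Fin m → Ty Q n} {T U V : Ty Q n}
      (o : Op2 Q T U V) {t t' : Tm q Γ T} (h : Cong R t t') (u : Tm q Γ U) :
      Cong R (.bin o t u) (.bin o t' u)
  | binR {n : ℕ} {q : Q → Idx n} {m : ℕ} {Γ : Fin m → Ty Q n} {T U V : Ty Q n}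
      (o : Op2 Q T U V) (t : Tm q Γ T) {u u' : Tm q Γ U} (h : Cong R u u') :
      Cong R (.bin o t u) (.bin o t u')

/-- Finitely many applications of the rule `R`. -/
def Reduces (R : Rule Q) {n : ℕ} {q : Q → Idx n} {m : ℕ} {Γ : Fin m → Ty Q n} {T : Ty Q n} (t u : Tm q Γ T) : Prop :=
  Relation.ReflTransGen (Cong R) t u

section

variable {n : ℕ} {q : Q → Idx n}

/-- Tensors of labelled basis kets and bras. -/
inductive IsBasisTensor {m : ℕ} {Γ : Fin m → Ty Q n} :
    {s s' : Finset Q} → Tm q Γ (.lin (.D s s')) → Prop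
  | one {s s' : Finset Q} (hs : s = ∅) (hs' : s' = ∅) : IsBasisTensor (.lone hs hs')
  | ket (r : Q) {σ : Idx n} (hr : q r = σ) {s s' : Finset Q} (hs : s = {r}) (hs' : s' = ∅)
      (i : Tm q Γ (.basis σ)) : IsBasisTensor (.lket r hr hs hs' i)
  | bra (r : Q) {σ : Idx n} (hr : q r = σ) {s s' : Finset Q} (hs : s = ∅) (hs' : s' = {r})
      (i : Tm q Γ (.basis σ)) : IsBasisTensor (.lbra r hr hs hs' i)
  | tsr {s₁ s₁' s₂ s₂' s s' : Finset Q} (h : TsrOK s₁ s₁' s₂ s₂' s s')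
      {X : Tm q Γ (.lin (.D s₁ s₁'))} {Y : Tm q Γ (.lin (.D s₂ s₂'))}
      (hX : IsBasisTensor X) (hY : IsBasisTensor Y) : IsBasisTensor (.tsr h X Y)

/-- Iterated sums `∑_i ⋯ ∑_j a.X` of a tensor `X` of labelled bases, with or without a scalar
coefficient `a`. -/
inductive IsSummand : {m : ℕ} → {Γ : Fin m → Ty Q n} → {s s' : Finset Q} →
    Tm q Γ (.lin (.D s s')) → Prop
  | body {m : ℕ} {Γ : Fin m → Ty Q n} {s s' : Finset Q} {X : Tm q Γ (.lin (.D s s'))}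
      (hX : IsBasisTensor X) : IsSummand X
  | smul {m : ℕ} {Γ : Fin m → Ty Q n} {s s' : Finset Q} (a : Tm q Γ (.lin .S))
      {X : Tm q Γ (.lin (.D s s'))} (hX : IsBasisTensor X) : IsSummand (.smul a X)
  | sum {m : ℕ} {Γ : Fin m → Ty Q n} {s s' : Finset Q} {σ : Idx n} (M : Tm q Γ (.set σ))
      {X : Tm q (ext (.basis σ) Γ) (.lin (.D s s'))} (hX : IsSummand X) :
      IsSummand (M.bigSum X)

/-- The normal form: additions of iterated sums of tensors of labelled bases. -/
inductive IsNormal {m : ℕ} {Γ : Fin m → Ty Q n} {s s' : Finset Q} :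
    Tm q Γ (.lin (.D s s')) → Prop
  | summand {X : Tm q Γ (.lin (.D s s'))} (hX : IsSummand X) : IsNormal X
  | add {X Y : Tm q Γ (.lin (.D s s'))} (hX : IsNormal X) (hY : IsNormal Y) : IsNormal (X.add Y)

/-! ### Step 3: sorting and elimination of labels -/

/-- The index `q r₁ × (⋯ × q rₖ)` for the nonempty list `r₁, …, rₖ`. -/
def prodIdx (q : Q → Idx n) : Q → List Q → Idx n
  | r, [] => q r
  | r, r' :: l => .prod (q r) (prodIdx q r' l)

/-- The plain type of the result of the elimination of labels from a term of type `D(s, s')`. -/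
def plainTy (q : Q → Idx n) (s s' : Finset Q) : LTy Q n :=
  match s.sort, s'.sort with
  | [], [] => .S
  | r :: l, [] => .K (prodIdx q r l)
  | [], r' :: l' => .B (prodIdx q r' l')
  | r :: l, r' :: l' => .O (prodIdx q r l) (prodIdx q r' l')

/-- `DropKets r l X e`: for the list `r :: l = [r₁, …, rₖ]`, `X` is
`|i₁⟩_{r₁} ⊗ (⋯ ⊗ |iₖ⟩_{rₖ})` and `e` is `|i₁⟩ ⊗ (⋯ ⊗ |iₖ⟩)`. -/
inductive DropKets {m : ℕ} {Γ : Fin m → Ty Q n} : Q → List Q → {s s' : Finset Q} →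
    Tm q Γ (.lin (.D s s')) → {σ : Idx n} → Tm q Γ (.lin (.K σ)) → Prop
  | one (r : Q) {σ : Idx n} (hr : q r = σ) {s s' : Finset Q} (hs : s = {r}) (hs' : s' = ∅)
      (i : Tm q Γ (.basis σ)) : DropKets r [] (.lket r hr hs hs' i) (.un (.ket σ) i)
  | cons (r r' : Q) (l : List Q) {σ τ : Idx n} (hr : q r = σ) {s₁ s₁' s₂ s₂' s s' : Finset Q}
      (hs : s₁ = {r}) (hs' : s₁' = ∅) (h : TsrOK s₁ s₁' s₂ s₂' s s') (i : Tm q Γ (.basis σ))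
      {X : Tm q Γ (.lin (.D s₂ s₂'))} {e : Tm q Γ (.lin (.K τ))} (hX : DropKets r' l X e) :
      DropKets r (r' :: l) (.tsr h (.lket r hr hs hs' i) X) (.bin (.tsrK σ τ) (.un (.ket σ) i) e)

/-- `DropBras r l X e`: for the list `r :: l = [r₁, …, rₖ]`, `X` is
`_{r₁}⟨i₁| ⊗ (⋯ ⊗ _{rₖ}⟨iₖ|)` and `e` is `⟨i₁| ⊗ (⋯ ⊗ ⟨iₖ|)`. -/
inductive DropBras {m : ℕ} {Γ : Fin m → Ty Q n} : Q → List Q → {s s' : Finset Q} →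
    Tm q Γ (.lin (.D s s')) → {σ : Idx n} → Tm q Γ (.lin (.B σ)) → Prop
  | one (r : Q) {σ : Idx n} (hr : q r = σ) {s s' : Finset Q} (hs : s = ∅) (hs' : s' = {r})
      (i : Tm q Γ (.basis σ)) : DropBras r [] (.lbra r hr hs hs' i) (.un (.bra σ) i)
  | cons (r r' : Q) (l : List Q) {σ τ : Idx n} (hr : q r = σ) {s₁ s₁' s₂ s₂' s s' : Finset Q}
      (hs : s₁ = ∅) (hs' : s₁' = {r}) (h : TsrOK s₁ s₁' s₂ s₂' s s') (i : Tm q Γ (.basis σ))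
      {X : Tm q Γ (.lin (.D s₂ s₂'))} {e : Tm q Γ (.lin (.B τ))} (hX : DropBras r' l X e) :
      DropBras r (r' :: l) (.tsr h (.lbra r hr hs hs' i) X) (.bin (.tsrB σ τ) (.un (.bra σ) i) e)

/-- `DropBody X e`: `X` is a sorted tensor of labelled bases (kets first, and then by the order of
the quantum variables), and `e` is the plain term obtained by dropping the labels. -/
inductive DropBody {m : ℕ} {Γ : Fin m → Ty Q n} {s s' : Finset Q} :
    Tm q Γ (.lin (.D s s')) → {L : LTy Q n} → Tm q Γ (.lin L) → Prop
  | ketBra {r r' : Q} {l l' : List Q} (hs : s.sort = r :: l) (hs' : s'.sort = r' :: l')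
      {s₁ s₁' s₂ s₂' : Finset Q} (h : TsrOK s₁ s₁' s₂ s₂' s s')
      {X : Tm q Γ (.lin (.D s₁ s₁'))} {Y : Tm q Γ (.lin (.D s₂ s₂'))} {σ τ : Idx n}
      {K : Tm q Γ (.lin (.K σ))} {B : Tm q Γ (.lin (.B τ))} (hX : DropKets r l X K)
      (hY : DropBras r' l' Y B) : DropBody (.tsr h X Y) (.bin (.dotKB σ τ) K B)
  | ket {r : Q} {l : List Q} (hs : s.sort = r :: l) (hs' : s' = ∅)
      {X : Tm q Γ (.lin (.D s s'))} {σ : Idx n} {K : Tm q Γ (.lin (.K σ))}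
      (hX : DropKets r l X K) : DropBody X K
  | bra {r' : Q} {l' : List Q} (hs : s = ∅) (hs' : s'.sort = r' :: l')
      {X : Tm q Γ (.lin (.D s s'))} {τ : Idx n} {B : Tm q Γ (.lin (.B τ))}
      (hX : DropBras r' l' X B) : DropBody X B
  | one (hs : s = ∅) (hs' : s' = ∅) : DropBody (.lone hs hs') (.const .oneS)

/-- `Drop X e`: `X` is a normal form in which all tensors of labelled bases are sorted, and `e` is
the plain term obtained by dropping the labels. -/
inductive Drop {s s' : Finset Q} : {m : ℕ} → {Γ : Fin m → Ty Q n} →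
    Tm q Γ (.lin (.D s s')) → {L : LTy Q n} → Tm q Γ (.lin L) → Prop
  | body {m : ℕ} {Γ : Fin m → Ty Q n} {X : Tm q Γ (.lin (.D s s'))} {L : LTy Q n}
      {e : Tm q Γ (.lin L)} (h : DropBody X e) : Drop X e
  | smul {m : ℕ} {Γ : Fin m → Ty Q n} (a : Tm q Γ (.lin .S)) {X : Tm q Γ (.lin (.D s s'))}
      {L : LTy Q n} {e : Tm q Γ (.lin L)} (hL : L ≠ .S) (h : DropBody X e) :
      Drop (.smul a X) (.bin (.smul hL) a e)
  | scalar {m : ℕ} {Γ : Fin m → Ty Q n} (a : Tm q Γ (.lin .S)) (hs : s = ∅) (hs' : s' = ∅) :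
      Drop (.smul a (.lone hs hs')) a
  | sum {m : ℕ} {Γ : Fin m → Ty Q n} {σ : Idx n} (M : Tm q Γ (.set σ))
      {X : Tm q (ext (.basis σ) Γ) (.lin (.D s s'))} {L : LTy Q n}
      {e : Tm q (ext (.basis σ) Γ) (.lin L)} (h : Drop X e) : Drop (M.bigSum X) (M.bigSum e)
  | add {m : ℕ} {Γ : Fin m → Ty Q n} {X Y : Tm q Γ (.lin (.D s s'))} {L : LTy Q n}
      {e e' : Tm q Γ (.lin L)} (hX : Drop X e) (hY : Drop Y e') : Drop (X.add Y) (e.add e')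

/-- `Normalizes D e`: the plain term `e` is a result of the normalization procedure on `D`: lifted
terms are expanded, the result is rewritten to a normal form, the tensors of labelled bases are
sorted, and the labels are dropped. -/
def Normalizes {m : ℕ} {Γ : Fin m → Ty Q n} {s s' : Finset Q} (D : Tm q Γ (.lin (.D s s')))
    (e : Tm q Γ (.lin (plainTy q s s'))) : Prop :=
  ∃ D₁ D₂ D₃ : Tm q Γ (.lin (.D s s')),
    Reduces (fun _ _ _ _ _ => Expand) D D₁ ∧
      Reduces (fun _ _ _ _ _ => Rewrite) D₁ D₂ ∧ IsNormal D₂ ∧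
      Reduces (fun _ _ _ _ _ => TsrAC) D₂ D₃ ∧ Drop D₃ e

end

end

end LabelledDirac

open LabelledDirac

/-!
The normalization procedure does not change the value of a labelled term until the labels are
dropped, and dropping the labels amounts to the inverse of an injective linear map. So two
labelled terms have the same value under a valuation if and only if their normalizations do.

*Soundness.* Every expansion, rewriting and sorting step preserves values (`Expand.eval_eq`,
`Rewrite.eval_eq`, `TsrAC.eval_eq`), and so do finitely many applications of the rules inside of a
term (`Reduces.eval_eq`). The expansion of a lifted term is the completeness relation of the
standard basis, with `⟨i_R|` as the basis element that the tuple of the `i_r` represents. The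
`β`-rules hold by the substitution lemmas `Tm.eval_sub` and `Tm.eval_substI`. The rules that
contract a bra with a ket are cases of one identity, `dotMat_contract`, and a composition without
common quantum variables is a tensor by `dotMat_of_disjoint`.

*Labels.* For fixed `s`, `s'` and a fixed interpretation of the index variables, the basis of
`H_s` is identified with the tuples of values of the sorted elements of `s`. This yields an
injective linear map `ψ` from the interpretation of `plainTy q s s'` to that of `D(s, s')`
(`exists_label`). A sorted tensor of labelled bases is the image under `ψ` of the term without
labels. By linearity this extends to all sorted normal forms (`Drop.lval_eq`).

*Existence.* Expanding from the inside out removes all lifted terms (`Tm.exists_expand`). Without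
labelled variables, functions take arguments of plain type only, so a `β`-step can neither copy
nor create a labelled subterm: the size `Tm.skel` of the labelled part of such a term is invariant
under substitution (`Tm.skel_sub`), and a `β`-step lowers it by removing the application.
Induction on it (`Tm.normalizable`) reduces the existence of normal forms to their closure under
the labelled operations. The only such operation that does not follow from distributivity is the
composition of two tensors of labelled bases (`IsBasisTensor.dot`), which terminates because every
contraction removes a common quantum variable. A tensor of labelled bases can be sorted since any
of its factors can be moved to the front (`HasFactor`).

*Plainness.* No symbol with a plain result has a labelled argument. Hence a term of plain type
without labelled variables is plain (`Tm.NoLabelledVars.isPlain`), and all rules preserve the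
absence of labelled variables.
-/

namespace LabelledDirac

/-! ### Plain types and variables of plain type -/

section

variable {Q : Type}

theorem LTy.plain_subst {n k : ℕ} (f : Fin n → Idx k) (L : LTy Q n) :
    (Ty.lin (L.subst f)).Plain ↔ (Ty.lin L).Plain := by
  cases L <;> simp [LTy.subst, Ty.Plain]

theorem Ty.plain_subst {n : ℕ} (T : Ty Q n) :
    ∀ {k : ℕ} (f : Fin n → Idx k), (T.subst f).Plain ↔ T.Plain := by
  induction T with
  | basis σ => intro k f; simp [Ty.subst, Ty.Plain]
  | lin L => intro k f; exact LTy.plain_subst f L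
  | set σ => intro k f; simp [Ty.subst, Ty.Plain]
  | arr T U h1 h2 => intro k f; simp [Ty.subst, Ty.Plain, h1, h2]
  | all T h => intro k f; simp [Ty.subst, Ty.Plain, h]

/-- Types in which the domain of every arrow in result position is plain.  These are the only types
of terms without labelled variables. -/
def Ty.PlainArgs : {n : ℕ} → Ty Q n → Prop
  | _, .arr T U => T.Plain ∧ U.PlainArgs
  | _, .all T => T.PlainArgs
  | _, _ => True

theorem Ty.PlainArgs.subst {n : ℕ} {T : Ty Q n} :
    T.PlainArgs → ∀ {k : ℕ} (f : Fin n → Idx k), (T.subst f).PlainArgs := by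
  induction T with
  | basis σ => intro _ k f; trivial
  | lin L => intro _ k f; trivial
  | set σ => intro _ k f; trivial
  | arr T U h1 h2 => intro h k f; exact ⟨(T.plain_subst f).2 h.1, h2 h.2 f⟩
  | all T h => intro h' k f; exact h h' _

theorem Ty.Plain.plainArgs {n : ℕ} {T : Ty Q n} : T.Plain → T.PlainArgs := by
  induction T with
  | basis σ => intro _; trivial
  | lin L => intro _; trivial
  | set σ => intro _; trivial
  | arr T U h1 h2 => intro h; exact ⟨h.1, h2 h.2⟩
  | all T h => intro h'; exact h h'

open Classical in
/-- The number `k` for types in which a labelled type occurs, and `0` for plain types. -/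
noncomputable def Ty.weight {n : ℕ} (T : Ty Q n) (k : ℕ) : ℕ := if T.Plain then 0 else k

theorem Ty.weight_of_plain {n : ℕ} {T : Ty Q n} (h : T.Plain) (k : ℕ) : T.weight k = 0 := if_pos h

theorem Ty.weight_of_not_plain {n : ℕ} {T : Ty Q n} (h : ¬ T.Plain) (k : ℕ) : T.weight k = k :=
  if_neg h

theorem Ty.weight_subst {n : ℕ} (T : Ty Q n) {k : ℕ} (f : Fin n → Idx k) (a : ℕ) :
    (T.subst f).weight a = T.weight a := by
  unfold Ty.weight
  rw [Ty.plain_subst T f]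

end

section

variable {Q : Type} [LinearOrder Q] {n : ℕ} {q : Q → Idx n} {m : ℕ} {Γ : Fin m → Ty Q n}
  {T U : Ty Q n}

/-- An operation on terms that returns a value of plain type takes an argument of plain type. -/
theorem Op1.plain_arg (o : Op1 q T U) (h : U.Plain) : T.Plain := by
  cases o <;> trivial

theorem Op2.plain_args {V : Ty Q n} (o : Op2 Q T U V) (h : V.Plain) : T.Plain ∧ U.Plain := by
  cases o <;> first | exact ⟨trivial, trivial⟩ | exact ⟨h, h⟩ | exact ⟨trivial, h⟩

/-- The argument types of functions come from types of variables, which abstractions bind. -/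
theorem Tm.NoLabelledVars.plainArgs {t : Tm q Γ T} (h : t.NoLabelledVars) : T.PlainArgs := by
  induction t with
  | var i hi => subst hi; exact Ty.Plain.plainArgs h
  | lam t ih => exact ⟨h.1, ih h.2⟩
  | app t u ih1 ih2 => exact (ih1 h.1).2
  | lamI t ih => exact ih h
  | appI t σ hU ih =>
    subst hU
    have h' := ih h
    simp only [Ty.PlainArgs] at h'
    exact h'.subst (instI σ)
  | sum M f => trivial
  | const c => cases c <;> trivial
  | un o t => cases o <;> trivial
  | bin o t u => cases o <;> trivial

/-- Without labelled variables, a labelled subterm cannot disappear inside a term of plain type: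
no symbol has a labelled argument and a plain result, and functions only take plain arguments. -/
theorem Tm.NoLabelledVars.isPlain {t : Tm q Γ T} (h : t.NoLabelledVars) (hT : T.Plain) :
    t.IsPlain := by
  induction t with
  | var i hi => exact hT
  | lam t ih => exact ⟨h.1, ih h.2 hT.2⟩
  | app t u ih1 ih2 =>
    have ha := h.1.plainArgs.1
    exact ⟨hT, ih1 h.1 ⟨ha, hT⟩, ih2 h.2 ha⟩
  | lamI t ih => exact ih h hT
  | appI t σ hU ih =>
    exact ⟨hT, ih h ((Ty.plain_subst _ (instI σ)).1 (hU.symm ▸ hT))⟩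
  | sum M f ih1 ih2 => exact ⟨hT, ih1 h.1 trivial, ih2 h.2 ⟨trivial, hT⟩⟩
  | const c => exact hT
  | un o t ih => exact ⟨hT, ih h (o.plain_arg hT)⟩
  | bin o t u ih1 ih2 =>
    have ha := o.plain_args hT
    exact ⟨hT, ih1 h.1 ha.1, ih2 h.2 ha.2⟩

theorem Tm.IsPlain.plain {t : Tm q Γ T} (h : t.IsPlain) : T.Plain := by
  induction t with
  | var i hi => exact h
  | lam t ih => exact ⟨h.1, ih h.2⟩
  | app t u => exact h.1
  | lamI t ih => exact ih h
  | appI t σ hU ih => exact h.1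
  | sum M f => exact h.1
  | const c => exact h
  | un o t => exact h.1
  | bin o t u => exact h.1

/-! ### Syntactic invariants of renaming and substitution -/

theorem Tm.NoLabelledVars.ren {t : Tm q Γ T} (h : t.NoLabelledVars) {m' : ℕ}
    {Γ' : Fin m' → Ty Q n} (g : Fin m → Fin m') (hg : ∀ i, Γ' (g i) = Γ i) :
    (t.ren g hg).NoLabelledVars := by
  induction t generalizing m' with
  | var i hi => simpa only [Tm.ren, Tm.NoLabelledVars, hg] using h
  | lam t ih => exact ⟨h.1, ih h.2 _ _⟩
  | app t u ih1 ih2 => exact ⟨ih1 h.1 _ _, ih2 h.2 _ _⟩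
  | lamI t ih => exact ih h _ _
  | appI t σ hU ih => exact ih h _ _
  | sum M f ih1 ih2 => exact ⟨ih1 h.1 _ _, ih2 h.2 _ _⟩
  | const c => trivial
  | un o t ih => exact ih h _ _
  | bin o t u ih1 ih2 => exact ⟨ih1 h.1 _ _, ih2 h.2 _ _⟩

theorem Tm.NoLabelledVars.wk {t : Tm q Γ T} (h : t.NoLabelledVars) (U : Ty Q n) :
    (t.wk U).NoLabelledVars := h.ren _ _

theorem Tm.NoLabelledVars.substI {t : Tm q Γ T} (h : t.NoLabelledVars) {k : ℕ} {q' : Q → Idx k}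
    {Γ' : Fin m → Ty Q k} (f : Fin n → Idx k) (hq : ∀ r, q' r = (q r).subst f)
    (hΓ : ∀ i, Γ' i = (Γ i).subst f) : (t.substI f hq hΓ).NoLabelledVars := by
  induction t generalizing k with
  | var i hi => simpa only [Tm.substI, Tm.NoLabelledVars, hΓ, Ty.plain_subst] using h
  | lam t ih => exact ⟨(Ty.plain_subst _ f).2 h.1, ih h.2 _ _ _⟩
  | app t u ih1 ih2 => exact ⟨ih1 h.1 _ _ _, ih2 h.2 _ _ _⟩
  | lamI t ih => exact ih h _ _ _
  | appI t σ hU ih => exact ih h _ _ _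
  | sum M f ih1 ih2 => exact ⟨ih1 h.1 _ _ _, ih2 h.2 _ _ _⟩
  | const c => trivial
  | un o t ih => exact ih h _ _ _
  | bin o t u ih1 ih2 => exact ⟨ih1 h.1 _ _ _, ih2 h.2 _ _ _⟩

theorem Tm.NoLabelledVars.sub {t : Tm q Γ T} (h : t.NoLabelledVars) {m' : ℕ}
    {Γ' : Fin m' → Ty Q n} (θ : (i : Fin m) → Tm q Γ' (Γ i))
    (hθ : ∀ i, (Γ i).Plain → (θ i).NoLabelledVars) : (t.sub θ).NoLabelledVars := by
  induction t generalizing m' with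
  | var i hi => subst hi; exact hθ i h
  | lam t ih =>
    refine ⟨h.1, ih h.2 _ fun i => ?_⟩
    refine Fin.cases (fun h' => h') (fun j hj => (hθ j hj).wk _) i
  | app t u ih1 ih2 => exact ⟨ih1 h.1 _ hθ, ih2 h.2 _ hθ⟩
  | lamI t ih =>
    exact ih h _ fun i hi => (hθ i ((Ty.plain_subst _ shiftI).1 hi)).substI _ _ _
  | appI t σ hU ih => exact ih h _ hθ
  | sum M f ih1 ih2 => exact ⟨ih1 h.1 _ hθ, ih2 h.2 _ hθ⟩
  | const c => trivial
  | un o t ih => exact ih h _ hθ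
  | bin o t u ih1 ih2 => exact ⟨ih1 h.1 _ hθ, ih2 h.2 _ hθ⟩

theorem Tm.NoLabelledVars.inst {t : Tm q (ext U Γ) T} {u : Tm q Γ U} (ht : t.NoLabelledVars)
    (hu : u.NoLabelledVars) : (t.inst u).NoLabelledVars :=
  ht.sub _ fun i => Fin.cases (fun _ => hu) (fun _ h => h) i

theorem Tm.NoLabelledVars.instIdx {T : Ty Q (n + 1)} {t : Tm (qI q) (extI Γ) T}
    (h : t.NoLabelledVars) (σ : Idx n) : (t.instIdx σ).NoLabelledVars :=
  h.substI _ _ _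

/-- The symbols other than the lifted terms `K_R`, `B_R`, `O_{R;R'}`. -/
def Op1.NotLift : {T U : Ty Q n} → Op1 q T U → Prop
  | _, _, .liftK .. => False
  | _, _, .liftB .. => False
  | _, _, .liftO .. => False
  | _, _, _ => True

/-- No lifted term `K_R`, `B_R`, `O_{R;R'}` occurs in the term. -/
def Tm.LiftFree : {n : ℕ} → {q : Q → Idx n} → {m : ℕ} → {Γ : Fin m → Ty Q n} →
    {T : Ty Q n} → Tm q Γ T → Prop
  | _, _, _, _, _, .var _ _ => True
  | _, _, _, _, _, .lam t => t.LiftFree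
  | _, _, _, _, _, .app t u => t.LiftFree ∧ u.LiftFree
  | _, _, _, _, _, .lamI t => t.LiftFree
  | _, _, _, _, _, .appI t _ _ => t.LiftFree
  | _, _, _, _, _, .sum M f => M.LiftFree ∧ f.LiftFree
  | _, _, _, _, _, .const _ => True
  | _, _, _, _, _, .un o t => o.NotLift ∧ t.LiftFree
  | _, _, _, _, _, .bin _ t u => t.LiftFree ∧ u.LiftFree

theorem Tm.LiftFree.ren {t : Tm q Γ T} (h : t.LiftFree) {m' : ℕ}
    {Γ' : Fin m' → Ty Q n} (g : Fin m → Fin m') (hg : ∀ i, Γ' (g i) = Γ i) :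
    (t.ren g hg).LiftFree := by
  induction t generalizing m' with
  | var i hi => trivial
  | lam t ih => exact ih h _ _
  | app t u ih1 ih2 => exact ⟨ih1 h.1 _ _, ih2 h.2 _ _⟩
  | lamI t ih => exact ih h _ _
  | appI t σ hU ih => exact ih h _ _
  | sum M f ih1 ih2 => exact ⟨ih1 h.1 _ _, ih2 h.2 _ _⟩
  | const c => trivial
  | un o t ih => exact ⟨h.1, ih h.2 _ _⟩
  | bin o t u ih1 ih2 => exact ⟨ih1 h.1 _ _, ih2 h.2 _ _⟩

theorem Op1.NotLift.subst {o : Op1 q T U} (h : o.NotLift) {k : ℕ} {q' : Q → Idx k}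
    (f : Fin n → Idx k) (hq : ∀ r, q' r = (q r).subst f) : (o.subst f hq).NotLift := by
  cases o <;> exact h

theorem Tm.LiftFree.substI {t : Tm q Γ T} (h : t.LiftFree) {k : ℕ} {q' : Q → Idx k}
    {Γ' : Fin m → Ty Q k} (f : Fin n → Idx k) (hq : ∀ r, q' r = (q r).subst f)
    (hΓ : ∀ i, Γ' i = (Γ i).subst f) : (t.substI f hq hΓ).LiftFree := by
  induction t generalizing k with
  | var i hi => trivial
  | lam t ih => exact ih h _ _ _
  | app t u ih1 ih2 => exact ⟨ih1 h.1 _ _ _, ih2 h.2 _ _ _⟩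
  | lamI t ih => exact ih h _ _ _
  | appI t σ hU ih => exact ih h _ _ _
  | sum M f ih1 ih2 => exact ⟨ih1 h.1 _ _ _, ih2 h.2 _ _ _⟩
  | const c => trivial
  | un o t ih => exact ⟨h.1.subst _ _, ih h.2 _ _ _⟩
  | bin o t u ih1 ih2 => exact ⟨ih1 h.1 _ _ _, ih2 h.2 _ _ _⟩

theorem Tm.LiftFree.sub {t : Tm q Γ T} (h : t.LiftFree) {m' : ℕ}
    {Γ' : Fin m' → Ty Q n} (θ : (i : Fin m) → Tm q Γ' (Γ i))
    (hθ : ∀ i, (θ i).LiftFree) : (t.sub θ).LiftFree := by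
  induction t generalizing m' with
  | var i hi => subst hi; exact hθ i
  | lam t ih =>
    refine ih h _ fun i => ?_
    refine Fin.cases trivial (fun j => (hθ j).ren _ _) i
  | app t u ih1 ih2 => exact ⟨ih1 h.1 _ hθ, ih2 h.2 _ hθ⟩
  | lamI t ih => exact ih h _ fun i => (hθ i).substI _ _ _
  | appI t σ hU ih => exact ih h _ hθ
  | sum M f ih1 ih2 => exact ⟨ih1 h.1 _ hθ, ih2 h.2 _ hθ⟩
  | const c => trivial
  | un o t ih => exact ⟨h.1, ih h.2 _ hθ⟩
  | bin o t u ih1 ih2 => exact ⟨ih1 h.1 _ hθ, ih2 h.2 _ hθ⟩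

theorem Tm.LiftFree.inst {t : Tm q (ext U Γ) T} {u : Tm q Γ U} (ht : t.LiftFree)
    (hu : u.LiftFree) : (t.inst u).LiftFree :=
  ht.sub _ fun i => Fin.cases hu (fun _ => trivial) i

/-- The number of symbols of a term outside of its subterms of plain type and of the arguments of
its functions. -/
noncomputable def Tm.skel : {n : ℕ} → {q : Q → Idx n} → {m : ℕ} → {Γ : Fin m → Ty Q n} →
    {T : Ty Q n} → Tm q Γ T → ℕ
  | _, _, _, _, _, .var _ _ => 0
  | _, _, _, _, _, .lam (U := U) t => U.weight (t.skel + 1)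
  | _, _, _, _, T, .app t _ => T.weight (t.skel + 1)
  | _, _, _, _, _, .lamI (T := T) t => T.weight (t.skel + 1)
  | _, _, _, _, T, .appI t _ _ => T.weight (t.skel + 1)
  | _, _, _, _, _, .sum (L := L) _ f => (Ty.lin L).weight (f.skel + 1)
  | _, _, _, _, _, .const _ => 0
  | _, _, _, _, T, .un _ t => T.weight (t.skel + 1)
  | _, _, _, _, T, .bin _ t u => T.weight (t.skel + u.skel + 1)

theorem Tm.skel_of_plain (t : Tm q Γ T) (h : T.Plain) : t.skel = 0 := by
  cases t with
  | var | const => rfl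
  | lam t => exact Ty.weight_of_plain h.2 _
  | _ => exact Ty.weight_of_plain h _

theorem Tm.skel_substI (t : Tm q Γ T) {k : ℕ} {q' : Q → Idx k}
    {Γ' : Fin m → Ty Q k} (f : Fin n → Idx k) (hq : ∀ r, q' r = (q r).subst f)
    (hΓ : ∀ i, Γ' i = (Γ i).subst f) : (t.substI f hq hΓ).skel = t.skel := by
  induction t generalizing k with
  | var i hi => rfl
  | const c => rfl
  | bin o t u ih1 ih2 =>
    exact (Ty.weight_subst _ f _).trans
      (congrArg₂ (fun a b => Ty.weight _ (a + b + 1)) (ih1 f hq hΓ) (ih2 f hq hΓ))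
  | @sum _ _ _ _ _ L M g ih1 ih2 =>
    exact (Ty.weight_subst (Ty.lin L) f _).trans
      (congrArg (fun a => Ty.weight _ (a + 1)) (ih2 f hq hΓ))
  | lam t ih =>
    exact (Ty.weight_subst _ f _).trans (congrArg (fun a => Ty.weight _ (a + 1)) (ih f hq _))
  | lamI t ih =>
    exact (Ty.weight_subst _ (liftI f) _).trans
      (congrArg (fun a => Ty.weight _ (a + 1)) (ih (liftI f) _ _))
  | app t u ih | appI t σ hU ih | un o t ih =>
    exact (Ty.weight_subst _ f _).trans (congrArg (fun a => Ty.weight _ (a + 1)) (ih f hq hΓ))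

/-- A substitution acts on variables only, and these have plain type, where the size is `0`. -/
theorem Tm.skel_sub {t : Tm q Γ T} (h : t.NoLabelledVars) {m' : ℕ}
    {Γ' : Fin m' → Ty Q n} (θ : (i : Fin m) → Tm q Γ' (Γ i)) : (t.sub θ).skel = t.skel := by
  induction t generalizing m' with
  | var i hi => subst hi; exact Tm.skel_of_plain _ h
  | const c => rfl
  | lam t ih => exact congrArg (fun a => Ty.weight _ (a + 1)) (ih h.2 _)
  | app t u ih => exact congrArg (fun a => Ty.weight _ (a + 1)) (ih h.1 _)
  | sum M f ih1 ih2 => exact congrArg (fun a => Ty.weight _ (a + 1)) (ih2 h.2 _)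
  | bin o t u ih1 ih2 =>
    exact congrArg₂ (fun a b => Ty.weight _ (a + b + 1)) (ih1 h.1 _) (ih2 h.2 _)
  | lamI t ih | appI t σ hU ih | un o t ih =>
    exact congrArg (fun a => Ty.weight _ (a + 1)) (ih h _)

end

/-! ### Semantics of renaming and substitution -/

section

theorem heq_app {A A' B B' : Type 1} (hA : A = A') (hB : B = B') {f : A → B}
    {f' : A' → B'} (hf : HEq f f') {x : A} {x' : A'} (hx : HEq x x') : HEq (f x) (f' x') := by
  subst hA hB
  cases hf
  cases hx
  rfl

theorem heq_pi_app {A : Type 1} {B B' : A → Type 1} (hB : B = B') {f : (a : A) → B a}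
    {f' : (a : A) → B' a} (hf : HEq f f') {x x' : A} (hx : x = x') : HEq (f x) (f' x') := by
  subst hB hx
  cases hf
  rfl

/-- An operation that is defined uniformly in its index has the same value at equal indices.  The
symbols of the language are such operations, since they are parametric in the sets that interpret
their indices. -/
theorem heq_dep {ι : Type*} {X : ι → Type*} (F : (a : ι) → X a) {a a' : ι} (h : a = a') :
    HEq (F a) (F a') := by
  subst h
  rfl

theorem heq_dep₂ {ι ι' : Type*} {X : ι → ι' → Type*} (F : (a : ι) → (b : ι') → X a b) {a a' : ι}
    (h : a = a') {b b' : ι'} (h' : b = b') : HEq (F a b) (F a' b') := by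
  subst h h'
  rfl

theorem heq_dep₃ {ι : Type*} {X : ι → ι → ι → Type*} (F : (a b c : ι) → X a b c)
    {a a' b b' c c' : ι} (h : a = a') (h' : b = b') (h'' : c = c') :
    HEq (F a b c) (F a' b' c') := by
  subst h h' h''
  rfl

theorem heq_dep₄ {ι : Type*} {X : ι → ι → ι → ι → Type*} (F : (a b c d : ι) → X a b c d)
    {a a' b b' c c' d d' : ι} (h : a = a') (h' : b = b') (h'' : c = c') (h₃ : d = d') :
    HEq (F a b c d) (F a' b' c' d') := by
  subst h h' h'' h₃
  rfl

variable {Q : Type}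

/-- A complex vector space, bundled so that values of types with equal denotations can be compared
together with their linear structure. -/
structure BundledModule : Type 1 where
  carrier : Type
  [addCommMonoid : AddCommMonoid carrier]
  [module : Module ℂ carrier]

attribute [instance] BundledModule.addCommMonoid BundledModule.module

/-- The denotation of a summable type as a bundled vector space. -/
noncomputable def LTy.bundle (κ : Q → FinSet) {n : ℕ} (ρ : Fin n → FinSet) (L : LTy Q n) :
    BundledModule :=
  ⟨L.den κ ρ⟩

theorem LTy.bundle_subst (κ : Q → FinSet) {n k : ℕ} (f : Fin n → Idx k) (ρ : Fin k → FinSet)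
    (L : LTy Q n) : (L.subst f).bundle κ ρ = L.bundle κ (fun i => (f i).den ρ) := by
  cases L with
  | S => rfl
  | K σ => exact congrArg (fun A : FinSet => (⟨A → ℂ⟩ : BundledModule)) (Idx.den_subst f ρ σ)
  | B σ => exact congrArg (fun A : FinSet => (⟨A → ℂ⟩ : BundledModule)) (Idx.den_subst f ρ σ)
  | O σ τ =>
    exact congrArg₂ (fun A B : FinSet => (⟨Matrix A B ℂ⟩ : BundledModule))
      (Idx.den_subst f ρ σ) (Idx.den_subst f ρ τ)
  | D s s' => rfl

theorem denQ_subst {n k : ℕ} {q : Q → Idx n} {q' : Q → Idx k} {f : Fin n → Idx k}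
    (hq : ∀ r, q' r = (q r).subst f) (ρ : Fin k → FinSet) :
    denQ q' ρ = denQ q (fun i => (f i).den ρ) := by
  funext r
  simp only [denQ, hq, Idx.den_subst]

theorem Reg.idx_den_subst {n k : ℕ} {q : Q → Idx n} {q' : Q → Idx k} {f : Fin n → Idx k}
    (hq : ∀ r, q' r = (q r).subst f) (ρ : Fin k → FinSet) (R : Reg Q) :
    (R.idx q').den ρ = (R.idx q).den (fun i => (f i).den ρ) := by
  induction R with
  | var r => exact congrFun (denQ_subst hq ρ) r
  | pair R R' h1 h2 => exact congrArg₂ FinSet.prod h1 h2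

theorem LTy.bundle_denQ_subst {n k : ℕ} {q : Q → Idx n} {q' : Q → Idx k} {f : Fin n → Idx k}
    (hq : ∀ r, q' r = (q r).subst f) (ρ : Fin k → FinSet) (L : LTy Q n) :
    (L.subst f).bundle (denQ q' ρ) ρ =
      L.bundle (denQ q (fun i => (f i).den ρ)) (fun i => (f i).den ρ) := by
  rw [LTy.bundle_subst, denQ_subst hq]

theorem Cfg.at_heq {n : ℕ} {q : Q → Idx n} {ρ : Fin n → FinSet} {s : Finset Q} {r : Q} {σ : Idx n}
    (hr : q r = σ) (hs : s = {r}) (c : Cfg (denQ q ρ) s) :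
    HEq (c.at hr hs) (c ⟨r, hs ▸ Finset.mem_singleton_self r⟩) := by
  subst hr
  rfl

end

section

variable {Q : Type} [LinearOrder Q]

theorem Tm.eval_ren {n : ℕ} {q : Q → Idx n} {m : ℕ} {Γ : Fin m → Ty Q n} {T : Ty Q n}
    (t : Tm q Γ T) {m' : ℕ} {Γ' : Fin m' → Ty Q n} (g : Fin m → Fin m')
    (hg : ∀ i, Γ' (g i) = Γ i) (ρ : Fin n → FinSet) (v : Env q ρ Γ) (v' : Env q ρ Γ')
    (hv : ∀ i, HEq (v' (g i)) (v i)) : (t.ren g hg).eval ρ v' = t.eval ρ v := by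
  induction t generalizing m' with
  | var i hi =>
    subst hi
    simp only [Tm.ren, Tm.eval]
    exact eq_of_heq ((eqRec_heq _ _).trans (hv i))
  | lam t ih =>
    funext x
    exact ih _ _ _ _ _ fun i => Fin.cases HEq.rfl hv i
  | app t u ih1 ih2 => simp only [Tm.ren, Tm.eval, ih1 g hg ρ v v' hv, ih2 g hg ρ v v' hv]
  | lamI t ih =>
    funext A
    exact ih _ _ _ _ _ fun i => (cast_heq _ _).trans ((hv i).trans (cast_heq _ _).symm)
  | appI t σ hU ih => simp only [Tm.ren, Tm.eval, ih g hg ρ v v' hv]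
  | sum M f ih1 ih2 =>
    simp only [Tm.ren, Tm.eval, ih1 g hg ρ v v' hv, ih2 g hg ρ v v' hv]
    rfl
  | const c => rfl
  | un o t ih => simp only [Tm.ren, Tm.eval, ih g hg ρ v v' hv]
  | bin o t u ih1 ih2 => simp only [Tm.ren, Tm.eval, ih1 g hg ρ v v' hv, ih2 g hg ρ v v' hv]

theorem Tm.eval_wk {n : ℕ} {q : Q → Idx n} {m : ℕ} {Γ : Fin m → Ty Q n} {T : Ty Q n}
    (t : Tm q Γ T) (U : Ty Q n) (ρ : Fin n → FinSet) (v : Env q ρ Γ) (x : U.den q ρ) :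
    (t.wk U).eval ρ (Fin.cases x v : Env q ρ (ext U Γ)) = t.eval ρ v :=
  t.eval_ren _ _ ρ v _ fun _ => HEq.rfl

section

variable {n k : ℕ} {q : Q → Idx n} {q' : Q → Idx k} {f : Fin n → Idx k}

theorem Reg.tuple_subst (hq : ∀ r, q' r = (q r).subst f) (ρ : Fin k → FinSet) (R : Reg Q)
    (c : Cfg (denQ q' ρ) R.vars) (c' : Cfg (denQ q (fun i => (f i).den ρ)) R.vars)
    (hc : HEq c c') : HEq (R.tuple q' ρ c) (R.tuple q (fun i => (f i).den ρ) c') := by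
  have hκ := denQ_subst hq ρ
  have key : ∀ (κ κ' : Q → FinSet) (_ : κ = κ') (s t : Finset Q) (h : t ⊆ s) (c : Cfg κ s)
      (c' : Cfg κ' s), HEq c c' → HEq (c.restrict t h) (c'.restrict t h) := by
    rintro κ _ rfl s t h c _ ⟨⟩
    rfl
  induction R with
  | var r =>
    have : ∀ (κ κ' : Q → FinSet) (_ : κ = κ') (c : Cfg κ {r}) (c' : Cfg κ' {r}), HEq c c' →
        HEq (c ⟨r, Finset.mem_singleton_self r⟩) (c' ⟨r, Finset.mem_singleton_self r⟩) := by
      rintro κ _ rfl c _ ⟨⟩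
      rfl
    exact this _ _ hκ c c' hc
  | pair R R' h1 h2 =>
    have : ∀ (A A' B B' : FinSet) (_ : A = A') (_ : B = B') (x : A) (x' : A') (y : B) (y' : B'),
        HEq x x' → HEq y y' → HEq ((x, y) : A.prod B) ((x', y') : A'.prod B') := by
      rintro A _ B _ rfl rfl x _ y _ ⟨⟩ ⟨⟩
      rfl
    exact this _ _ _ _ (R.idx_den_subst hq ρ) (R'.idx_den_subst hq ρ) _ _ _ _
      (h1 _ _ (key _ _ hκ _ _ _ _ _ hc))
      (h2 _ _ (key _ _ hκ _ _ _ _ _ hc))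

theorem Op0.eval_subst (hq : ∀ r, q' r = (q r).subst f) (ρ : Fin k → FinSet) {T : Ty Q n}
    (o : Op0 Q T) : HEq ((o.subst f).eval q' ρ) (o.eval q (fun i => (f i).den ρ)) := by
  have hκ := denQ_subst hq ρ
  have hσ := Idx.den_subst f ρ
  cases o with
  | b0 | b1 | zeroS | oneS => rfl
  | zeroK σ => exact heq_dep (fun A : FinSet => ULift.up.{1} (0 : A → ℂ)) (hσ σ)
  | zeroB σ => exact heq_dep (fun A : FinSet => ULift.up.{1} (0 : A → ℂ)) (hσ σ)
  | zeroO σ τ =>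
    exact heq_dep₂ (fun A B : FinSet => ULift.up.{1} (0 : Matrix A B ℂ)) (hσ σ) (hσ τ)
  | oneO σ => exact heq_dep (fun A : FinSet => ULift.up.{1} (1 : Matrix A A ℂ)) (hσ σ)
  | univ σ => exact heq_dep (fun A : FinSet => ULift.up.{1} (Finset.univ : Finset A)) (hσ σ)
  | @lone s s' hs hs' =>
    exact heq_dep (fun κ : Q → FinSet =>
      ULift.up.{1} (Matrix.of fun _ _ => 1 : Matrix (Cfg κ s) (Cfg κ s') ℂ)) hκ

theorem Op2.eval_subst (hq : ∀ r, q' r = (q r).subst f) (ρ : Fin k → FinSet) {T U V : Ty Q n}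
    (o : Op2 Q T U V) : HEq ((o.subst f).eval q' ρ) (o.eval q (fun i => (f i).den ρ)) := by
  have hκ := denQ_subst hq ρ
  have hσ := Idx.den_subst f ρ
  -- every plain symbol is interpreted uniformly in the values of the indices of its type, so it
  -- can be evaluated at index variables first
  let ρ₄ (A B C D : FinSet) : Fin 4 → FinSet := ![A, B, C, D]
  let q₄ : Q → Idx 4 := fun _ => .bool
  cases o with
  | mul => rfl
  | pair σ τ =>
    exact heq_dep₂ (fun A B => Op2.eval q₄ (ρ₄ A B A A) (.pair (.var 0) (.var 1))) (hσ σ) (hσ τ)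
  | delta σ => exact heq_dep (fun A => Op2.eval q₄ (ρ₄ A A A A) (.delta (.var 0))) (hσ σ)
  | add L =>
    exact heq_dep (fun M : BundledModule => fun x y : ULift.{1} M.carrier =>
      ULift.up.{1} (x.down + y.down)) (LTy.bundle_denQ_subst hq ρ L)
  | @smul L hL =>
    exact heq_dep (fun M : BundledModule => fun (a : ULift.{1} ℂ) (x : ULift.{1} M.carrier) =>
      ULift.up.{1} (a.down • x.down)) (LTy.bundle_denQ_subst hq ρ L)
  | tsrK σ τ =>
    exact heq_dep₂ (fun A B => Op2.eval q₄ (ρ₄ A B A A) (.tsrK (.var 0) (.var 1))) (hσ σ) (hσ τ)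
  | tsrB σ τ =>
    exact heq_dep₂ (fun A B => Op2.eval q₄ (ρ₄ A B A A) (.tsrB (.var 0) (.var 1))) (hσ σ) (hσ τ)
  | tsrO σ τ σ' τ' =>
    exact heq_dep₄ (fun A B C D => Op2.eval q₄ (ρ₄ A B C D)
      (.tsrO (.var 0) (.var 1) (.var 2) (.var 3))) (hσ σ) (hσ τ) (hσ σ') (hσ τ')
  | dotBK σ => exact heq_dep (fun A => Op2.eval q₄ (ρ₄ A A A A) (.dotBK (.var 0))) (hσ σ)
  | dotOK σ τ =>
    exact heq_dep₂ (fun A B => Op2.eval q₄ (ρ₄ A B A A) (.dotOK (.var 0) (.var 1))) (hσ σ) (hσ τ)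
  | dotBO σ τ =>
    exact heq_dep₂ (fun A B => Op2.eval q₄ (ρ₄ A B A A) (.dotBO (.var 0) (.var 1))) (hσ σ) (hσ τ)
  | dotKB σ τ =>
    exact heq_dep₂ (fun A B => Op2.eval q₄ (ρ₄ A B A A) (.dotKB (.var 0) (.var 1))) (hσ σ) (hσ τ)
  | dotOO σ τ υ =>
    exact heq_dep₃ (fun A B C => Op2.eval q₄ (ρ₄ A B C A) (.dotOO (.var 0) (.var 1) (.var 2)))
      (hσ σ) (hσ τ) (hσ υ)
  | star σ τ =>
    exact heq_dep₂ (fun A B => Op2.eval q₄ (ρ₄ A B A A) (.star (.var 0) (.var 1))) (hσ σ) (hσ τ)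
  | @ltsr s₁ s₁' s₂ s₂' s s' h =>
    exact heq_dep (fun κ : Q → FinSet => fun (A : ULift.{1} (Matrix (Cfg κ s₁) (Cfg κ s₁') ℂ))
      (B : ULift.{1} (Matrix (Cfg κ s₂) (Cfg κ s₂') ℂ)) =>
        ULift.up.{1} (tsrMat h.2.2.1 h.2.2.2 A.down B.down)) hκ
  | @ldot s₁ s₁' s₂ s₂' s s' h =>
    exact heq_dep (fun κ : Q → FinSet => fun (A : ULift.{1} (Matrix (Cfg κ s₁) (Cfg κ s₁') ℂ))
      (B : ULift.{1} (Matrix (Cfg κ s₂) (Cfg κ s₂') ℂ)) =>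
        ULift.up.{1} (dotMat h.2.2.1 h.2.2.2 A.down B.down)) hκ

/-- `SWAP_R` is determined by the map `i ↦ i_R`. -/
theorem Reg.swap_subst (hq : ∀ r, q' r = (q r).subst f) (ρ : Fin k → FinSet) (R : Reg Q)
    {σ : Idx n} (hR : R.HasType q σ) {s : Finset Q} (hs : s = R.vars) :
    HEq (R.swap ρ (hR.subst hq) hs) (R.swap (fun i => (f i).den ρ) hR hs) := by
  have hκ := denQ_subst hq ρ
  have key : ∀ (κ κ' : Q → FinSet) (_ : κ = κ') (A A' : FinSet) (_ : A = A') (t : Cfg κ s → A)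
      (t' : Cfg κ' s → A'), HEq t t' →
      HEq (Matrix.of fun c x => if t c = x then (1 : ℂ) else 0 : Matrix (Cfg κ s) A ℂ)
        (Matrix.of fun c x => if t' c = x then 1 else 0 : Matrix (Cfg κ' s) A' ℂ) := by
    rintro κ _ rfl A _ rfl t _ ⟨⟩
    rfl
  refine key _ _ hκ _ _ (Idx.den_subst f ρ σ) _ _ (Function.hfunext (by rw [hκ]) ?_)
  intro c c' hc
  simp only [eqRec_heq_iff, heq_eqRec_iff]
  subst hs
  exact R.tuple_subst hq ρ c c' hc

theorem Op1.eval_subst (hq : ∀ r, q' r = (q r).subst f) (ρ : Fin k → FinSet) {T U : Ty Q n}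
    (o : Op1 q T U) : HEq ((o.subst f hq).eval ρ) (o.eval (fun i => (f i).den ρ)) := by
  have hκ := denQ_subst hq ρ
  have hσ := Idx.den_subst f ρ
  let q₂ : Q → Idx 2 := fun _ => .bool
  let ρ₂ (A B : FinSet) : Fin 2 → FinSet := ![A, B]
  have hat : ∀ {r : Q} {σ : Idx n} (hr : q r = σ) {s : Finset Q} (hs : s = {r}),
      HEq (fun c : Cfg (denQ q' ρ) s => c.at ((hq r).trans (congrArg (Idx.subst f) hr)) hs)
        (fun c : Cfg (denQ q (fun i => (f i).den ρ)) s => c.at hr hs) := by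
    intro r σ hr s hs
    refine Function.hfunext (by rw [hκ]) fun c c' hc => ?_
    refine (Cfg.at_heq _ _ _).trans (HEq.trans ?_ (Cfg.at_heq _ _ _).symm)
    have : ∀ (κ κ' : Q → FinSet) (_ : κ = κ') (x : {r // r ∈ s}) (c : Cfg κ s) (c' : Cfg κ' s),
        HEq c c' → HEq (c x) (c' x) := by
      rintro κ _ rfl x c _ ⟨⟩
      rfl
    exact this _ _ hκ _ c c' hc
  cases o with
  | conj => rfl
  | adjK σ => exact heq_dep (fun A => Op1.eval (q := q₂) (ρ₂ A A) (.adjK (.var 0))) (hσ σ)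
  | adjB σ => exact heq_dep (fun A => Op1.eval (q := q₂) (ρ₂ A A) (.adjB (.var 0))) (hσ σ)
  | adjO σ τ =>
    exact heq_dep₂ (fun A B => Op1.eval (q := q₂) (ρ₂ A B) (.adjO (.var 0) (.var 1))) (hσ σ) (hσ τ)
  | adjD s s' =>
    exact heq_dep (fun κ : Q → FinSet => fun A : ULift.{1} (Matrix (Cfg κ s) (Cfg κ s') ℂ) =>
      ULift.up.{1} A.down.conjTranspose) hκ
  | ket σ => exact heq_dep (fun A => Op1.eval (q := q₂) (ρ₂ A A) (.ket (.var 0))) (hσ σ)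
  | bra σ => exact heq_dep (fun A => Op1.eval (q := q₂) (ρ₂ A A) (.bra (.var 0))) (hσ σ)
  | @lket r σ hr s s' hs hs' =>
    have key : ∀ (κ κ' : Q → FinSet) (_ : κ = κ') (A A' : FinSet) (_ : A = A') (t : Cfg κ s → A)
        (t' : Cfg κ' s → A'), HEq t t' →
        HEq (fun x : ULift.{1} A => ULift.up.{1} (Matrix.of fun c _ => basisVec x.down (t c) :
            Matrix (Cfg κ s) (Cfg κ s') ℂ))
          (fun x : ULift.{1} A' => ULift.up.{1} (Matrix.of fun c _ => basisVec x.down (t' c) :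
            Matrix (Cfg κ' s) (Cfg κ' s') ℂ)) := by
      rintro κ _ rfl A _ rfl t _ ⟨⟩
      rfl
    exact key _ _ hκ _ _ (hσ σ) _ _ (hat hr hs)
  | @lbra r σ hr s s' hs hs' =>
    have key : ∀ (κ κ' : Q → FinSet) (_ : κ = κ') (A A' : FinSet) (_ : A = A') (t : Cfg κ s' → A)
        (t' : Cfg κ' s' → A'), HEq t t' →
        HEq (fun x : ULift.{1} A => ULift.up.{1} (Matrix.of fun _ c => basisVec x.down (t c) :
            Matrix (Cfg κ s) (Cfg κ s') ℂ))
          (fun x : ULift.{1} A' => ULift.up.{1} (Matrix.of fun _ c => basisVec x.down (t' c) :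
            Matrix (Cfg κ' s) (Cfg κ' s') ℂ)) := by
      rintro κ _ rfl A _ rfl t _ ⟨⟩
      rfl
    exact key _ _ hκ _ _ (hσ σ) _ _ (hat hr hs')
  | @liftK R σ hR s s' hs hs' =>
    have key : ∀ (κ κ' : Q → FinSet) (_ : κ = κ') (A A' : FinSet) (_ : A = A')
        (t : Matrix (Cfg κ s) A ℂ) (t' : Matrix (Cfg κ' s) A' ℂ), HEq t t' →
        HEq (fun v : ULift.{1} (A → ℂ) => ULift.up.{1} (Matrix.of fun c _ => t.mulVec v.down c :
            Matrix (Cfg κ s) (Cfg κ s') ℂ))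
          (fun v : ULift.{1} (A' → ℂ) => ULift.up.{1} (Matrix.of fun c _ => t'.mulVec v.down c :
            Matrix (Cfg κ' s) (Cfg κ' s') ℂ)) := by
      rintro κ _ rfl A _ rfl t _ ⟨⟩
      rfl
    exact key _ _ hκ _ _ (hσ σ) _ _ (R.swap_subst hq ρ hR hs)
  | @liftB R σ hR s s' hs hs' =>
    have key : ∀ (κ κ' : Q → FinSet) (_ : κ = κ') (A A' : FinSet) (_ : A = A')
        (t : Matrix (Cfg κ s') A ℂ) (t' : Matrix (Cfg κ' s') A' ℂ), HEq t t' →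
        HEq (fun v : ULift.{1} (A → ℂ) => ULift.up.{1} (Matrix.of fun _ c =>
            Matrix.vecMul v.down t.conjTranspose c : Matrix (Cfg κ s) (Cfg κ s') ℂ))
          (fun v : ULift.{1} (A' → ℂ) => ULift.up.{1} (Matrix.of fun _ c =>
            Matrix.vecMul v.down t'.conjTranspose c : Matrix (Cfg κ' s) (Cfg κ' s') ℂ)) := by
      rintro κ _ rfl A _ rfl t _ ⟨⟩
      rfl
    exact key _ _ hκ _ _ (hσ σ) _ _ (R.swap_subst hq ρ hR hs')
  | @liftO R R' σ τ hR hR' s s' hs hs' =>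
    have key : ∀ (κ κ' : Q → FinSet) (_ : κ = κ') (A A' : FinSet) (_ : A = A') (B B' : FinSet)
        (_ : B = B') (t : Matrix (Cfg κ s) A ℂ) (t' : Matrix (Cfg κ' s) A' ℂ)
        (u : Matrix (Cfg κ s') B ℂ) (u' : Matrix (Cfg κ' s') B' ℂ), HEq t t' → HEq u u' →
        HEq (fun O : ULift.{1} (Matrix A B ℂ) => ULift.up.{1} (t * O.down * u.conjTranspose))
          (fun O : ULift.{1} (Matrix A' B' ℂ) =>
            ULift.up.{1} (t' * O.down * u'.conjTranspose)) := by
      rintro κ _ rfl A _ rfl B _ rfl t _ u _ ⟨⟩ ⟨⟩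
      rfl
    exact key _ _ hκ _ _ (hσ σ) _ _ (hσ τ) _ _ _ _ (R.swap_subst hq ρ hR hs)
      (R'.swap_subst hq ρ hR' hs')

end

/-- Substitution of indices in a term amounts to a change of the valuation of the index variables.
The two values live in types that are only propositionally equal. -/
theorem Tm.eval_substI {n : ℕ} {q : Q → Idx n} {m : ℕ} {Γ : Fin m → Ty Q n} {T : Ty Q n}
    (t : Tm q Γ T) {k : ℕ} {q' : Q → Idx k} {Γ' : Fin m → Ty Q k} (f : Fin n → Idx k)
    (hq : ∀ r, q' r = (q r).subst f) (hΓ : ∀ i, Γ' i = (Γ i).subst f) (ρ : Fin k → FinSet)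
    (ρ' : Fin n → FinSet) (hρ : ρ' = fun i => (f i).den ρ) (v : Env q ρ' Γ) (v' : Env q' ρ Γ')
    (hv : ∀ i, HEq (v' i) (v i)) : HEq ((t.substI f hq hΓ).eval ρ v') (t.eval ρ' v) := by
  induction t generalizing k with
  | var i hi =>
    exact (eqRec_heq _ _).trans ((hv i).trans (eqRec_heq _ _).symm)
  | lam t ih =>
    subst hρ
    refine Function.hfunext (Ty.den_subst _ _ _ f hq ρ) fun x x' hx => ?_
    exact ih f hq _ ρ _ rfl _ _ fun i => Fin.cases hx hv i
  | app t u ih1 ih2 =>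
    subst hρ
    exact heq_app (Ty.den_subst _ _ _ f hq ρ) (Ty.den_subst _ _ _ f hq ρ)
      (ih1 f hq hΓ ρ _ rfl v v' hv) (ih2 f hq hΓ ρ _ rfl v v' hv)
  | lamI t ih =>
    subst hρ
    refine Function.hfunext rfl fun A _ hA => ?_
    cases hA
    exact ih (liftI f) _ _ (consI A ρ) _ (den_liftI f ρ A).symm _ _ fun i =>
      (cast_heq _ _).trans ((hv i).trans (cast_heq _ _).symm)
  | appI t σ hU ih =>
    subst hρ
    refine (cast_heq _ _).trans (HEq.trans ?_ (cast_heq _ _).symm)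
    refine heq_pi_app (funext fun A => ?_) (ih f hq hΓ ρ _ rfl v v' hv) (Idx.den_subst f ρ σ)
    rw [← den_liftI]
    exact Ty.den_subst _ _ _ (liftI f)
      (fun r => (congrArg (Idx.subst shiftI) (hq r)).trans (Idx.shift_lift f _).symm) (consI A ρ)
  | @sum _ q _ _ σ L M g ih1 ih2 =>
    subst hρ
    have key : ∀ (V V' : BundledModule) (_ : V = V') (A A' : FinSet) (_ : A = A')
        (N : ULift.{1} (Finset A)) (N' : ULift.{1} (Finset A'))
        (h : ULift.{1} A → ULift.{1} V.carrier)
        (h' : ULift.{1} A' → ULift.{1} V'.carrier), HEq N N' → HEq h h' →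
        HEq (ULift.up.{1} (∑ x ∈ N.down, (h ⟨x⟩).down))
          (ULift.up.{1} (∑ x ∈ N'.down, (h' ⟨x⟩).down)) := by
      rintro V _ rfl A _ rfl N _ h _ ⟨⟩ ⟨⟩
      rfl
    exact key _ _ (LTy.bundle_denQ_subst hq ρ L) _ _ (Idx.den_subst f ρ σ) _ _ _ _
      (ih1 f hq hΓ ρ _ rfl v v' hv) (ih2 f hq hΓ ρ _ rfl v v' hv)
  | const c =>
    subst hρ
    exact c.eval_subst hq ρ
  | un o t ih =>
    subst hρ
    exact heq_app (Ty.den_subst _ _ _ f hq ρ) (Ty.den_subst _ _ _ f hq ρ) (o.eval_subst hq ρ)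
      (ih f hq hΓ ρ _ rfl v v' hv)
  | bin o t u ih1 ih2 =>
    subst hρ
    have hT := fun T : Ty Q _ => Ty.den_subst T _ _ f hq ρ
    exact heq_app (hT _) (hT _)
      (heq_app (hT _) (congrArg₂ (fun A B => A → B) (hT _) (hT _)) (o.eval_subst hq ρ)
        (ih1 f hq hΓ ρ _ rfl v v' hv)) (ih2 f hq hΓ ρ _ rfl v v' hv)

/-- Substitution of terms amounts to a change of the valuation of the term variables. -/
theorem Tm.eval_sub {n : ℕ} {q : Q → Idx n} {m : ℕ} {Γ : Fin m → Ty Q n} {T : Ty Q n}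
    (t : Tm q Γ T) {m' : ℕ} {Γ' : Fin m' → Ty Q n} (θ : (i : Fin m) → Tm q Γ' (Γ i))
    (ρ : Fin n → FinSet) (v : Env q ρ Γ) (v' : Env q ρ Γ')
    (hv : ∀ i, v i = (θ i).eval ρ v') : (t.sub θ).eval ρ v' = t.eval ρ v := by
  induction t generalizing m' with
  | var i hi =>
    subst hi
    exact (hv i).symm
  | lam t ih =>
    funext x
    refine ih _ _ _ _ fun i => Fin.cases rfl (fun j => ?_) i
    exact (hv j).trans (Tm.eval_wk _ _ _ _ _).symm
  | app t u ih1 ih2 => simp only [Tm.sub, Tm.eval, ih1 θ ρ v v' hv, ih2 θ ρ v v' hv]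
  | lamI t ih =>
    funext A
    refine ih _ _ _ _ fun i => eq_of_heq ((cast_heq _ _).trans ?_)
    rw [hv i]
    exact (Tm.eval_substI (θ i) shiftI _ _ (consI A ρ) ρ rfl v' _ fun j => cast_heq _ _).symm
  | appI t σ hU ih => simp only [Tm.sub, Tm.eval, ih θ ρ v v' hv]
  | sum M f ih1 ih2 =>
    simp only [Tm.sub, Tm.eval, ih1 θ ρ v v' hv, ih2 θ ρ v v' hv]
    rfl
  | const c => rfl
  | un o t ih => simp only [Tm.sub, Tm.eval, ih θ ρ v v' hv]
  | bin o t u ih1 ih2 => simp only [Tm.sub, Tm.eval, ih1 θ ρ v v' hv, ih2 θ ρ v v' hv]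

theorem Tm.eval_inst {n : ℕ} {q : Q → Idx n} {m : ℕ} {Γ : Fin m → Ty Q n} {T U : Ty Q n}
    (t : Tm q (ext U Γ) T) (u : Tm q Γ U) (ρ : Fin n → FinSet) (v : Env q ρ Γ) :
    (t.inst u).eval ρ v = t.eval ρ (Fin.cases (u.eval ρ v) v) :=
  t.eval_sub _ ρ _ v fun i => Fin.cases rfl (fun _ => rfl) i

theorem Tm.eval_instIdx {n : ℕ} {q : Q → Idx n} {m : ℕ} {Γ : Fin m → Ty Q n} {T : Ty Q (n + 1)}
    (t : Tm (qI q) (extI Γ) T) (σ : Idx n) (ρ : Fin n → FinSet) (v : Env q ρ Γ) :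
    (t.instIdx σ).eval ρ v = (Tm.appI t.lamI σ rfl).eval ρ v := by
  refine eq_of_heq (HEq.trans ?_ (cast_heq _ _).symm)
  refine Tm.eval_substI t (instI σ) _ _ ρ _ ?_ _ v fun i => (cast_heq _ _).symm
  funext i
  exact Fin.cases rfl (fun j => rfl) i

end

/-! ### Labelled tensors and generalized compositions of matrices -/

section

variable {Q : Type} {κ : Q → FinSet}

/-- The value of `|i⟩_r`. -/
def ketMat {r : Q} {s s' : Finset Q} (hs : s = {r}) (i : κ r) : Matrix (Cfg κ s) (Cfg κ s') ℂ :=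
  Matrix.of fun f _ => basisVec i (f ⟨r, hs ▸ Finset.mem_singleton_self r⟩)

/-- The value of `_r⟨i|`. -/
def braMat {r : Q} {s s' : Finset Q} (hs' : s' = {r}) (i : κ r) : Matrix (Cfg κ s) (Cfg κ s') ℂ :=
  Matrix.of fun _ g => basisVec i (g ⟨r, hs' ▸ Finset.mem_singleton_self r⟩)

theorem ketMat_conjTranspose {r : Q} {s s' : Finset Q} (hs : s = {r}) (i : κ r) :
    (ketMat hs i : Matrix (Cfg κ s) (Cfg κ s') ℂ).conjTranspose = braMat hs i := by
  ext f g
  simp only [ketMat, braMat, basisVec, Matrix.conjTranspose_apply, Matrix.of_apply]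
  split_ifs <;> simp

theorem braMat_conjTranspose {r : Q} {s s' : Finset Q} (hs' : s' = {r}) (i : κ r) :
    (braMat hs' i : Matrix (Cfg κ s) (Cfg κ s') ℂ).conjTranspose = ketMat hs' i := by
  rw [← ketMat_conjTranspose, Matrix.conjTranspose_conjTranspose]

end

section

variable {Q : Type} [LinearOrder Q] {κ : Q → FinSet}

section tsr

variable {s₁ s₁' s₂ s₂' s₃ s₃' t t' u u' s s' : Finset Q}

theorem tsrMat_add (hs : s = s₁ ∪ s₂) (hs' : s' = s₁' ∪ s₂')
    (A A' : Matrix (Cfg κ s₁) (Cfg κ s₁') ℂ)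
    (B : Matrix (Cfg κ s₂) (Cfg κ s₂') ℂ) :
    tsrMat hs hs' (A + A') B = tsrMat hs hs' A B + tsrMat hs hs' A' B := by
  ext f g
  exact add_mul _ _ _

theorem tsrMat_smul (hs : s = s₁ ∪ s₂) (hs' : s' = s₁' ∪ s₂') (a : ℂ)
    (A : Matrix (Cfg κ s₁) (Cfg κ s₁') ℂ) (B : Matrix (Cfg κ s₂) (Cfg κ s₂') ℂ) :
    tsrMat hs hs' (a • A) B = a • tsrMat hs hs' A B := by
  ext f g
  exact mul_assoc _ _ _

theorem tsrMat_sum (hs : s = s₁ ∪ s₂) (hs' : s' = s₁' ∪ s₂') {ι : Type*} (M : Finset ι)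
    (A : ι → Matrix (Cfg κ s₁) (Cfg κ s₁') ℂ) (B : Matrix (Cfg κ s₂) (Cfg κ s₂') ℂ) :
    tsrMat hs hs' (∑ x ∈ M, A x) B = ∑ x ∈ M, tsrMat hs hs' (A x) B :=
  map_sum (AddMonoidHom.mk' (fun A => tsrMat hs hs' A B) fun A A' => tsrMat_add hs hs' A A' B) A M

theorem tsrMat_comm (hs : s = s₁ ∪ s₂) (hs' : s' = s₁' ∪ s₂') (h : s = s₂ ∪ s₁)
    (h' : s' = s₂' ∪ s₁') (A : Matrix (Cfg κ s₁) (Cfg κ s₁') ℂ)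
    (B : Matrix (Cfg κ s₂) (Cfg κ s₂') ℂ) : tsrMat hs hs' A B = tsrMat h h' B A := by
  ext f g
  exact mul_comm _ _

theorem tsrMat_assoc (ht : t = s₁ ∪ s₂) (ht' : t' = s₁' ∪ s₂') (hs : s = t ∪ s₃)
    (hs' : s' = t' ∪ s₃') (hu : u = s₂ ∪ s₃) (hu' : u' = s₂' ∪ s₃') (h : s = s₁ ∪ u)
    (h' : s' = s₁' ∪ u') (A : Matrix (Cfg κ s₁) (Cfg κ s₁') ℂ)
    (B : Matrix (Cfg κ s₂) (Cfg κ s₂') ℂ) (C : Matrix (Cfg κ s₃) (Cfg κ s₃') ℂ) :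
    tsrMat hs hs' (tsrMat ht ht' A B) C = tsrMat h h' A (tsrMat hu hu' B C) := by
  ext f g
  exact mul_assoc _ _ _

theorem tsrMat_one (hs : s = s₁ ∪ s) (hs' : s' = s₁' ∪ s') (A : Matrix (Cfg κ s) (Cfg κ s') ℂ) :
    tsrMat hs hs' (Matrix.of fun _ _ => 1) A = A := by
  ext f g
  exact one_mul _

theorem tsrMat_conjTranspose (hs : s = s₁ ∪ s₂) (hs' : s' = s₁' ∪ s₂')
    (A : Matrix (Cfg κ s₁) (Cfg κ s₁') ℂ) (B : Matrix (Cfg κ s₂) (Cfg κ s₂') ℂ) :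
    (tsrMat hs hs' A B).conjTranspose = tsrMat hs' hs A.conjTranspose B.conjTranspose := by
  ext f g
  exact map_mul (starRingEnd ℂ) _ _

end tsr

section dot

variable {s₁ s₁' s₂ s₂' s s' : Finset Q}

theorem dotMat_add_left (hs : s = s₁ ∪ (s₂ \ s₁')) (hs' : s' = s₂' ∪ (s₁' \ s₂))
    (A A' : Matrix (Cfg κ s₁) (Cfg κ s₁') ℂ) (B : Matrix (Cfg κ s₂) (Cfg κ s₂') ℂ) :
    dotMat hs hs' (A + A') B = dotMat hs hs' A B + dotMat hs hs' A' B := by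
  simp only [dotMat, cyl, tsrMat_add, Matrix.add_mul]

theorem dotMat_add_right (hs : s = s₁ ∪ (s₂ \ s₁')) (hs' : s' = s₂' ∪ (s₁' \ s₂))
    (A : Matrix (Cfg κ s₁) (Cfg κ s₁') ℂ) (B B' : Matrix (Cfg κ s₂) (Cfg κ s₂') ℂ) :
    dotMat hs hs' A (B + B') = dotMat hs hs' A B + dotMat hs hs' A B' := by
  simp only [dotMat, cyl, tsrMat_add, Matrix.mul_add]

theorem dotMat_smul_left (hs : s = s₁ ∪ (s₂ \ s₁')) (hs' : s' = s₂' ∪ (s₁' \ s₂)) (a : ℂ)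
    (A : Matrix (Cfg κ s₁) (Cfg κ s₁') ℂ) (B : Matrix (Cfg κ s₂) (Cfg κ s₂') ℂ) :
    dotMat hs hs' (a • A) B = a • dotMat hs hs' A B := by
  simp only [dotMat, cyl, tsrMat_smul, Matrix.smul_mul]

theorem dotMat_smul_right (hs : s = s₁ ∪ (s₂ \ s₁')) (hs' : s' = s₂' ∪ (s₁' \ s₂)) (a : ℂ)
    (A : Matrix (Cfg κ s₁) (Cfg κ s₁') ℂ) (B : Matrix (Cfg κ s₂) (Cfg κ s₂') ℂ) :
    dotMat hs hs' A (a • B) = a • dotMat hs hs' A B := by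
  simp only [dotMat, cyl, tsrMat_smul, Matrix.mul_smul]

theorem dotMat_sum_left (hs : s = s₁ ∪ (s₂ \ s₁')) (hs' : s' = s₂' ∪ (s₁' \ s₂)) {ι : Type*}
    (M : Finset ι) (A : ι → Matrix (Cfg κ s₁) (Cfg κ s₁') ℂ)
    (B : Matrix (Cfg κ s₂) (Cfg κ s₂') ℂ) :
    dotMat hs hs' (∑ x ∈ M, A x) B = ∑ x ∈ M, dotMat hs hs' (A x) B := by
  simp only [dotMat, cyl, tsrMat_sum, Matrix.sum_mul]

theorem dotMat_sum_right (hs : s = s₁ ∪ (s₂ \ s₁')) (hs' : s' = s₂' ∪ (s₁' \ s₂)) {ι : Type*}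
    (M : Finset ι) (A : Matrix (Cfg κ s₁) (Cfg κ s₁') ℂ)
    (B : ι → Matrix (Cfg κ s₂) (Cfg κ s₂') ℂ) :
    dotMat hs hs' A (∑ x ∈ M, B x) = ∑ x ∈ M, dotMat hs hs' A (B x) := by
  simp only [dotMat, cyl, tsrMat_sum, Matrix.mul_sum]

theorem cyl_apply {t : Finset Q} (A : Matrix (Cfg κ s₁) (Cfg κ s₁') ℂ) (hs : s = s₁ ∪ t)
    (hs' : s' = s₁' ∪ t) (f : Cfg κ s) (g : Cfg κ s') :
    cyl A t hs hs' f g =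
      if ∀ x (hx : x ∈ t), f ⟨x, hs ▸ Finset.mem_union_right _ hx⟩ =
          g ⟨x, hs' ▸ Finset.mem_union_right _ hx⟩ then
        A (f.restrict s₁ (hs ▸ Finset.subset_union_left))
          (g.restrict s₁' (hs' ▸ Finset.subset_union_left))
      else 0 := by
  simp only [cyl, tsrMat, Matrix.of_apply, Matrix.one_apply, mul_ite, mul_one, mul_zero]
  refine if_congr ?_ rfl rfl
  rw [funext_iff, Subtype.forall]
  exact Iff.rfl

/-- The entries of a generalized composition, with the intermediate set of quantum variables in any
form `w`. -/
theorem dotMat_apply (hs : s = s₁ ∪ (s₂ \ s₁')) (hs' : s' = s₂' ∪ (s₁' \ s₂))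
    (A : Matrix (Cfg κ s₁) (Cfg κ s₁') ℂ) (B : Matrix (Cfg κ s₂) (Cfg κ s₂') ℂ) (f : Cfg κ s)
    (g : Cfg κ s') {w : Finset Q} (h₁ : s₁' ⊆ w) (h₂ : s₂ ⊆ w) (hw : w ⊆ s₁' ∪ s₂) :
    dotMat hs hs' A B f g = ∑ c : Cfg κ w,
      (if ∀ x (hx : x ∈ s₂ \ s₁'), f ⟨x, hs ▸ Finset.mem_union_right _ hx⟩ =
          c ⟨x, h₂ (Finset.mem_sdiff.1 hx).1⟩ then
        A (f.restrict s₁ (hs ▸ Finset.subset_union_left)) (c.restrict s₁' h₁) else 0) *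
      (if ∀ x (hx : x ∈ s₁' \ s₂), c ⟨x, h₁ (Finset.mem_sdiff.1 hx).1⟩ =
          g ⟨x, hs' ▸ Finset.mem_union_right _ hx⟩ then
        B (c.restrict s₂ h₂) (g.restrict s₂' (hs' ▸ Finset.subset_union_left)) else 0) := by
  obtain rfl : w = s₁' ∪ s₂ := hw.antisymm (Finset.union_subset h₁ h₂)
  rw [dotMat, Matrix.mul_apply]
  simp only [cyl_apply]

theorem dotMat_conjTranspose (hs : s = s₁ ∪ (s₂ \ s₁')) (hs' : s' = s₂' ∪ (s₁' \ s₂))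
    (A : Matrix (Cfg κ s₁) (Cfg κ s₁') ℂ) (B : Matrix (Cfg κ s₂) (Cfg κ s₂') ℂ) :
    (dotMat hs hs' A B).conjTranspose = dotMat hs' hs B.conjTranspose A.conjTranspose := by
  ext f g
  rw [Matrix.conjTranspose_apply,
    dotMat_apply hs hs' A B g f Finset.subset_union_left Finset.subset_union_right subset_rfl,
    dotMat_apply hs' hs _ _ f g Finset.subset_union_right Finset.subset_union_left
      (Finset.union_comm _ _).subset, star_sum]
  refine Finset.sum_congr rfl fun c _ => ?_
  rw [star_mul']
  simp only [apply_ite (star : ℂ → ℂ), star_zero, Matrix.conjTranspose_apply]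
  rw [mul_comm]
  congr 1 <;> exact if_congr (forall₂_congr fun _ _ => eq_comm) rfl rfl

/-- If nothing is contracted, generalized composition is the tensor product. -/
theorem dotMat_of_disjoint (hs : s = s₁ ∪ (s₂ \ s₁')) (hs' : s' = s₂' ∪ (s₁' \ s₂))
    (h : s = s₁ ∪ s₂) (h' : s' = s₁' ∪ s₂') (hd : s₁' ∩ s₂ = ∅)
    (A : Matrix (Cfg κ s₁) (Cfg κ s₁') ℂ) (B : Matrix (Cfg κ s₂) (Cfg κ s₂') ℂ) :
    dotMat hs hs' A B = tsrMat h h' A B := by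
  have hd' : ∀ x, x ∈ s₁' → x ∉ s₂ := fun x h1 h2 => by
    simpa [hd] using Finset.mem_inter.2 ⟨h1, h2⟩
  ext f g
  rw [dotMat_apply hs hs' A B f g Finset.subset_union_left Finset.subset_union_right subset_rfl]
  -- the only intermediate basis element that contributes agrees with `f` on `s₂`, with `g` on `s₁'`
  let c₀ : Cfg κ (s₁' ∪ s₂) := fun x =>
    if hx : x.1 ∈ s₂ then f ⟨x, h ▸ Finset.mem_union_right _ hx⟩
    else g ⟨x, h' ▸ Finset.mem_union_left _ ((Finset.mem_union.1 x.2).resolve_right hx)⟩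
  have hf : ∀ x (hx : x ∈ s₂), c₀ ⟨x, Finset.mem_union_right _ hx⟩ =
      f ⟨x, h ▸ Finset.mem_union_right _ hx⟩ := fun x hx => dif_pos hx
  have hg : ∀ x (hx : x ∈ s₁'), c₀ ⟨x, Finset.mem_union_left _ hx⟩ =
      g ⟨x, h' ▸ Finset.mem_union_left _ hx⟩ := fun x hx => dif_neg (hd' x hx)
  rw [Finset.sum_eq_single c₀]
  · rw [if_pos fun x hx => (hf x (Finset.mem_sdiff.1 hx).1).symm,
      if_pos fun x hx => hg x (Finset.mem_sdiff.1 hx).1]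
    refine congrArg₂ (· * ·) (congrArg (A _) ?_) (congrArg (B · _) ?_)
    · funext x
      exact hg x x.2
    · funext x
      exact hf x x.2
  · intro c _ hc
    by_contra hne
    obtain ⟨h1, h2⟩ := mul_ne_zero_iff.1 hne
    have h1 := (ite_ne_right_iff.1 h1).1
    have h2 := (ite_ne_right_iff.1 h2).1
    refine hc (funext fun x => ?_)
    by_cases hx : x.1 ∈ s₂
    · exact (h1 x (Finset.mem_sdiff.2 ⟨hx, fun h => hd' x h hx⟩)).symm.trans (hf x hx).symm
    · have hx' := (Finset.mem_union.1 x.2).resolve_right hx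
      exact (h2 x (Finset.mem_sdiff.2 ⟨hx', hx⟩)).trans (hg x hx').symm
  · exact fun h => absurd (Finset.mem_univ _) h

end dot

/-- Splitting off the value of one quantum variable. -/
def Cfg.insertEquiv {W : Finset Q} {r : Q} (hr : r ∉ W) :
    Cfg κ (insert r W) ≃ κ r × Cfg κ W where
  toFun c := (c ⟨r, Finset.mem_insert_self r W⟩, c.restrict W (Finset.subset_insert r W))
  invFun p := fun x => if h : x.1 = r then cast (by rw [h]) p.1
    else p.2 ⟨x, (Finset.mem_insert.1 x.2).resolve_left h⟩
  left_inv c := by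
    funext ⟨x, hx⟩
    by_cases h : x = r
    · subst h
      exact dif_pos rfl
    · exact dif_neg h
  right_inv p := by
    refine Prod.ext (dif_pos rfl) (funext fun x => ?_)
    exact dif_neg (fun h : x.1 = r => hr (h ▸ x.2))

/-- Contraction of the bra and the ket of one quantum variable in a generalized composition: the sum
over the intermediate basis elements splits into a sum over the values of `r` and the sum that
computes the composition of the remaining factors. -/
theorem dotMat_contract {r : Q} {s₁ s₁' s₂ s₂' t t' u u' v v' w w' s s' : Finset Q}
    (h₁ : s₁ = ∅) (h₁' : s₁' = {r}) (h₂ : s₂ = {r}) (h₂' : s₂' = ∅)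
    (hX : TsrOK s₁ s₁' t t' v v') (hY : TsrOK s₂ s₂' u u' w w')
    (h : DotOK v v' w w' s s') (h' : DotOK t t' u u' s s') (i j : κ r)
    (X : Matrix (Cfg κ t) (Cfg κ t') ℂ) (Y : Matrix (Cfg κ u) (Cfg κ u') ℂ) :
    dotMat h.2.2.1 h.2.2.2 (tsrMat hX.2.2.1 hX.2.2.2 (braMat h₁' i) X)
        (tsrMat hY.2.2.1 hY.2.2.2 (ketMat h₂ j) Y) =
      (if i = j then 1 else 0 : ℂ) • dotMat h'.2.2.1 h'.2.2.2 X Y := by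
  subst h₁ h₁' h₂ h₂'
  have hv : v = t := by simpa using hX.2.2.1
  have hv' : v' = insert r t' := hX.2.2.2
  have hw : w = insert r u := hY.2.2.1
  have hw' : w' = u' := by simpa using hY.2.2.2
  have hrt : r ∉ t' := by simpa using hX.2.1
  have hru : r ∉ u := by simpa using hY.1
  have hr : r ∉ t' ∪ u := by simp [hrt, hru]
  ext f g
  rw [dotMat_apply (w := insert r (t' ∪ u)) _ _ _ _ f g
      (by rw [hv']; exact Finset.insert_subset_insert _ Finset.subset_union_left)
      (by rw [hw]; exact Finset.insert_subset_insert _ Finset.subset_union_right)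
      (by rw [hv', hw]; intro x; simp only [Finset.mem_insert, Finset.mem_union]; tauto),
    Matrix.smul_apply, dotMat_apply (w := t' ∪ u) _ _ X Y f g
      Finset.subset_union_left Finset.subset_union_right subset_rfl,
    ← (Cfg.insertEquiv hr).symm.sum_comp, Fintype.sum_prod_type, Finset.sum_comm,
    Finset.smul_sum]
  refine Finset.sum_congr rfl fun c _ => ?_
  have hcr : ∀ x, (Cfg.insertEquiv hr).symm (x, c) ⟨r, Finset.mem_insert_self _ _⟩ = x :=
    fun x => congrArg Prod.fst ((Cfg.insertEquiv hr).apply_symm_apply (x, c))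
  have hcW : ∀ x y (hy : y ∈ t' ∪ u), (Cfg.insertEquiv hr).symm (x, c)
      ⟨y, Finset.mem_insert_of_mem hy⟩ = c ⟨y, hy⟩ :=
    fun x y hy =>
      congrFun (congrArg Prod.snd ((Cfg.insertEquiv hr).apply_symm_apply (x, c))) ⟨y, hy⟩
  have hA : ∀ x (h₁ h₂), tsrMat hX.2.2.1 hX.2.2.2 (braMat rfl i) X (f.restrict v h₁)
      (((Cfg.insertEquiv hr).symm (x, c)).restrict v' h₂) =
      (if x = i then 1 else 0) * X (f.restrict t (hv ▸ h₁))
        (c.restrict t' Finset.subset_union_left) := fun x h₁ h₂ =>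
    congrArg₂ (· * ·) (congrArg (basisVec i) (hcr x))
      (congrArg (X _) (funext fun y => hcW x y (Finset.mem_union_left _ y.2)))
  have hB : ∀ x (h₁ h₂), tsrMat hY.2.2.1 hY.2.2.2 (ketMat rfl j) Y
      (((Cfg.insertEquiv hr).symm (x, c)).restrict w h₁) (g.restrict w' h₂) =
      (if x = j then 1 else 0) * Y (c.restrict u Finset.subset_union_right)
        (g.restrict u' (hw' ▸ h₂)) := fun x h₁ h₂ =>
    congrArg₂ (· * ·) (congrArg (basisVec j) (hcr x))
      (congrArg (Y · _) (funext fun y => hcW x y (Finset.mem_union_right _ y.2)))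
  have hsub : w \ v' = u \ t' := by
    rw [hw, hv']; ext x; by_cases hx : x = r <;> simp [hx, hru]
  have hsub' : v' \ w = t' \ u := by
    rw [hw, hv']; ext x; by_cases hx : x = r <;> simp [hx, hrt]
  have hP : ∀ x (h₁ : ∀ y ∈ w \ v', y ∈ s) (h₂ : ∀ y ∈ w \ v', y ∈ insert r (t' ∪ u)),
      (∀ y (hy : y ∈ w \ v'), f ⟨y, h₁ y hy⟩ =
      (Cfg.insertEquiv hr).symm (x, c) ⟨y, h₂ y hy⟩) ↔ ∀ y (hy : y ∈ u \ t'),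
      f ⟨y, h₁ y (hsub ▸ hy)⟩ = c ⟨y, Finset.mem_union_right _ (Finset.mem_sdiff.1 hy).1⟩ := by
    intro x h₁ h₂
    constructor
    · exact fun H y hy => (H y (hsub ▸ hy)).trans (hcW x y _)
    · exact fun H y hy => (H y (hsub ▸ hy)).trans (hcW x y _).symm
  have hP' : ∀ x (h₁ : ∀ y ∈ v' \ w, y ∈ insert r (t' ∪ u)) (h₂ : ∀ y ∈ v' \ w, y ∈ s'),
      (∀ y (hy : y ∈ v' \ w), (Cfg.insertEquiv hr).symm (x, c) ⟨y, h₁ y hy⟩ =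
      g ⟨y, h₂ y hy⟩) ↔ ∀ y (hy : y ∈ t' \ u),
      c ⟨y, Finset.mem_union_left _ (Finset.mem_sdiff.1 hy).1⟩ = g ⟨y, h₂ y (hsub' ▸ hy)⟩ := by
    intro x h₁ h₂
    constructor
    · exact fun H y hy => (hcW x y _).symm.trans (H y (hsub' ▸ hy))
    · exact fun H y hy => (hcW x y _).trans (H y (hsub' ▸ hy))
  simp only [hA, hB, hP, hP']
  rw [Finset.sum_eq_single i]
  · by_cases hij : i = j
    · simp only [if_pos hij, if_true, one_mul, one_smul]
    · simp only [if_neg hij, zero_mul, zero_smul, ite_self, mul_zero]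
  · intro x _ hx
    simp only [if_neg hx, zero_mul, ite_self]
  · exact fun h => absurd (Finset.mem_univ _) h

/-- Composition with the empty tensor. -/
theorem dotMat_one_left {t t' s s' : Finset Q} (ht : t = ∅) (ht' : t' = ∅)
    (hs : s = t ∪ (s \ t')) (hs' : s' = s' ∪ (t' \ s)) (A : Matrix (Cfg κ s) (Cfg κ s') ℂ) :
    dotMat hs hs' (Matrix.of fun _ _ => 1 : Matrix (Cfg κ t) (Cfg κ t') ℂ) A = A := by
  subst ht ht'
  rw [dotMat_of_disjoint hs hs' (by simp) (by simp) (by simp), tsrMat_one]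

theorem dotMat_one_right {t t' s s' : Finset Q} (ht : t = ∅) (ht' : t' = ∅)
    (hs : s = s ∪ (t \ s')) (hs' : s' = t' ∪ (s' \ t)) (A : Matrix (Cfg κ s) (Cfg κ s') ℂ) :
    dotMat hs hs' A (Matrix.of fun _ _ => 1 : Matrix (Cfg κ t) (Cfg κ t') ℂ) = A := by
  subst ht ht'
  rw [dotMat_of_disjoint hs hs' (by simp) (by simp) (by simp),
    tsrMat_comm _ _ (by simp) (by simp), tsrMat_one]

end

/-! ### Soundness of the expansion of lifted terms -/

section

variable {Q : Type} [LinearOrder Q] {n : ℕ} {q : Q → Idx n} {m : ℕ} {Γ : Fin m → Ty Q n}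

/-- The value of a labelled term as a matrix. -/
noncomputable def Tm.mat {s s' : Finset Q} (t : Tm q Γ (.lin (.D s s'))) (ρ : Fin n → FinSet)
    (v : Env q ρ Γ) : Matrix (Cfg (denQ q ρ) s) (Cfg (denQ q ρ) s') ℂ :=
  (t.eval ρ v).down

theorem Tm.eval_eq_of_mat {s s' : Finset Q} {t u : Tm q Γ (.lin (.D s s'))} {ρ : Fin n → FinSet}
    {v : Env q ρ Γ} (h : t.mat ρ v = u.mat ρ v) : t.eval ρ v = u.eval ρ v :=
  congrArg ULift.up h

/-- The value of a basis term, as a basis element of the space of a quantum variable. -/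
noncomputable def Tm.val {r : Q} (i : Tm q Γ (.basis (q r))) (ρ : Fin n → FinSet)
    (v : Env q ρ Γ) : denQ q ρ r :=
  (i.eval ρ v).down

/-- An iterated sum whose body vanishes unless the summation variables take prescribed values is
equal to the value of the body there. -/
theorem mat_sumOver {s s' : Finset Q} (l : List Q) (hl : l.Nodup) :
    ∀ {m : ℕ} (Γ : Fin m → Ty Q n)
      (body : (m' : ℕ) → (Γ' : Fin m' → Ty Q n) → (g : Fin m → Fin m') →
        (∀ j, Γ' (g j) = Γ j) → ((r : Q) → r ∈ l → Tm q Γ' (.basis (q r))) →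
          Tm q Γ' (.lin (.D s s')))
      (ρ : Fin n → FinSet) (v : Env q ρ Γ) (f : Cfg (denQ q ρ) s) (g : Cfg (denQ q ρ) s')
      (val : (r : Q) → r ∈ l → denQ q ρ r) (G : ℂ)
      (_ : ∀ m' Γ' e he i (v' : Env q ρ Γ'), (∀ j, HEq (v' (e j)) (v j)) →
        (∀ r hr, (i r hr).val ρ v' = val r hr) → (body m' Γ' e he i).mat ρ v' f g = G)
      (_ : ∀ m' Γ' e he i (v' : Env q ρ Γ'), (∀ j, HEq (v' (e j)) (v j)) →
        (¬ ∀ r hr, (i r hr).val ρ v' = val r hr) → (body m' Γ' e he i).mat ρ v' f g = 0),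
      (sumOver l Γ body).mat ρ v f g = G := by
  induction l with
  | nil =>
    intro m Γ body ρ v f g val G h1 _
    exact h1 _ _ _ _ _ v (fun _ => HEq.rfl) (fun r hr => absurd hr List.not_mem_nil)
  | cons r l ih =>
    intro m Γ body ρ v f g val G h1 h2
    obtain ⟨hr, hl⟩ := List.nodup_cons.1 hl
    let body' (m' : ℕ) (Γ' : Fin m' → Ty Q n) (e : Fin (m + 1) → Fin m')
        (he : ∀ j, Γ' (e j) = ext (.basis (q r)) Γ j)
        (i : (r : Q) → r ∈ l → Tm q Γ' (.basis (q r))) : Tm q Γ' (.lin (.D s s')) :=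
      body m' Γ' (fun j => e j.succ) (fun j => he j.succ) fun r' hr' =>
          if h : r' = r then .var (e 0) (h ▸ he 0)
          else i r' ((List.mem_cons.mp hr').resolve_left h)
    have hsum : (sumOver (r :: l) Γ body).mat ρ v f g =
        ∑ x : denQ q ρ r, (sumOver l (ext (.basis (q r)) Γ) body').mat ρ
          (Fin.cases (ULift.up.{1} x) v : Env q ρ (ext (.basis (q r)) Γ)) f g :=
      Matrix.sum_apply f g Finset.univ _
    -- the values of the summation variables in the body
    have hval : ∀ (x : denQ q ρ r) (m' : ℕ) (Γ' : Fin m' → Ty Q n) (e : Fin (m + 1) → Fin m')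
        (he : ∀ j, Γ' (e j) = ext (.basis (q r)) Γ j)
        (i : (r : Q) → r ∈ l → Tm q Γ' (.basis (q r))) (v' : Env q ρ Γ')
        (_ : ∀ j, HEq (v' (e j)) ((Fin.cases (ULift.up.{1} x) v :
          Env q ρ (ext (.basis (q r)) Γ)) j)),
        (∀ r' hr', (if h : r' = r then .var (e 0) (h ▸ he 0)
          else i r' ((List.mem_cons.mp hr').resolve_left h) : Tm q Γ' (.basis (q r'))).val ρ v'
            = val r' hr') ↔
        x = val r List.mem_cons_self ∧
          ∀ r' hr', (i r' hr').val ρ v' = val r' (List.mem_cons_of_mem r hr') := by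
      intro x m' Γ' e he i v' hv
      have hvar : (Tm.var (e 0) (he 0) : Tm q Γ' (.basis (q r))).val ρ v' = x :=
        congrArg ULift.down (eq_of_heq ((eqRec_heq _ _).trans (hv 0)))
      constructor
      · intro H
        refine ⟨?_, fun r' hr' => ?_⟩
        · have := H r List.mem_cons_self
          rw [dif_pos rfl] at this
          exact hvar.symm.trans this
        · have := H r' (List.mem_cons_of_mem r hr')
          rwa [dif_neg (fun h : r' = r => hr (h ▸ hr'))] at this
      · rintro ⟨hx, H⟩ r' hr'
        by_cases h : r' = r
        · subst h
          rw [dif_pos rfl]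
          exact hvar.trans hx
        · rw [dif_neg h]
          exact H r' _
    rw [hsum, Finset.sum_eq_single (val r List.mem_cons_self)]
    · refine ih hl _ _ ρ _ f g (fun r' hr' => val r' (List.mem_cons_of_mem r hr')) G ?_ ?_
      · intro m' Γ' e he i v' hv H
        exact h1 _ _ _ _ _ v' (fun j => hv j.succ) ((hval _ _ _ e he i v' hv).2 ⟨rfl, H⟩)
      · intro m' Γ' e he i v' hv H
        exact h2 _ _ _ _ _ v' (fun j => hv j.succ) fun H' => H ((hval _ _ _ e he i v' hv).1 H').2
    · intro x _ hx
      have h0 : ∀ m' Γ' e he i (v' : Env q ρ Γ'),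
          (∀ j, HEq (v' (e j)) ((Fin.cases (ULift.up.{1} x) v :
          Env q ρ (ext (.basis (q r)) Γ)) j)) → (body' m' Γ' e he i).mat ρ v' f g = 0 :=
        fun m' Γ' e he i v' hv =>
          h2 _ _ _ _ _ v' (fun j => hv j.succ) fun H' => hx ((hval _ _ _ e he i v' hv).1 H').1
      exact ih hl _ _ ρ _ f g (fun r' hr' => val r' (List.mem_cons_of_mem r hr')) 0
        (fun m' Γ' e he i v' hv _ => h0 m' Γ' e he i v' hv)
        (fun m' Γ' e he i v' hv _ => h0 m' Γ' e he i v' hv)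
    · exact fun h => absurd (Finset.mem_univ _) h

open Classical in
/-- A tensor of labelled kets denotes the basis vector of the tuple of their values. -/
theorem mat_ketsTm (ρ : Fin n → FinSet) (v : Env q ρ Γ) (l : List Q) (hl : l.Nodup) :
    ∀ {s s' : Finset Q} (hs : s = l.toFinset) (hs' : s' = ∅)
      (i : (r : Q) → r ∈ l → Tm q Γ (.basis (q r))) (f : Cfg (denQ q ρ) s)
      (g : Cfg (denQ q ρ) s'), (ketsTm l hl hs hs' i).mat ρ v f g =
        if ∀ r (hr : r ∈ l), (i r hr).val ρ v = f ⟨r, hs ▸ List.mem_toFinset.2 hr⟩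
          then 1 else 0 := by
  induction l with
  | nil => intro s s' hs hs' i f g; exact (if_pos fun r hr => absurd hr List.not_mem_nil).symm
  | cons r l ih =>
    intro s s' hs hs' i f g
    refine (congrArg (basisVec _ _ * ·) (ih (List.nodup_cons.mp hl).2 rfl rfl _ _ _)).trans ?_
    rw [basisVec, ite_mul, one_mul, zero_mul, ← ite_and]
    refine if_congr ?_ rfl rfl
    constructor
    · rintro ⟨h1, h2⟩ r' hr'
      rcases List.mem_cons.1 hr' with rfl | h
      · exact h1.symm
      · exact h2 r' h
    · exact fun H =>
        ⟨(H r List.mem_cons_self).symm, fun r' hr' => H r' (List.mem_cons_of_mem r hr')⟩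

open Classical in
/-- A tensor of labelled bras denotes the dual basis vector of the tuple of their values. -/
theorem mat_brasTm (ρ : Fin n → FinSet) (v : Env q ρ Γ) (l : List Q) (hl : l.Nodup) :
    ∀ {s s' : Finset Q} (hs : s = ∅) (hs' : s' = l.toFinset)
      (i : (r : Q) → r ∈ l → Tm q Γ (.basis (q r))) (f : Cfg (denQ q ρ) s)
      (g : Cfg (denQ q ρ) s'), (brasTm l hl hs hs' i).mat ρ v f g =
        if ∀ r (hr : r ∈ l), (i r hr).val ρ v = g ⟨r, hs' ▸ List.mem_toFinset.2 hr⟩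
          then 1 else 0 := by
  induction l with
  | nil => intro s s' hs hs' i f g; exact (if_pos fun r hr => absurd hr List.not_mem_nil).symm
  | cons r l ih =>
    intro s s' hs hs' i f g
    refine (congrArg (basisVec _ _ * ·) (ih (List.nodup_cons.mp hl).2 rfl rfl _ _ _)).trans ?_
    rw [basisVec, ite_mul, one_mul, zero_mul, ← ite_and]
    refine if_congr ?_ rfl rfl
    constructor
    · rintro ⟨h1, h2⟩ r' hr'
      rcases List.mem_cons.1 hr' with rfl | h
      · exact h1.symm
      · exact h2 r' h
    · exact fun H =>
        ⟨(H r List.mem_cons_self).symm, fun r' hr' => H r' (List.mem_cons_of_mem r hr')⟩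

theorem basisVec_prod {A B : FinSet} (x : A) (y : B) :
    (fun p : A × B => basisVec x p.1 * basisVec y p.2) = basisVec (A := A.prod B) (x, y) := by
  funext p
  by_cases h : p = (x, y)
  · subst h
    refine Eq.trans ?_ (if_pos rfl).symm
    simp [basisVec]
  · refine Eq.trans ?_ (if_neg h).symm
    rw [Prod.ext_iff] at h
    simp only [basisVec, ite_mul, one_mul, zero_mul, ← ite_and]
    exact if_neg h

theorem Reg.eval_braTm (ρ : Fin n → FinSet) (v : Env q ρ Γ) (R : Reg Q)
    (i : (r : Q) → r ∈ R.vars → Tm q Γ (.basis (q r))) :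
    (R.braTm i).eval ρ v =
      ⟨basisVec (R.tuple q ρ fun r => (i r.1 r.2).val ρ v)⟩ := by
  induction R with
  | var r => rfl
  | pair R R' h1 h2 =>
    simp only [Reg.braTm, Tm.eval, h1, h2]
    exact congrArg ULift.up (basisVec_prod _ _)

theorem Reg.eval_ketTm (ρ : Fin n → FinSet) (v : Env q ρ Γ) (R : Reg Q)
    (i : (r : Q) → r ∈ R.vars → Tm q Γ (.basis (q r))) :
    (R.ketTm i).eval ρ v =
      ⟨basisVec (R.tuple q ρ fun r => (i r.1 r.2).val ρ v)⟩ := by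
  induction R with
  | var r => rfl
  | pair R R' h1 h2 =>
    simp only [Reg.ketTm, Tm.eval, h1, h2]
    exact congrArg ULift.up (basisVec_prod _ _)

theorem basisVec_dotProduct {A : FinSet} (x : A) (K : A → ℂ) : dotProduct (basisVec x) K = K x := by
  simp [basisVec, dotProduct]

theorem dotProduct_basisVec {A : FinSet} (x : A) (B : A → ℂ) : dotProduct B (basisVec x) = B x := by
  simp [basisVec, dotProduct]

theorem Reg.swap_mulVec (ρ : Fin n → FinSet) (R : Reg Q) (hR : R.HasType q (R.idx q))
    {s : Finset Q} (hs : s = R.vars) (K : (R.idx q).den ρ → ℂ) (f : Cfg (denQ q ρ) s) :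
    Matrix.mulVec (R.swap ρ hR hs) K f = K (R.tuple q ρ (f.restrict R.vars hs.symm.subset)) := by
  simp [Reg.swap, Matrix.mulVec, dotProduct]

theorem Reg.vecMul_swap (ρ : Fin n → FinSet) (R : Reg Q) (hR : R.HasType q (R.idx q))
    {s : Finset Q} (hs : s = R.vars) (B : (R.idx q).den ρ → ℂ) (f : Cfg (denQ q ρ) s) :
    Matrix.vecMul B (R.swap ρ hR hs).conjTranspose f =
      B (R.tuple q ρ (f.restrict R.vars hs.symm.subset)) := by
  simp [Reg.swap, Matrix.vecMul, dotProduct, apply_ite]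

/-- The value of a scalar term. -/
noncomputable def Tm.scalar (a : Tm q Γ (.lin .S)) (ρ : Fin n → FinSet) (v : Env q ρ Γ) : ℂ :=
  (a.eval ρ v).down

/-- The value of a term for an operator. -/
noncomputable def Tm.opt {σ τ : Idx n} (O : Tm q Γ (.lin (.O σ τ))) (ρ : Fin n → FinSet)
    (v : Env q ρ Γ) : Matrix (σ.den ρ) (τ.den ρ) ℂ :=
  (O.eval ρ v).down

/-- The value of a ket. -/
noncomputable def Tm.kvec {σ : Idx n} (K : Tm q Γ (.lin (.K σ))) (ρ : Fin n → FinSet)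
    (v : Env q ρ Γ) : σ.den ρ → ℂ :=
  (K.eval ρ v).down

/-- The value of a bra. -/
noncomputable def Tm.bvec {σ : Idx n} (B : Tm q Γ (.lin (.B σ))) (ρ : Fin n → FinSet)
    (v : Env q ρ Γ) : σ.den ρ → ℂ :=
  (B.eval ρ v).down

theorem Tm.mat_smul_apply {s s' : Finset Q} (a : Tm q Γ (.lin .S)) (X : Tm q Γ (.lin (.D s s')))
    (ρ : Fin n → FinSet) (v : Env q ρ Γ) (f : Cfg (denQ q ρ) s) (g : Cfg (denQ q ρ) s') :
    (Tm.smul a X).mat ρ v f g = a.scalar ρ v * X.mat ρ v f g := rfl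

theorem Reg.scalar_bra_dot (R : Reg Q) (ρ : Fin n → FinSet) (v : Env q ρ Γ)
    (i : (r : Q) → r ∈ R.vars → Tm q Γ (.basis (q r))) (K : Tm q Γ (.lin (.K (R.idx q)))) :
    (Tm.bin (.dotBK _) (R.braTm i) K).scalar ρ v =
      K.kvec ρ v (R.tuple q ρ fun r => (i r.1 r.2).val ρ v) :=
  (congrArg (fun B : ULift.{1} ((R.idx q).den ρ → ℂ) => dotProduct B.down (K.kvec ρ v))
    (Reg.eval_braTm ρ v R i)).trans (basisVec_dotProduct _ _)

theorem Reg.scalar_dot_ket (R : Reg Q) (ρ : Fin n → FinSet) (v : Env q ρ Γ)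
    (i : (r : Q) → r ∈ R.vars → Tm q Γ (.basis (q r))) (B : Tm q Γ (.lin (.B (R.idx q)))) :
    (Tm.bin (.dotBK _) B (R.ketTm i)).scalar ρ v =
      B.bvec ρ v (R.tuple q ρ fun r => (i r.1 r.2).val ρ v) :=
  (congrArg (fun K : ULift.{1} ((R.idx q).den ρ → ℂ) => dotProduct (B.bvec ρ v) K.down)
    (Reg.eval_ketTm ρ v R i)).trans (dotProduct_basisVec _ _)

theorem Reg.bvec_bra_dot (R : Reg Q) (ρ : Fin n → FinSet) (v : Env q ρ Γ) {τ : Idx n}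
    (i : (r : Q) → r ∈ R.vars → Tm q Γ (.basis (q r))) (O : Tm q Γ (.lin (.O (R.idx q) τ))) :
    (Tm.bin (.dotBO _ _) (R.braTm i) O).bvec ρ v =
      O.opt ρ v (R.tuple q ρ fun r => (i r.1 r.2).val ρ v) :=
  (congrArg (fun B : ULift.{1} ((R.idx q).den ρ → ℂ) => Matrix.vecMul B.down (O.opt ρ v))
    (Reg.eval_braTm ρ v R i)).trans (funext fun _ => basisVec_dotProduct _ _)

theorem expandK_mat (ρ : Fin n → FinSet) (v : Env q ρ Γ) (R : Reg Q) {s s' : Finset Q}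
    (hR : R.HasType q (R.idx q)) (hs : s = R.vars) (hs' : s' = ∅)
    (K : Tm q Γ (.lin (.K (R.idx q)))) :
    (expandK R hs hs' K).mat ρ v = (Tm.un (.liftK R hR hs hs') K).mat ρ v := by
  ext f g
  refine Eq.trans ?_ (R.swap_mulVec ρ hR hs (K.kvec ρ v) f).symm
  refine mat_sumOver R.list R.list_nodup Γ _ ρ v f g
    (fun r hr => f ⟨r, hs ▸ (Finset.mem_sort _).1 hr⟩) _ ?_ ?_
  · intro m' Γ' e he i v' hv H
    rw [Tm.mat_smul_apply, mat_ketsTm, if_pos H, mul_one, Reg.scalar_bra_dot]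
    exact congrArg₂ (fun (B : (R.idx q).den ρ → ℂ) x => B x)
      (congrArg ULift.down (Tm.eval_ren K e he ρ v v' hv)) (congrArg _ (funext fun r => H r.1 _))
  · intro m' Γ' e he i v' hv H
    rw [Tm.mat_smul_apply, mat_ketsTm, if_neg H, mul_zero]

theorem expandB_mat (ρ : Fin n → FinSet) (v : Env q ρ Γ) (R : Reg Q) {s s' : Finset Q}
    (hR : R.HasType q (R.idx q)) (hs : s = ∅) (hs' : s' = R.vars)
    (B : Tm q Γ (.lin (.B (R.idx q)))) :
    (expandB R hs hs' B).mat ρ v = (Tm.un (.liftB R hR hs hs') B).mat ρ v := by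
  ext f g
  refine Eq.trans ?_ (R.vecMul_swap ρ hR hs' (B.bvec ρ v) g).symm
  refine mat_sumOver R.list R.list_nodup Γ _ ρ v f g
    (fun r hr => g ⟨r, hs' ▸ (Finset.mem_sort _).1 hr⟩) _ ?_ ?_
  · intro m' Γ' e he i v' hv H
    rw [Tm.mat_smul_apply, mat_brasTm, if_pos H, mul_one, Reg.scalar_dot_ket]
    exact congrArg₂ (fun (B : (R.idx q).den ρ → ℂ) x => B x)
      (congrArg ULift.down (Tm.eval_ren B e he ρ v v' hv)) (congrArg _ (funext fun r => H r.1 _))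
  · intro m' Γ' e he i v' hv H
    rw [Tm.mat_smul_apply, mat_brasTm, if_neg H, mul_zero]

theorem expandO_mat (ρ : Fin n → FinSet) (v : Env q ρ Γ) (R R' : Reg Q) {s s' : Finset Q}
    (hR : R.HasType q (R.idx q)) (hR' : R'.HasType q (R'.idx q)) (hs : s = R.vars)
    (hs' : s' = R'.vars) (O : Tm q Γ (.lin (.O (R.idx q) (R'.idx q)))) :
    (expandO R R' hs hs' O).mat ρ v = (Tm.un (.liftO R R' hR hR' hs hs') O).mat ρ v := by
  ext f g
  have hval : (Tm.un (.liftO R R' hR hR' hs hs') O).mat ρ v f g =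
      O.opt ρ v (R.tuple q ρ (f.restrict R.vars hs.symm.subset))
        (R'.tuple q ρ (g.restrict R'.vars hs'.symm.subset)) := by
    refine Eq.trans ?_ (R'.vecMul_swap ρ hR' hs' (O.opt ρ v _) g)
    refine congrArg (fun B : (R'.idx q).den ρ → ℂ =>
      Matrix.vecMul B (R'.swap ρ hR' hs').conjTranspose g) (funext fun y => ?_)
    exact R.swap_mulVec ρ hR hs (fun x => O.opt ρ v x y) f
  rw [hval]
  -- the value of the labelled tensor in the body
  have htsr : ∀ {m₂ : ℕ} {Γ₂ : Fin m₂ → Ty Q n} (X : Tm q Γ₂ (.lin (.D s ∅)))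
      (Y : Tm q Γ₂ (.lin (.D ∅ s'))) (h : TsrOK s ∅ ∅ s' s s') (v₂ : Env q ρ Γ₂),
      (Tm.bin (.ltsr h) X Y).mat ρ v₂ f g = X.mat ρ v₂ f (g.restrict ∅ (Finset.empty_subset _)) *
        Y.mat ρ v₂ (f.restrict ∅ (Finset.empty_subset _)) g := fun _ _ _ _ => rfl
  have hren : ∀ {m₁ m₂ : ℕ} {Γ₁ : Fin m₁ → Ty Q n} {Γ₂ : Fin m₂ → Ty Q n} (e : Fin m₁ → Fin m₂)
      (he : ∀ j, Γ₂ (e j) = Γ₁ j) (v₁ : Env q ρ Γ₁) (v₂ : Env q ρ Γ₂)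
      (_ : ∀ j, HEq (v₂ (e j)) (v₁ j)) {r : Q} (i : Tm q Γ₁ (.basis (q r))) (x : denQ q ρ r),
      (i.ren e he).val ρ v₂ = x ↔ i.val ρ v₁ = x := by
    intro m₁ m₂ Γ₁ Γ₂ e he v₁ v₂ hv r i x
    rw [Tm.val, Tm.eval_ren i e he ρ v₁ v₂ hv, Tm.val]
  refine mat_sumOver R.list R.list_nodup Γ _ ρ v f g
    (fun r hr => f ⟨r, hs ▸ (Finset.mem_sort _).1 hr⟩) _ ?_ ?_
  · intro m₁ Γ₁ e₁ he₁ i v₁ hv₁ H₁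
    refine mat_sumOver R'.list R'.list_nodup Γ₁ _ ρ v₁ f g
      (fun r hr => g ⟨r, hs' ▸ (Finset.mem_sort _).1 hr⟩) _ ?_ ?_
    · intro m₂ Γ₂ e₂ he₂ i' v₂ hv₂ H₂
      have H₁' := fun r hr => (hren e₂ he₂ v₁ v₂ hv₂ (i r hr) _).2 (H₁ r hr)
      refine (congrArg (Tm.scalar _ ρ v₂ * ·) (htsr _ _ _ v₂)).trans ?_
      rw [mat_ketsTm, if_pos H₁', mat_brasTm, if_pos H₂, mul_one, mul_one,
        Reg.scalar_dot_ket, Reg.bvec_bra_dot]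
      have hO : ((O.ren e₁ he₁).ren e₂ he₂).opt ρ v₂ = O.opt ρ v := congrArg ULift.down
        ((Tm.eval_ren _ e₂ he₂ ρ v₁ v₂ hv₂).trans (Tm.eval_ren O e₁ he₁ ρ v v₁ hv₁))
      rw [hO]
      exact congrArg₂ (O.opt ρ v) (congrArg _ (funext fun r => H₁' r.1 _))
        (congrArg _ (funext fun r => H₂ r.1 _))
    · intro m₂ Γ₂ e₂ he₂ i' v₂ hv₂ H₂
      refine (congrArg (Tm.scalar _ ρ v₂ * ·) (htsr _ _ _ v₂)).trans ?_
      rw [mat_brasTm, if_neg H₂, mul_zero, mul_zero]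
  · intro m₁ Γ₁ e₁ he₁ i v₁ hv₁ H₁
    have h0 : ∀ m₂ (Γ₂ : Fin m₂ → Ty Q n) e₂ (he₂ : ∀ j, Γ₂ (e₂ j) = Γ₁ j) (v₂ : Env q ρ Γ₂)
        (_ : ∀ j, HEq (v₂ (e₂ j)) (v₁ j)) (a : Tm q Γ₂ (.lin .S)) (Y : Tm q Γ₂ (.lin (.D ∅ s')))
        (h : TsrOK s ∅ ∅ s' s s'),
        (Tm.smul a (.bin (.ltsr h) (ketsTm R.list R.list_nodup (hs.trans R.vars_eq) rfl
          fun r h => (i r h).ren e₂ he₂) Y)).mat ρ v₂ f g = 0 := by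
      intro m₂ Γ₂ e₂ he₂ v₂ hv₂ a Y h
      refine (congrArg (Tm.scalar _ ρ v₂ * ·) (htsr _ _ _ v₂)).trans ?_
      rw [mat_ketsTm, if_neg, zero_mul, mul_zero]
      exact fun H => H₁ fun r hr => (hren e₂ he₂ v₁ v₂ hv₂ (i r hr) _).1 (H r hr)
    exact mat_sumOver R'.list R'.list_nodup Γ₁ _ ρ v₁ f g
      (fun r hr => g ⟨r, hs' ▸ (Finset.mem_sort _).1 hr⟩) 0
      (fun m₂ Γ₂ e₂ he₂ i' v₂ hv₂ _ => h0 m₂ Γ₂ e₂ he₂ v₂ hv₂ _ _ _)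
      (fun m₂ Γ₂ e₂ he₂ i' v₂ hv₂ _ => h0 m₂ Γ₂ e₂ he₂ v₂ hv₂ _ _ _)

theorem Expand.eval_eq {T : Ty Q n} {t u : Tm q Γ T} (h : Expand t u) (ρ : Fin n → FinSet)
    (v : Env q ρ Γ) : t.eval ρ v = u.eval ρ v := by
  cases h with
  | ket R hR hs hs' K => exact Tm.eval_eq_of_mat (expandK_mat ρ v R hR hs hs' K).symm
  | bra R hR hs hs' B => exact Tm.eval_eq_of_mat (expandB_mat ρ v R hR hs hs' B).symm
  | opt R R' hR hR' hs hs' O => exact Tm.eval_eq_of_mat (expandO_mat ρ v R R' hR hR' hs hs' O).symm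

end

/-! ### Soundness of rewriting -/

section

variable {Q : Type} [LinearOrder Q] {n : ℕ} {q : Q → Idx n} {m : ℕ} {Γ : Fin m → Ty Q n}

section mat

variable (ρ : Fin n → FinSet) (v : Env q ρ Γ) {s₁ s₁' s₂ s₂' s s' : Finset Q}

theorem Tm.mat_add (X Y : Tm q Γ (.lin (.D s s'))) :
    (X.add Y).mat ρ v = X.mat ρ v + Y.mat ρ v := rfl

theorem Tm.mat_smul (a : Tm q Γ (.lin .S)) (X : Tm q Γ (.lin (.D s s'))) :
    (Tm.smul a X).mat ρ v = a.scalar ρ v • X.mat ρ v := rfl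

theorem Tm.mat_tsr (h : TsrOK s₁ s₁' s₂ s₂' s s') (X : Tm q Γ (.lin (.D s₁ s₁')))
    (Y : Tm q Γ (.lin (.D s₂ s₂'))) :
    (Tm.tsr h X Y).mat ρ v = tsrMat h.2.2.1 h.2.2.2 (X.mat ρ v) (Y.mat ρ v) := rfl

theorem Tm.mat_dot (h : DotOK s₁ s₁' s₂ s₂' s s') (X : Tm q Γ (.lin (.D s₁ s₁')))
    (Y : Tm q Γ (.lin (.D s₂ s₂'))) :
    (Tm.dot h X Y).mat ρ v = dotMat h.2.2.1 h.2.2.2 (X.mat ρ v) (Y.mat ρ v) := rfl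

/-- The extension of a valuation by a value of the variable of a sum. -/
abbrev Env.cons {σ : Idx n} (x : σ.den ρ) (v : Env q ρ Γ) : Env q ρ (ext (.basis σ) Γ) :=
  Fin.cases (ULift.up.{1} x) v

/-- The value of a set. -/
noncomputable def Tm.finset {σ : Idx n} (M : Tm q Γ (.set σ)) : Finset (σ.den ρ) :=
  (M.eval ρ v).down

theorem Tm.mat_bigSum {σ : Idx n} (M : Tm q Γ (.set σ))
    (X : Tm q (ext (.basis σ) Γ) (.lin (.D s s'))) :
    (M.bigSum X).mat ρ v = ∑ x ∈ M.finset ρ v, X.mat ρ (Env.cons ρ x v) := rfl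

theorem Tm.scalar_bigSum {σ : Idx n} (M : Tm q Γ (.set σ))
    (a : Tm q (ext (.basis σ) Γ) (.lin .S)) :
    (M.bigSum a).scalar ρ v = ∑ x ∈ M.finset ρ v, a.scalar ρ (Env.cons ρ x v) := rfl

theorem Tm.mat_wk {σ : Idx n} (X : Tm q Γ (.lin (.D s s'))) (x : σ.den ρ) :
    (X.wk (.basis σ)).mat ρ (Env.cons ρ x v) = X.mat ρ v :=
  congrArg ULift.down (Tm.eval_wk X (.basis σ) ρ v (ULift.up.{1} x))

theorem Tm.scalar_wk {σ : Idx n} (a : Tm q Γ (.lin .S)) (x : σ.den ρ) :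
    (a.wk (.basis σ)).scalar ρ (Env.cons ρ x v) = a.scalar ρ v :=
  congrArg ULift.down (Tm.eval_wk a (.basis σ) ρ v (ULift.up.{1} x))

end mat

theorem TsrAC.eval_eq {T : Ty Q n} {t u : Tm q Γ T} (h : TsrAC t u) (ρ : Fin n → FinSet)
    (v : Env q ρ Γ) : t.eval ρ v = u.eval ρ v := by
  cases h with
  | comm h h' X Y => exact Tm.eval_eq_of_mat (tsrMat_comm h.2.2.1 h.2.2.2 h'.2.2.1 h'.2.2.2 _ _)
  | assoc h₁ h₂ h₃ h₄ X Y Z => exact Tm.eval_eq_of_mat (tsrMat_assoc h₁.2.2.1 h₁.2.2.2 h₂.2.2.1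
      h₂.2.2.2 h₃.2.2.1 h₃.2.2.2 h₄.2.2.1 h₄.2.2.2 _ _ _)
  | one h hs hs' X => exact Tm.eval_eq_of_mat (tsrMat_one h.2.2.1 h.2.2.2 _)

theorem Rewrite.eval_eq {T : Ty Q n} {t u : Tm q Γ T} (h : Rewrite t u) (ρ : Fin n → FinSet)
    (v : Env q ρ Γ) : t.eval ρ v = u.eval ρ v := by
  cases h with
  | beta t u => exact (Tm.eval_inst t u ρ v).symm
  | betaI t σ => exact (Tm.eval_instIdx t σ ρ v).symm
  | ac h => exact h.eval_eq ρ v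
  | adjKet r hr hs hs' i =>
    subst hr
    exact Tm.eval_eq_of_mat (ketMat_conjTranspose hs _)
  | adjBra r hr hs hs' i =>
    subst hr
    exact Tm.eval_eq_of_mat (braMat_conjTranspose hs' _)
  | adjOne hs hs' =>
    refine Tm.eval_eq_of_mat ?_
    ext f g
    exact map_one (starRingEnd ℂ)
  | adjTsr h h' X Y => exact Tm.eval_eq_of_mat (tsrMat_conjTranspose h.2.2.1 h.2.2.2 _ _)
  | adjDot h h' X Y => exact Tm.eval_eq_of_mat (dotMat_conjTranspose h.2.2.1 h.2.2.2 _ _)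
  | adjAdj X => exact Tm.eval_eq_of_mat (Matrix.conjTranspose_conjTranspose _)
  | adjSmul a X => exact Tm.eval_eq_of_mat (Matrix.conjTranspose_smul _ _)
  | adjAdd X Y => exact Tm.eval_eq_of_mat (Matrix.conjTranspose_add _ _)
  | adjSum M X => exact Tm.eval_eq_of_mat (Matrix.conjTranspose_sum _ _)
  | smulOne X => exact Tm.eval_eq_of_mat (one_smul ℂ (X.mat ρ v))
  | smulSmul a b X => exact Tm.eval_eq_of_mat (smul_smul (a.scalar ρ v) (b.scalar ρ v) (X.mat ρ v))
  | smulAdd a X Y =>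
    exact Tm.eval_eq_of_mat (smul_add (a.scalar ρ v) (X.mat ρ v) (Y.mat ρ v))
  | smulSum a M X =>
    refine Tm.eval_eq_of_mat ?_
    simp only [Tm.mat_smul, Tm.mat_bigSum, Tm.scalar_wk, Finset.smul_sum]
  | sumSmul M a X =>
    refine Tm.eval_eq_of_mat ?_
    simp only [Tm.mat_smul, Tm.mat_bigSum, Tm.scalar_bigSum, Tm.mat_wk, Finset.sum_smul]
  | addAssoc X Y Z =>
    exact Tm.eval_eq_of_mat (add_assoc (X.mat ρ v) (Y.mat ρ v) (Z.mat ρ v))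
  | sumAdd M X Y =>
    refine Tm.eval_eq_of_mat ?_
    simp only [Tm.mat_add, Tm.mat_bigSum, Finset.sum_add_distrib]
  | tsrSmul h a X Y => exact Tm.eval_eq_of_mat (tsrMat_smul h.2.2.1 h.2.2.2 _ _ _)
  | tsrAdd h X X' Y => exact Tm.eval_eq_of_mat (tsrMat_add h.2.2.1 h.2.2.2 _ _ _)
  | tsrSum h M X Y =>
    refine Tm.eval_eq_of_mat ?_
    simp only [Tm.mat_tsr, Tm.mat_bigSum, Tm.mat_wk, tsrMat_sum]
  | dotSmulL h a X Y => exact Tm.eval_eq_of_mat (dotMat_smul_left h.2.2.1 h.2.2.2 _ _ _)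
  | dotSmulR h a X Y => exact Tm.eval_eq_of_mat (dotMat_smul_right h.2.2.1 h.2.2.2 _ _ _)
  | dotAddL h X X' Y => exact Tm.eval_eq_of_mat (dotMat_add_left h.2.2.1 h.2.2.2 _ _ _)
  | dotAddR h X Y Y' => exact Tm.eval_eq_of_mat (dotMat_add_right h.2.2.1 h.2.2.2 _ _ _)
  | dotSumL h M X Y =>
    refine Tm.eval_eq_of_mat ?_
    simp only [Tm.mat_dot, Tm.mat_bigSum, Tm.mat_wk, dotMat_sum_left]
  | dotSumR h X M Y =>
    refine Tm.eval_eq_of_mat ?_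
    simp only [Tm.mat_dot, Tm.mat_bigSum, Tm.mat_wk, dotMat_sum_right]
  | sort0 h h' hd X Y =>
    exact Tm.eval_eq_of_mat (dotMat_of_disjoint _ _ h'.2.2.1 h'.2.2.2 hd _ _)
  -- the remaining rules are instances of the contraction of one quantum variable, with empty
  -- tensors as the missing factors
  | sort1 r hr hr' h₁ h₁' h₂ h₂' hs hs' h i j =>
    subst hr hs hs'
    refine Tm.eval_eq_of_mat ?_
    have := dotMat_contract (κ := denQ q ρ) (t := ∅) (t' := ∅) (u := ∅) (u' := ∅) h₁ h₁' h₂ h₂'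
      (by simp [TsrOK]) (by simp [TsrOK]) h
      (by simp [DotOK]) (i.val ρ v) (j.val ρ v)
      (Matrix.of fun _ _ => 1) (Matrix.of fun _ _ => 1)
    rw [tsrMat_comm _ _ (by simp) (by simp), tsrMat_one, tsrMat_comm _ _ (by simp) (by simp),
      tsrMat_one, dotMat_one_left rfl rfl] at this
    exact this
  | sort2 r hr hr' h₁ h₁' h₂ h₂' hY h i j Y =>
    subst hr
    refine Tm.eval_eq_of_mat ?_
    have := dotMat_contract (κ := denQ q ρ) (t := ∅) (t' := ∅) h₁ h₁' h₂ h₂'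
      (by simp [TsrOK]) hY h
      (by simp [DotOK]) (i.val ρ v) (j.val ρ v)
      (Matrix.of fun _ _ => 1) (Y.mat ρ v)
    rw [tsrMat_comm _ _ (by simp) (by simp), tsrMat_one, dotMat_one_left rfl rfl] at this
    exact this
  | sort3 r hr hr' h₁ h₁' h₂ h₂' hX h i j X =>
    subst hr
    refine Tm.eval_eq_of_mat ?_
    have := dotMat_contract (κ := denQ q ρ) (u := ∅) (u' := ∅) h₁ h₁' h₂ h₂'
      hX (by simp [TsrOK]) h
      (by simp [DotOK]) (i.val ρ v) (j.val ρ v)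
      (X.mat ρ v) (Matrix.of fun _ _ => 1)
    rw [tsrMat_comm _ _ (by simp) (by simp) (ketMat _ _), tsrMat_one,
      dotMat_one_right rfl rfl] at this
    exact this
  | sort4 r hr hr' h₁ h₁' h₂ h₂' hX hY h h' i j X Y =>
    subst hr
    exact Tm.eval_eq_of_mat (dotMat_contract h₁ h₁' h₂ h₂' hX hY h h' _ _ _ _)

end

section

variable {Q : Type} [LinearOrder Q]

theorem Cong.eval_eq {R : Rule Q}
    (hR : ∀ n (q : Q → Idx n) m (Γ : Fin m → Ty Q n) T (t u : Tm q Γ T), R n q m Γ T t u →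
      ∀ ρ v, t.eval ρ v = u.eval ρ v)
    {n : ℕ} {q : Q → Idx n} {m : ℕ} {Γ : Fin m → Ty Q n} {T : Ty Q n} {t u : Tm q Γ T}
    (h : Cong R t u) (ρ : Fin n → FinSet) (v : Env q ρ Γ) : t.eval ρ v = u.eval ρ v := by
  induction h with
  | base h => exact hR _ _ _ _ _ _ _ h ρ v
  | lam h ih => exact funext fun x => ih ρ _
  | appL h u ih => simp only [Tm.eval, ih]
  | appR t h ih => simp only [Tm.eval, ih]
  | lamI h ih => exact funext fun A => ih _ _
  | appI h σ hU ih => simp only [Tm.eval, ih]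
  | sumL h f ih =>
    simp only [Tm.eval, ih]
    rfl
  | sumR M h ih =>
    simp only [Tm.eval, ih]
    rfl
  | un o h ih => simp only [Tm.eval, ih]
  | binL o h u ih => simp only [Tm.eval, ih]
  | binR o t h ih => simp only [Tm.eval, ih]

theorem Reduces.eval_eq {R : Rule Q}
    (hR : ∀ n (q : Q → Idx n) m (Γ : Fin m → Ty Q n) T (t u : Tm q Γ T), R n q m Γ T t u →
      ∀ ρ v, t.eval ρ v = u.eval ρ v)
    {n : ℕ} {q : Q → Idx n} {m : ℕ} {Γ : Fin m → Ty Q n} {T : Ty Q n} {t u : Tm q Γ T}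
    (h : Reduces R t u) (ρ : Fin n → FinSet) (v : Env q ρ Γ) : t.eval ρ v = u.eval ρ v := by
  induction h with
  | refl => rfl
  | tail _ h ih => exact ih.trans (h.eval_eq hR ρ v)

end

/-! ### Syntactic invariants of the rules -/

section

variable {Q : Type} [LinearOrder Q] {n : ℕ} {q : Q → Idx n} {m : ℕ} {Γ : Fin m → Ty Q n}

theorem sumOver_noLabelledVars {L : LTy Q n} (l : List Q)
    (body : (m' : ℕ) → (Γ' : Fin m' → Ty Q n) → (g : Fin m → Fin m') →
      (∀ j, Γ' (g j) = Γ j) → ((r : Q) → r ∈ l → Tm q Γ' (.basis (q r))) → Tm q Γ' (.lin L))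
    (h : ∀ m' Γ' g hg i, (∀ r hr, (i r hr).NoLabelledVars) →
      (body m' Γ' g hg i).NoLabelledVars) : (sumOver l Γ body).NoLabelledVars := by
  induction l generalizing m with
  | nil => exact h _ _ _ _ _ fun _ hr => absurd hr List.not_mem_nil
  | cons r l ih =>
    refine ⟨trivial, trivial, ih _ fun m' Γ' g hg i hi => h _ _ _ _ _ fun r' hr' => ?_⟩
    split
    · show (Γ' (g 0)).Plain
      rw [hg 0]
      trivial
    · exact hi _ _

theorem sumOver_liftFree {L : LTy Q n} (l : List Q)
    (body : (m' : ℕ) → (Γ' : Fin m' → Ty Q n) → (g : Fin m → Fin m') →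
      (∀ j, Γ' (g j) = Γ j) → ((r : Q) → r ∈ l → Tm q Γ' (.basis (q r))) → Tm q Γ' (.lin L))
    (h : ∀ m' Γ' g hg i, (∀ r hr, (i r hr).LiftFree) → (body m' Γ' g hg i).LiftFree) :
    (sumOver l Γ body).LiftFree := by
  induction l generalizing m with
  | nil => exact h _ _ _ _ _ fun _ hr => absurd hr List.not_mem_nil
  | cons r l ih =>
    refine ⟨trivial, ih _ fun m' Γ' g hg i hi => h _ _ _ _ _ fun r' hr' => ?_⟩
    split
    · trivial
    · exact hi _ _

theorem Reg.braTm_noLabelledVars (R : Reg Q) (i : (r : Q) → r ∈ R.vars → Tm q Γ (.basis (q r)))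
    (hi : ∀ r hr, (i r hr).NoLabelledVars) : (R.braTm i).NoLabelledVars := by
  induction R with
  | var r => exact hi _ _
  | pair R R' h1 h2 => exact ⟨h1 _ fun _ _ => hi _ _, h2 _ fun _ _ => hi _ _⟩

theorem Reg.ketTm_noLabelledVars (R : Reg Q) (i : (r : Q) → r ∈ R.vars → Tm q Γ (.basis (q r)))
    (hi : ∀ r hr, (i r hr).NoLabelledVars) : (R.ketTm i).NoLabelledVars := by
  induction R with
  | var r => exact hi _ _
  | pair R R' h1 h2 => exact ⟨h1 _ fun _ _ => hi _ _, h2 _ fun _ _ => hi _ _⟩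

theorem Reg.braTm_liftFree (R : Reg Q) (i : (r : Q) → r ∈ R.vars → Tm q Γ (.basis (q r)))
    (hi : ∀ r hr, (i r hr).LiftFree) : (R.braTm i).LiftFree := by
  induction R with
  | var r => exact ⟨trivial, hi _ _⟩
  | pair R R' h1 h2 => exact ⟨h1 _ fun _ _ => hi _ _, h2 _ fun _ _ => hi _ _⟩

theorem Reg.ketTm_liftFree (R : Reg Q) (i : (r : Q) → r ∈ R.vars → Tm q Γ (.basis (q r)))
    (hi : ∀ r hr, (i r hr).LiftFree) : (R.ketTm i).LiftFree := by
  induction R with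
  | var r => exact ⟨trivial, hi _ _⟩
  | pair R R' h1 h2 => exact ⟨h1 _ fun _ _ => hi _ _, h2 _ fun _ _ => hi _ _⟩

theorem ketsTm_noLabelledVars (l : List Q) (hl : l.Nodup) {s s' : Finset Q} (hs : s = l.toFinset)
    (hs' : s' = ∅) (i : (r : Q) → r ∈ l → Tm q Γ (.basis (q r)))
    (hi : ∀ r hr, (i r hr).NoLabelledVars) : (ketsTm l hl hs hs' i).NoLabelledVars := by
  induction l generalizing s s' with
  | nil => trivial
  | cons r l ih => exact ⟨hi _ _, ih _ _ _ _ fun _ _ => hi _ _⟩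

theorem brasTm_noLabelledVars (l : List Q) (hl : l.Nodup) {s s' : Finset Q} (hs : s = ∅)
    (hs' : s' = l.toFinset) (i : (r : Q) → r ∈ l → Tm q Γ (.basis (q r)))
    (hi : ∀ r hr, (i r hr).NoLabelledVars) : (brasTm l hl hs hs' i).NoLabelledVars := by
  induction l generalizing s s' with
  | nil => trivial
  | cons r l ih => exact ⟨hi _ _, ih _ _ _ _ fun _ _ => hi _ _⟩

theorem ketsTm_liftFree (l : List Q) (hl : l.Nodup) {s s' : Finset Q} (hs : s = l.toFinset)
    (hs' : s' = ∅) (i : (r : Q) → r ∈ l → Tm q Γ (.basis (q r)))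
    (hi : ∀ r hr, (i r hr).LiftFree) : (ketsTm l hl hs hs' i).LiftFree := by
  induction l generalizing s s' with
  | nil => trivial
  | cons r l ih => exact ⟨⟨trivial, hi _ _⟩, ih _ _ _ _ fun _ _ => hi _ _⟩

theorem brasTm_liftFree (l : List Q) (hl : l.Nodup) {s s' : Finset Q} (hs : s = ∅)
    (hs' : s' = l.toFinset) (i : (r : Q) → r ∈ l → Tm q Γ (.basis (q r)))
    (hi : ∀ r hr, (i r hr).LiftFree) : (brasTm l hl hs hs' i).LiftFree := by
  induction l generalizing s s' with
  | nil => trivial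
  | cons r l ih => exact ⟨⟨trivial, hi _ _⟩, ih _ _ _ _ fun _ _ => hi _ _⟩

section

variable {s s' : Finset Q} (R R' : Reg Q)

theorem expandK_liftFree (hs : s = R.vars) (hs' : s' = ∅) {K : Tm q Γ (.lin (.K (R.idx q)))}
    (h : K.LiftFree) : (expandK R hs hs' K).LiftFree :=
  sumOver_liftFree _ _ fun _ _ _ _ _ hi =>
    ⟨⟨R.braTm_liftFree _ fun _ _ => hi _ _, h.ren _ _⟩, ketsTm_liftFree _ _ _ _ _ hi⟩

theorem expandB_liftFree (hs : s = ∅) (hs' : s' = R.vars) {B : Tm q Γ (.lin (.B (R.idx q)))}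
    (h : B.LiftFree) : (expandB R hs hs' B).LiftFree :=
  sumOver_liftFree _ _ fun _ _ _ _ _ hi =>
    ⟨⟨h.ren _ _, R.ketTm_liftFree _ fun _ _ => hi _ _⟩, brasTm_liftFree _ _ _ _ _ hi⟩

theorem expandO_liftFree (hs : s = R.vars) (hs' : s' = R'.vars)
    {O : Tm q Γ (.lin (.O (R.idx q) (R'.idx q)))} (h : O.LiftFree) :
    (expandO R R' hs hs' O).LiftFree :=
  sumOver_liftFree _ _ fun _ _ _ _ _ hi => sumOver_liftFree _ _ fun _ _ _ _ _ hi' =>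
    ⟨⟨⟨R.braTm_liftFree _ fun _ _ => (hi _ _).ren _ _, (h.ren _ _).ren _ _⟩,
      R'.ketTm_liftFree _ fun _ _ => hi' _ _⟩,
      ketsTm_liftFree _ _ _ _ _ fun _ _ => (hi _ _).ren _ _, brasTm_liftFree _ _ _ _ _ hi'⟩

end

theorem Expand.noLabelledVars {T : Ty Q n} {t u : Tm q Γ T} (h : Expand t u)
    (ht : t.NoLabelledVars) : u.NoLabelledVars := by
  cases h with
  | ket R hR hs hs' K =>
    exact sumOver_noLabelledVars _ _ fun _ _ _ _ _ hi =>
      ⟨⟨R.braTm_noLabelledVars _ fun _ _ => hi _ _, Tm.NoLabelledVars.ren (t := K) ht _ _⟩,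
        ketsTm_noLabelledVars _ _ _ _ _ hi⟩
  | bra R hR hs hs' B =>
    exact sumOver_noLabelledVars _ _ fun _ _ _ _ _ hi =>
      ⟨⟨Tm.NoLabelledVars.ren (t := B) ht _ _, R.ketTm_noLabelledVars _ fun _ _ => hi _ _⟩,
        brasTm_noLabelledVars _ _ _ _ _ hi⟩
  | opt R R' hR hR' hs hs' O =>
    exact sumOver_noLabelledVars _ _ fun _ _ _ _ _ hi => sumOver_noLabelledVars _ _
      fun _ _ _ _ _ hi' =>
      ⟨⟨⟨R.braTm_noLabelledVars _ fun _ _ => (hi _ _).ren _ _,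
          (Tm.NoLabelledVars.ren (t := O) ht _ _).ren _ _⟩,
        R'.ketTm_noLabelledVars _ fun _ _ => hi' _ _⟩,
        ketsTm_noLabelledVars _ _ _ _ _ fun _ _ => (hi _ _).ren _ _,
        brasTm_noLabelledVars _ _ _ _ _ hi'⟩

theorem TsrAC.noLabelledVars {T : Ty Q n} {t u : Tm q Γ T} (h : TsrAC t u)
    (ht : t.NoLabelledVars) : u.NoLabelledVars := by
  cases h with
  | comm h h' X Y => exact ⟨ht.2, ht.1⟩
  | assoc h₁ h₂ h₃ h₄ X Y Z => exact ⟨ht.1.1, ht.1.2, ht.2⟩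
  | one h hs hs' X => exact ht.2

theorem Rewrite.noLabelledVars {T : Ty Q n} {t u : Tm q Γ T} (h : Rewrite t u)
    (ht : t.NoLabelledVars) : u.NoLabelledVars := by
  cases h with
  | beta t u => exact ht.1.2.inst ht.2
  | betaI t σ => exact Tm.NoLabelledVars.instIdx (t := t) ht σ
  | ac h => exact h.noLabelledVars ht
  | adjKet | adjBra | adjOne | adjTsr | adjAdj | adjSmul | adjAdd | adjSum => exact ht
  | adjDot => exact ⟨ht.2, ht.1⟩
  | smulOne => exact ht.2
  | smulSmul => exact ⟨⟨ht.1, ht.2.1⟩, ht.2.2⟩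
  | smulAdd => exact ⟨⟨ht.1, ht.2.1⟩, ht.1, ht.2.2⟩
  | smulSum => exact ⟨ht.2.1, trivial, ht.1.wk _, ht.2.2.2⟩
  | sumSmul => exact ⟨ht.1.1, trivial, ht.1.2.2, ht.2.wk _⟩
  | addAssoc => exact ⟨ht.1.1, ht.1.2, ht.2⟩
  | sumAdd => exact ⟨⟨ht.1, trivial, ht.2.2.1⟩, ht.1, trivial, ht.2.2.2⟩
  | tsrSmul => exact ⟨ht.1.1, ht.1.2, ht.2⟩
  | tsrAdd => exact ⟨⟨ht.1.1, ht.2⟩, ht.1.2, ht.2⟩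
  | tsrSum => exact ⟨ht.1.1, trivial, ht.1.2.2, ht.2.wk _⟩
  | dotSmulL => exact ⟨ht.1.1, ht.1.2, ht.2⟩
  | dotSmulR => exact ⟨ht.2.1, ht.1, ht.2.2⟩
  | dotAddL => exact ⟨⟨ht.1.1, ht.2⟩, ht.1.2, ht.2⟩
  | dotAddR => exact ⟨⟨ht.1, ht.2.1⟩, ht.1, ht.2.2⟩
  | dotSumL => exact ⟨ht.1.1, trivial, ht.1.2.2, ht.2.wk _⟩
  | dotSumR => exact ⟨ht.2.1, trivial, ht.1.wk _, ht.2.2.2⟩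
  | sort0 => exact ht
  | sort1 => exact ⟨ht, trivial⟩
  | sort2 => exact ⟨⟨ht.1, ht.2.1⟩, ht.2.2⟩
  | sort3 => exact ⟨⟨ht.1.1, ht.2⟩, ht.1.2⟩
  | sort4 => exact ⟨⟨ht.1.1, ht.2.1⟩, ht.1.2, ht.2.2⟩

end

section

variable {Q : Type} [LinearOrder Q]

theorem Cong.noLabelledVars {R : Rule Q}
    (hR : ∀ n (q : Q → Idx n) m (Γ : Fin m → Ty Q n) T (t u : Tm q Γ T), R n q m Γ T t u →
      t.NoLabelledVars → u.NoLabelledVars)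
    {n : ℕ} {q : Q → Idx n} {m : ℕ} {Γ : Fin m → Ty Q n} {T : Ty Q n} {t u : Tm q Γ T}
    (h : Cong R t u) (ht : t.NoLabelledVars) : u.NoLabelledVars := by
  induction h with
  | base h => exact hR _ _ _ _ _ _ _ h ht
  | lam h ih => exact ⟨ht.1, ih ht.2⟩
  | appL h u ih => exact ⟨ih ht.1, ht.2⟩
  | appR t h ih => exact ⟨ht.1, ih ht.2⟩
  | lamI h ih => exact ih ht
  | appI h σ hU ih => exact ih ht
  | sumL h f ih => exact ⟨ih ht.1, ht.2⟩
  | sumR M h ih => exact ⟨ht.1, ih ht.2⟩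
  | un o h ih => exact ih ht
  | binL o h u ih => exact ⟨ih ht.1, ht.2⟩
  | binR o t h ih => exact ⟨ht.1, ih ht.2⟩

theorem Reduces.noLabelledVars {R : Rule Q}
    (hR : ∀ n (q : Q → Idx n) m (Γ : Fin m → Ty Q n) T (t u : Tm q Γ T), R n q m Γ T t u →
      t.NoLabelledVars → u.NoLabelledVars)
    {n : ℕ} {q : Q → Idx n} {m : ℕ} {Γ : Fin m → Ty Q n} {T : Ty Q n} {t u : Tm q Γ T}
    (h : Reduces R t u) (ht : t.NoLabelledVars) : u.NoLabelledVars := by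
  induction h with
  | refl => exact ht
  | tail _ h ih => exact h.noLabelledVars hR ih

/-! ### Reductions inside of terms -/

variable {R : Rule Q} {n : ℕ} {q : Q → Idx n} {m : ℕ} {Γ : Fin m → Ty Q n} {T U V : Ty Q n}

theorem Reduces.refl (t : Tm q Γ T) : Reduces R t t := Relation.ReflTransGen.refl

theorem Reduces.trans {t u w : Tm q Γ T} (h : Reduces R t u) (h' : Reduces R u w) :
    Reduces R t w := Relation.ReflTransGen.trans h h'

theorem Reduces.step {t u : Tm q Γ T} (h : R n q m Γ T t u) : Reduces R t u :=
  Relation.ReflTransGen.single (.base h)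

theorem Reduces.map {n' m' : ℕ} {q' : Q → Idx n'} {Γ' : Fin m' → Ty Q n'} {T' : Ty Q n'}
    (F : Tm q Γ T → Tm q' Γ' T') (hF : ∀ t t', Cong R t t' → Cong R (F t) (F t')) {t t' : Tm q Γ T}
    (h : Reduces R t t') : Reduces R (F t) (F t') := by
  induction h with
  | refl => exact .refl _
  | tail _ h ih => exact Relation.ReflTransGen.tail ih (hF _ _ h)

theorem Reduces.lam {t t' : Tm q (ext T Γ) U} (h : Reduces R t t') :
    Reduces R (.lam t) (.lam t') := Reduces.map _ (fun _ _ h => Cong.lam h) h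

theorem Reduces.app {t t' : Tm q Γ (.arr T U)} {u u' : Tm q Γ T} (h : Reduces R t t')
    (h' : Reduces R u u') : Reduces R (.app t u) (.app t' u') :=
  (Reduces.map (fun t => Tm.app t u) (fun _ _ h => Cong.appL h u) h).trans
    (Reduces.map (fun u => Tm.app t' u) (fun _ _ h => Cong.appR t' h) h')

theorem Reduces.lamI {T : Ty Q (n + 1)} {t t' : Tm (qI q) (extI Γ) T} (h : Reduces R t t') :
    Reduces R (.lamI t) (.lamI t') := Reduces.map _ (fun _ _ h => Cong.lamI h) h

theorem Reduces.appI {T : Ty Q (n + 1)} {t t' : Tm q Γ (.all T)} (h : Reduces R t t') (σ : Idx n)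
    (hU : T.subst (instI σ) = U) : Reduces R (.appI t σ hU) (.appI t' σ hU) :=
  Reduces.map (fun t => Tm.appI t σ hU) (fun _ _ h => Cong.appI h σ hU) h

theorem Reduces.sum {σ : Idx n} {L : LTy Q n} {M M' : Tm q Γ (.set σ)}
    {f f' : Tm q Γ (.arr (.basis σ) (.lin L))} (h : Reduces R M M') (h' : Reduces R f f') :
    Reduces R (.sum M f) (.sum M' f') :=
  (Reduces.map (fun M => Tm.sum M f) (fun _ _ h => Cong.sumL h f) h).trans
    (Reduces.map (fun f => Tm.sum M' f) (fun _ _ h => Cong.sumR M' h) h')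

theorem Reduces.un (o : Op1 q T U) {t t' : Tm q Γ T} (h : Reduces R t t') :
    Reduces R (.un o t) (.un o t') := Reduces.map _ (fun _ _ h => Cong.un o h) h

theorem Reduces.bin (o : Op2 Q T U V) {t t' : Tm q Γ T} {u u' : Tm q Γ U} (h : Reduces R t t')
    (h' : Reduces R u u') : Reduces R (.bin o t u) (.bin o t' u') :=
  (Reduces.map (fun t => Tm.bin o t u) (fun _ _ h => Cong.binL o h u) h).trans
    (Reduces.map (fun u => Tm.bin o t' u) (fun _ _ h => Cong.binR o t' h) h')

theorem Reduces.bigSum {σ : Idx n} {L : LTy Q n} (M : Tm q Γ (.set σ))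
    {X X' : Tm q (ext (.basis σ) Γ) (.lin L)} (h : Reduces R X X') :
    Reduces R (M.bigSum X) (M.bigSum X') := .sum (.refl M) h.lam

/-- Expanding from the inside out removes all lifted terms. -/
theorem Tm.exists_expand (t : Tm q Γ T) :
    ∃ t', Reduces (fun _ _ _ _ _ => Expand) t t' ∧ t'.LiftFree := by
  induction t with
  | var i h => exact ⟨_, .refl _, trivial⟩
  | const c => exact ⟨_, .refl _, trivial⟩
  | lam t ih =>
    obtain ⟨t', h, h'⟩ := ih
    exact ⟨_, h.lam, h'⟩
  | app t u ih1 ih2 =>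
    obtain ⟨t', h1, h1'⟩ := ih1
    obtain ⟨u', h2, h2'⟩ := ih2
    exact ⟨_, h1.app h2, h1', h2'⟩
  | lamI t ih =>
    obtain ⟨t', h, h'⟩ := ih
    exact ⟨_, h.lamI, h'⟩
  | appI t σ hU ih =>
    obtain ⟨t', h, h'⟩ := ih
    exact ⟨_, h.appI σ hU, h'⟩
  | sum M f ih1 ih2 =>
    obtain ⟨t', h1, h1'⟩ := ih1
    obtain ⟨u', h2, h2'⟩ := ih2
    exact ⟨_, h1.sum h2, h1', h2'⟩
  | bin o t u ih1 ih2 =>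
    obtain ⟨t', h1, h1'⟩ := ih1
    obtain ⟨u', h2, h2'⟩ := ih2
    exact ⟨_, h1.bin o h2, h1', h2'⟩
  | un o t ih =>
    obtain ⟨t', h, h'⟩ := ih
    cases o with
    | liftK R hR hs hs' =>
      obtain ⟨hR, rfl⟩ := hR
      exact ⟨_, (h.un _).trans (.step (.ket R ⟨hR, rfl⟩ hs hs' t')), expandK_liftFree R hs hs' h'⟩
    | liftB R hR hs hs' =>
      obtain ⟨hR, rfl⟩ := hR
      exact ⟨_, (h.un _).trans (.step (.bra R ⟨hR, rfl⟩ hs hs' t')), expandB_liftFree R hs hs' h'⟩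
    | liftO R R' hR hR' hs hs' =>
      obtain ⟨hR, rfl⟩ := hR
      obtain ⟨hR', rfl⟩ := hR'
      exact ⟨_, (h.un _).trans (.step (.opt R R' ⟨hR, rfl⟩ ⟨hR', rfl⟩ hs hs' t')),
        expandO_liftFree R R' hs hs' h'⟩
    | _ => exact ⟨_, h.un _, trivial, h'⟩

end

/-! ### Rearranging tensors of labelled bases -/

section

variable {Q : Type} [LinearOrder Q] {n : ℕ} {q : Q → Idx n} {m : ℕ} {Γ : Fin m → Ty Q n}
  {T : Ty Q n}

/-- Finitely many rearrangements of labelled tensors. -/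
abbrev Tm.Rearranges (t u : Tm q Γ T) : Prop := Reduces (fun _ _ _ _ _ => TsrAC) t u

/-- Finitely many rewriting steps. -/
abbrev Tm.Rewrites (t u : Tm q Γ T) : Prop := Reduces (fun _ _ _ _ _ => Rewrite) t u

theorem Cong.mono {R R' : Rule Q}
    (hR : ∀ n (q : Q → Idx n) m (Γ : Fin m → Ty Q n) T (t u : Tm q Γ T), R n q m Γ T t u →
      R' n q m Γ T t u) {t u : Tm q Γ T} (h : Cong R t u) : Cong R' t u := by
  induction h with
  | base h => exact .base (hR _ _ _ _ _ _ _ h)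
  | lam h ih => exact .lam ih
  | appL h u ih => exact .appL ih u
  | appR t h ih => exact .appR t ih
  | lamI h ih => exact .lamI ih
  | appI h σ hU ih => exact .appI ih σ hU
  | sumL h f ih => exact .sumL ih f
  | sumR M h ih => exact .sumR M ih
  | un o h ih => exact .un o ih
  | binL o h u ih => exact .binL o ih u
  | binR o t h ih => exact .binR o t ih

theorem Tm.Rearranges.rewrites {t u : Tm q Γ T} (h : t.Rearranges u) : t.Rewrites u := by
  induction h with
  | refl => exact .refl _
  | tail _ h ih => exact Relation.ReflTransGen.tail ih (h.mono fun _ _ _ _ _ _ _ h => .ac h)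

variable {s₁ s₁' s₂ s₂' s₃ s₃' t t' u u' s s' : Finset Q}

theorem TsrOK.symm (h : TsrOK s₁ s₁' s₂ s₂' s s') : TsrOK s₂ s₂' s₁ s₁' s s' :=
  ⟨h.1.symm, h.2.1.symm, h.2.2.1.trans (Finset.union_comm _ _),
    h.2.2.2.trans (Finset.union_comm _ _)⟩

theorem TsrOK.transpose (h : TsrOK s₁ s₁' s₂ s₂' s s') : TsrOK s₁' s₁ s₂' s₂ s' s :=
  ⟨h.2.1, h.1, h.2.2.2, h.2.2.1⟩

theorem TsrOK.assoc_inner (h₁ : TsrOK s₁ s₁' s₂ s₂' t t') (h₂ : TsrOK t t' s₃ s₃' s s') :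
    TsrOK s₂ s₂' s₃ s₃' (s₂ ∪ s₃) (s₂' ∪ s₃') := by
  obtain ⟨a1, a2, rfl, rfl⟩ := h₁
  obtain ⟨b1, b2, rfl, rfl⟩ := h₂
  rw [Finset.disjoint_union_left] at b1 b2
  exact ⟨b1.2, b2.2, rfl, rfl⟩

theorem TsrOK.assoc_outer (h₁ : TsrOK s₁ s₁' s₂ s₂' t t') (h₂ : TsrOK t t' s₃ s₃' s s') :
    TsrOK s₁ s₁' (s₂ ∪ s₃) (s₂' ∪ s₃') s s' := by
  obtain ⟨a1, a2, rfl, rfl⟩ := h₁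
  obtain ⟨b1, b2, rfl, rfl⟩ := h₂
  rw [Finset.disjoint_union_left] at b1 b2
  exact ⟨Finset.disjoint_union_right.2 ⟨a1, b1.1⟩, Finset.disjoint_union_right.2 ⟨a2, b2.1⟩,
    Finset.union_assoc _ _ _, Finset.union_assoc _ _ _⟩

theorem Tm.Rearranges.comm (h : TsrOK s₁ s₁' s₂ s₂' s s') (X : Tm q Γ (.lin (.D s₁ s₁')))
    (Y : Tm q Γ (.lin (.D s₂ s₂'))) : (Tm.tsr h X Y).Rearranges (.tsr h.symm Y X) :=
  .step (.comm _ _ _ _)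

theorem Tm.Rearranges.assoc_symm (h₁ : TsrOK s₁ s₁' s₂ s₂' t t') (h₂ : TsrOK t t' s₃ s₃' s s')
    (h₃ : TsrOK s₂ s₂' s₃ s₃' u u') (h₄ : TsrOK s₁ s₁' u u' s s') (X : Tm q Γ (.lin (.D s₁ s₁')))
    (Y : Tm q Γ (.lin (.D s₂ s₂'))) (Z : Tm q Γ (.lin (.D s₃ s₃'))) :
    (Tm.tsr h₄ X (.tsr h₃ Y Z)).Rearranges (.tsr h₂ (.tsr h₁ X Y) Z) :=
  (Tm.Rearranges.comm h₄ X (.tsr h₃ Y Z)).trans <|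
    (Reduces.bin _ (Tm.Rearranges.comm h₃ Y Z) (.refl X)).trans <|
    (Reduces.step (.assoc h₃.symm h₄.symm h₁.symm h₂.symm Z Y X)).trans <|
    (Reduces.bin _ (.refl Z) (Tm.Rearranges.comm h₁.symm Y X)).trans <|
    Tm.Rearranges.comm h₂.symm Z (.tsr h₁ X Y)

/-- The term is `|i⟩_r` for some `i`. -/
inductive IsKet (r : Q) {m : ℕ} {Γ : Fin m → Ty Q n} :
    {s s' : Finset Q} → Tm q Γ (.lin (.D s s')) → Prop
  | mk {s s' : Finset Q} (hs : s = {r}) (hs' : s' = ∅) (i : Tm q Γ (.basis (q r))) :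
      IsKet r (.lket r rfl hs hs' i)

/-- The term is `_r⟨i|` for some `i`. -/
inductive IsBra (r : Q) {m : ℕ} {Γ : Fin m → Ty Q n} :
    {s s' : Finset Q} → Tm q Γ (.lin (.D s s')) → Prop
  | mk {s s' : Finset Q} (hs : s = ∅) (hs' : s' = {r}) (i : Tm q Γ (.basis (q r))) :
      IsBra r (.lbra r rfl hs hs' i)

/-- The term can be rearranged such that its first (or only) factor satisfies `P`. -/
inductive HasFactor (P : {s s' : Finset Q} → Tm q Γ (.lin (.D s s')) → Prop) :
    {s s' : Finset Q} → Tm q Γ (.lin (.D s s')) → Prop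
  | only {s s' : Finset Q} {X A : Tm q Γ (.lin (.D s s'))} (hA : P A) (h : X.Rearranges A) :
      HasFactor P X
  | first {s₁ s₁' s₂ s₂' s s' : Finset Q} {X : Tm q Γ (.lin (.D s s'))}
      {A : Tm q Γ (.lin (.D s₁ s₁'))} {Y : Tm q Γ (.lin (.D s₂ s₂'))} (hA : P A)
      (hY : IsBasisTensor Y) (hT : TsrOK s₁ s₁' s₂ s₂' s s') (h : X.Rearranges (.tsr hT A Y)) :
      HasFactor P X

variable {P : {s s' : Finset Q} → Tm q Γ (.lin (.D s s')) → Prop}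

theorem HasFactor.of_rearranges {X X' : Tm q Γ (.lin (.D s s'))} (hX : HasFactor P X')
    (h : X.Rearranges X') : HasFactor P X := by
  cases hX with
  | only hA h' => exact .only hA (h.trans h')
  | first hA hY hT h' => exact .first hA hY hT (h.trans h')

theorem HasFactor.tsr_left (h : TsrOK s₁ s₁' s₂ s₂' s s') {X : Tm q Γ (.lin (.D s₁ s₁'))}
    {Y : Tm q Γ (.lin (.D s₂ s₂'))} (hX : HasFactor P X) (hY : IsBasisTensor Y) :
    HasFactor P (.tsr h X Y) := by
  cases hX with
  | only hA h' => exact .first hA hY h (h'.bin _ (.refl _))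
  | first hA hZ hT h' =>
    exact .first hA (.tsr (hT.assoc_inner h) hZ hY) (hT.assoc_outer h)
      ((h'.bin _ (.refl _)).trans (.step (.assoc _ _ _ _ _ _ _)))

theorem HasFactor.tsr_right (h : TsrOK s₁ s₁' s₂ s₂' s s') {X : Tm q Γ (.lin (.D s₁ s₁'))}
    {Y : Tm q Γ (.lin (.D s₂ s₂'))} (hX : IsBasisTensor X) (hY : HasFactor P Y) :
    HasFactor P (.tsr h X Y) :=
  (hY.tsr_left h.symm hX).of_rearranges (.comm _ _ _)

theorem IsBasisTensor.hasFactor_ket {X : Tm q Γ (.lin (.D s s'))} (hX : IsBasisTensor X) {r : Q}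
    (hr : r ∈ s) : HasFactor (IsKet r) X := by
  induction hX with
  | one hs hs' => simp [hs] at hr
  | ket r' hr' hs hs' i =>
    subst hr'
    obtain rfl : r = r' := by simpa [hs] using hr
    exact .only (.mk hs hs' i) (.refl _)
  | bra r' hr' hs hs' i => simp [hs] at hr
  | tsr h hX hY ih1 ih2 =>
    rw [h.2.2.1, Finset.mem_union] at hr
    rcases hr with hr | hr
    · exact (ih1 hr).tsr_left h hY
    · exact .tsr_right h hX (ih2 hr)

theorem IsBasisTensor.hasFactor_bra {X : Tm q Γ (.lin (.D s s'))} (hX : IsBasisTensor X) {r : Q}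
    (hr : r ∈ s') : HasFactor (IsBra r) X := by
  induction hX with
  | one hs hs' => simp [hs'] at hr
  | ket r' hr' hs hs' i => simp [hs'] at hr
  | bra r' hr' hs hs' i =>
    subst hr'
    obtain rfl : r = r' := by simpa [hs'] using hr
    exact .only (.mk hs hs' i) (.refl _)
  | tsr h hX hY ih1 ih2 =>
    rw [h.2.2.2, Finset.mem_union] at hr
    rcases hr with hr | hr
    · exact (ih1 hr).tsr_left h hY
    · exact .tsr_right h hX (ih2 hr)

theorem IsBasisTensor.ren {X : Tm q Γ (.lin (.D s s'))} (hX : IsBasisTensor X) {m' : ℕ}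
    {Γ' : Fin m' → Ty Q n} (g : Fin m → Fin m') (hg : ∀ i, Γ' (g i) = Γ i) :
    IsBasisTensor (X.ren g hg) := by
  induction hX with
  | one hs hs' => exact .one hs hs'
  | ket r hr hs hs' i => exact .ket r hr hs hs' _
  | bra r hr hs hs' i => exact .bra r hr hs hs' _
  | tsr h hX hY ih1 ih2 => exact .tsr h ih1 ih2

end

/-! ### Existence of normal forms -/

section

variable {Q : Type} [LinearOrder Q] {n : ℕ} {q : Q → Idx n} {m : ℕ} {Γ : Fin m → Ty Q n}
  {T : Ty Q n} {s₁ s₁' s₂ s₂' s₃ s₃' t t' u u' s s' : Finset Q}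

theorem IsSummand.ren {X : Tm q Γ (.lin (.D s s'))} (hX : IsSummand X) {m' : ℕ}
    {Γ' : Fin m' → Ty Q n} (g : Fin m → Fin m') (hg : ∀ i, Γ' (g i) = Γ i) :
    IsSummand (X.ren g hg) := by
  induction hX generalizing m' with
  | body hX => exact .body (hX.ren g hg)
  | smul a hX => exact .smul _ (hX.ren g hg)
  | sum M hX ih => exact .sum _ (ih _ _)

/-- The term can be rewritten to an iterated sum of a scaled tensor of labelled bases. -/
def HasSummand (t : Tm q Γ (.lin (.D s s'))) : Prop := ∃ X, IsSummand X ∧ t.Rewrites X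

/-- The term can be rewritten to a normal form. -/
def HasNormal (t : Tm q Γ (.lin (.D s s'))) : Prop := ∃ X, IsNormal X ∧ t.Rewrites X

theorem HasSummand.of_rewrites {t u : Tm q Γ (.lin (.D s s'))} (hu : HasSummand u)
    (h : t.Rewrites u) : HasSummand t := by
  obtain ⟨X, hX, h'⟩ := hu
  exact ⟨X, hX, h.trans h'⟩

theorem HasNormal.of_rewrites {t u : Tm q Γ (.lin (.D s s'))} (hu : HasNormal u)
    (h : t.Rewrites u) : HasNormal t := by
  obtain ⟨X, hX, h'⟩ := hu
  exact ⟨X, hX, h.trans h'⟩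

theorem HasSummand.hasNormal {t : Tm q Γ (.lin (.D s s'))} (h : HasSummand t) : HasNormal t := by
  obtain ⟨X, hX, h'⟩ := h
  exact ⟨X, .summand hX, h'⟩

theorem HasSummand.bigSum {σ : Idx n} (M : Tm q Γ (.set σ))
    {X : Tm q (ext (.basis σ) Γ) (.lin (.D s s'))} (h : HasSummand X) :
    HasSummand (M.bigSum X) := by
  obtain ⟨X', hX, h'⟩ := h
  exact ⟨_, .sum M hX, .bigSum M h'⟩

theorem HasNormal.add {X Y : Tm q Γ (.lin (.D s s'))} (hX : HasNormal X) (hY : HasNormal Y) :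
    HasNormal (X.add Y) := by
  obtain ⟨X', hX, h⟩ := hX
  obtain ⟨Y', hY, h'⟩ := hY
  exact ⟨_, .add hX hY, h.bin _ h'⟩

theorem IsNormal.bigSum {σ : Idx n} (M : Tm q Γ (.set σ))
    {X : Tm q (ext (.basis σ) Γ) (.lin (.D s s'))} (h : IsNormal X) : HasNormal (M.bigSum X) := by
  induction h with
  | summand hX => exact ⟨_, .summand (.sum M hX), .refl _⟩
  | add hX hY ih1 ih2 => exact (ih1.add ih2).of_rewrites (.step (.sumAdd _ _ _))

theorem IsSummand.smul_left (a : Tm q Γ (.lin .S)) {X : Tm q Γ (.lin (.D s s'))}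
    (h : IsSummand X) : HasSummand (.smul a X) := by
  induction h with
  | body hX => exact ⟨_, .smul a hX, .refl _⟩
  | smul b hX => exact ⟨_, .smul _ hX, .step (.smulSmul _ _ _)⟩
  | sum M hX ih => exact ((ih (a.wk _)).bigSum M).of_rewrites (.step (.smulSum _ _ _))

theorem HasSummand.smul_left (a : Tm q Γ (.lin .S)) {X : Tm q Γ (.lin (.D s s'))}
    (h : HasSummand X) : HasSummand (.smul a X) := by
  obtain ⟨X', hX, h'⟩ := h
  exact (hX.smul_left a).of_rewrites (.bin _ (.refl _) h')

theorem IsNormal.smul_left (a : Tm q Γ (.lin .S)) {X : Tm q Γ (.lin (.D s s'))}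
    (h : IsNormal X) : HasNormal (.smul a X) := by
  induction h with
  | summand hX => exact (hX.smul_left a).hasNormal
  | add hX hY ih1 ih2 => exact (ih1.add ih2).of_rewrites (.step (.smulAdd _ _ _))

theorem IsBasisTensor.adj {X : Tm q Γ (.lin (.D s s'))} (h : IsBasisTensor X) :
    ∃ Y, IsBasisTensor Y ∧ X.adj.Rewrites Y := by
  induction h with
  | one hs hs' => exact ⟨_, .one hs' hs, .step (.adjOne _ _)⟩
  | ket r hr hs hs' i => exact ⟨_, .bra r hr hs' hs i, .step (.adjKet _ _ _ _ _)⟩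
  | bra r hr hs hs' i => exact ⟨_, .ket r hr hs' hs i, .step (.adjBra _ _ _ _ _)⟩
  | tsr h hX hY ih1 ih2 =>
    obtain ⟨X', hX', h1⟩ := ih1
    obtain ⟨Y', hY', h2⟩ := ih2
    exact ⟨_, .tsr h.transpose hX' hY', (Reduces.step (.adjTsr _ _ _ _)).trans (.bin _ h1 h2)⟩

theorem IsSummand.adj {X : Tm q Γ (.lin (.D s s'))} (h : IsSummand X) : HasSummand X.adj := by
  induction h with
  | body hX =>
    obtain ⟨Y, hY, h⟩ := hX.adj
    exact ⟨Y, .body hY, h⟩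
  | smul a hX =>
    obtain ⟨Y, hY, h⟩ := hX.adj
    exact ⟨_, .smul _ hY, (Reduces.step (.adjSmul _ _)).trans (.bin _ (.refl _) h)⟩
  | sum M hX ih => exact (ih.bigSum M).of_rewrites (.step (.adjSum _ _))

theorem IsNormal.adj {X : Tm q Γ (.lin (.D s s'))} (h : IsNormal X) : HasNormal X.adj := by
  induction h with
  | summand hX => exact hX.adj.hasNormal
  | add hX hY ih1 ih2 => exact (ih1.add ih2).of_rewrites (.step (.adjAdd _ _))

section tensor

variable (h : TsrOK s₁ s₁' s₂ s₂' s s') {X : Tm q Γ (.lin (.D s₁ s₁'))}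
  {Y : Tm q Γ (.lin (.D s₂ s₂'))}

theorem IsSummand.tsr_basisTensor (hX : IsSummand X) (hY : IsBasisTensor Y) :
    HasSummand (.tsr h X Y) := by
  induction hX with
  | body hX => exact ⟨_, .body (.tsr h hX hY), .refl _⟩
  | smul a hX => exact ⟨_, .smul a (.tsr h hX hY), .step (.tsrSmul _ _ _ _)⟩
  | sum M hX ih => exact ((ih h (hY.ren _ _)).bigSum M).of_rewrites (.step (.tsrSum _ _ _ _))

theorem IsSummand.tsr (hX : IsSummand X) (hY : IsSummand Y) : HasSummand (.tsr h X Y) := by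
  induction hX with
  | body hX =>
    exact (hY.tsr_basisTensor h.symm hX).of_rewrites (Tm.Rearranges.comm _ _ _).rewrites
  | smul a hX =>
    exact (((hY.tsr_basisTensor h.symm hX).of_rewrites
      (Tm.Rearranges.comm _ _ _).rewrites).smul_left a).of_rewrites (.step (.tsrSmul _ _ _ _))
  | sum M hX ih => exact ((ih h (hY.ren _ _)).bigSum M).of_rewrites (.step (.tsrSum _ _ _ _))

theorem IsNormal.tsr_summand (hX : IsNormal X) (hY : IsSummand Y) : HasNormal (.tsr h X Y) := by
  induction hX with
  | summand hX => exact (hX.tsr h hY).hasNormal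
  | add hX hX' ih1 ih2 => exact (ih1.add ih2).of_rewrites (.step (.tsrAdd _ _ _ _))

theorem IsNormal.tsr (hX : IsNormal X) (hY : IsNormal Y) : HasNormal (.tsr h X Y) := by
  induction hX with
  | summand hX => exact (hY.tsr_summand h.symm hX).of_rewrites (Tm.Rearranges.comm _ _ _).rewrites
  | add hX hX' ih1 ih2 => exact (ih1.add ih2).of_rewrites (.step (.tsrAdd _ _ _ _))

end tensor

/-- A composition of two tensors of labelled bases is reduced by contracting the bras `_r⟨i|` of the
first factor with the kets `|j⟩_r` of the second one, one quantum variable at a time.  When no such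
pair is left, the composition is a tensor. -/
theorem IsBasisTensor.dot (h : DotOK s₁ s₁' s₂ s₂' s s') {X : Tm q Γ (.lin (.D s₁ s₁'))}
    {Y : Tm q Γ (.lin (.D s₂ s₂'))} (hX : IsBasisTensor X) (hY : IsBasisTensor Y) :
    HasSummand (.dot h X Y) := by
  obtain ⟨k, hk⟩ : ∃ k, (s₁' ∩ s₂).card < k := ⟨_, Nat.lt_succ_self _⟩
  induction k generalizing s₁ s₁' s₂ s₂' s s' with
  | zero => exact absurd hk (Nat.not_lt_zero _)
  | succ k ih =>
    rcases (s₁' ∩ s₂).eq_empty_or_nonempty with he | ⟨r, hr⟩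
    · have h' : TsrOK s₁ s₁' s₂ s₂' s s' := by
        obtain ⟨a, b, rfl, rfl⟩ := h
        have h1 : s₂ \ s₁' = s₂ := by
          rw [Finset.sdiff_eq_self_iff_disjoint, Finset.disjoint_iff_inter_eq_empty,
            Finset.inter_comm, he]
        have h2 : s₁' \ s₂ = s₁' := by
          rw [Finset.sdiff_eq_self_iff_disjoint, Finset.disjoint_iff_inter_eq_empty, he]
        rw [h1] at a ⊢
        rw [h2] at b ⊢
        exact ⟨Finset.disjoint_iff_inter_eq_empty.2 a,
          (Finset.disjoint_iff_inter_eq_empty.2 b).symm, rfl, Finset.union_comm _ _⟩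
      exact ⟨_, .body (.tsr h' hX hY), .step (.sort0 h h' he X Y)⟩
    · rw [Finset.mem_inter] at hr
      cases hX.hasFactor_bra hr.1 with
      | only hA hXA =>
        cases hA with
        | mk hs₁ hs₁' i =>
          cases hY.hasFactor_ket hr.2 with
          | only hB hYB =>
            cases hB with
            | mk hs₂ hs₂' j =>
              have hs : s = ∅ := by rw [h.2.2.1]; grind
              have hs' : s' = ∅ := by rw [h.2.2.2]; grind
              exact ⟨_, .smul _ (.one hs hs'), (Reduces.bin _ hXA.rewrites hYB.rewrites).trans
                (.step (.sort1 r rfl rfl hs₁ hs₁' hs₂ hs₂' hs hs' h i j))⟩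
          | @first _ _ u u' _ _ _ _ Y' hB hY' hT hYB =>
            cases hB with
            | mk hs₂ hs₂' j =>
              obtain rfl : s = u := by rw [h.2.2.1]; unfold TsrOK at hT; grind
              obtain rfl : s' = u' := by rw [h.2.2.2]; unfold TsrOK at hT; grind
              exact ⟨_, .smul _ hY', (Reduces.bin _ hXA.rewrites hYB.rewrites).trans
                (.step (.sort2 r rfl rfl hs₁ hs₁' hs₂ hs₂' hT h i j Y'))⟩
      | @first _ _ t t' _ _ _ _ X' hA hX' hT hXA =>
        cases hA with
        | mk hs₁ hs₁' i =>
          cases hY.hasFactor_ket hr.2 with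
          | only hB hYB =>
            cases hB with
            | mk hs₂ hs₂' j =>
              obtain rfl : s = t := by rw [h.2.2.1]; unfold TsrOK at hT; grind
              obtain rfl : s' = t' := by rw [h.2.2.2]; unfold TsrOK at hT; grind
              exact ⟨_, .smul _ hX', (Reduces.bin _ hXA.rewrites hYB.rewrites).trans
                (.step (.sort3 r rfl rfl hs₁ hs₁' hs₂ hs₂' hT h i j X'))⟩
          | @first _ _ u u' _ _ _ _ Y' hB hY' hT' hYB =>
            cases hB with
            | mk hs₂ hs₂' j =>
              have h' : DotOK t t' u u' s s' := by
                unfold DotOK at h ⊢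
                unfold TsrOK at hT hT'
                grind
              have hlt : (t' ∩ u).card < k := by
                refine lt_of_lt_of_le (Finset.card_lt_card ?_) (Nat.lt_succ_iff.1 hk)
                unfold TsrOK at hT hT'
                refine Finset.ssubset_iff_subset_ne.2 ⟨by grind, fun he => ?_⟩
                have : r ∈ t' ∩ u := he ▸ Finset.mem_inter.2 hr
                grind
              exact ((ih h' hX' hY' hlt).smul_left _).of_rewrites
                ((Reduces.bin _ hXA.rewrites hYB.rewrites).trans
                  (.step (.sort4 r rfl rfl hs₁ hs₁' hs₂ hs₂' hT hT' h h' i j X' Y')))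

section composition

variable (h : DotOK s₁ s₁' s₂ s₂' s s') {X : Tm q Γ (.lin (.D s₁ s₁'))}
  {Y : Tm q Γ (.lin (.D s₂ s₂'))}

theorem IsSummand.dot_basisTensor (hX : IsSummand X) (hY : IsBasisTensor Y) :
    HasSummand (.dot h X Y) := by
  induction hX with
  | body hX => exact hX.dot h hY
  | smul a hX => exact ((hX.dot h hY).smul_left a).of_rewrites (.step (.dotSmulL _ _ _ _))
  | sum M hX ih => exact ((ih h (hY.ren _ _)).bigSum M).of_rewrites (.step (.dotSumL _ _ _ _))

theorem IsSummand.dot (hX : IsSummand X) (hY : IsSummand Y) : HasSummand (.dot h X Y) := by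
  induction hY with
  | body hY => exact hX.dot_basisTensor h hY
  | smul a hY =>
    exact ((hX.dot_basisTensor h hY).smul_left a).of_rewrites (.step (.dotSmulR _ _ _ _))
  | sum M hY ih => exact ((ih h (hX.ren _ _)).bigSum M).of_rewrites (.step (.dotSumR _ _ _ _))

theorem IsNormal.dot_summand (hX : IsNormal X) (hY : IsSummand Y) : HasNormal (.dot h X Y) := by
  induction hX with
  | summand hX => exact (hX.dot h hY).hasNormal
  | add hX hX' ih1 ih2 => exact (ih1.add ih2).of_rewrites (.step (.dotAddL _ _ _ _))

theorem IsNormal.dot (hX : IsNormal X) (hY : IsNormal Y) : HasNormal (.dot h X Y) := by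
  induction hY with
  | summand hY => exact hX.dot_summand h hY
  | add hY hY' ih1 ih2 => exact (ih1.add ih2).of_rewrites (.step (.dotAddR _ _ _ _))

end composition

end

section

variable {Q : Type} [LinearOrder Q]

/-- Weak head normalization by type: labelled terms can be rewritten to a normal form, and functions
to an abstraction with a smaller labelled part. -/
def Tm.Normalizable : {n : ℕ} → {q : Q → Idx n} → {m : ℕ} → {Γ : Fin m → Ty Q n} →
    {T : Ty Q n} → Tm q Γ T → Prop
  | _, _, _, _, .lin (.D _ _), t => HasNormal t
  | _, q, _, Γ, .arr T U, t => ∃ t' : Tm q (ext T Γ) U,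
      t.Rewrites (.lam t') ∧ t'.NoLabelledVars ∧ t'.LiftFree ∧ t'.skel < t.skel
  | _, q, _, Γ, .all T, t => ∃ t' : Tm (qI q) (extI Γ) T,
      t.Rewrites (.lamI t') ∧ t'.NoLabelledVars ∧ t'.LiftFree ∧ t'.skel < t.skel
  | _, _, _, _, _, _ => True

theorem Tm.Normalizable.of_rewrites {n : ℕ} {q : Q → Idx n} {m : ℕ} {Γ : Fin m → Ty Q n}
    {T : Ty Q n} {t u : Tm q Γ T} (hu : u.Normalizable) (h : t.Rewrites u)
    (hs : u.skel < t.skel) : t.Normalizable := by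
  cases T with
  | lin L =>
    cases L with
    | D s s' => exact HasNormal.of_rewrites hu h
    | _ => trivial
  | arr T U =>
    obtain ⟨t', h1, h2, h3, h4⟩ := hu
    exact ⟨t', h.trans h1, h2, h3, h4.trans hs⟩
  | all T =>
    obtain ⟨t', h1, h2, h3, h4⟩ := hu
    exact ⟨t', h.trans h1, h2, h3, h4.trans hs⟩
  | _ => trivial

/-- Induction on the size of the labelled part, which decreases under `β`-reduction: arguments of
functions have plain types, so that labelled subterms are not duplicated. -/
theorem Tm.normalizable {n : ℕ} {q : Q → Idx n} {m : ℕ} {Γ : Fin m → Ty Q n}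
    {T : Ty Q n} (t : Tm q Γ T) (ht : t.NoLabelledVars) (hl : t.LiftFree) (hT : ¬ T.Plain) :
    t.Normalizable := by
  obtain ⟨k, hk⟩ : ∃ k, t.skel < k := ⟨_, Nat.lt_succ_self _⟩
  induction k generalizing n m with
  | zero => exact absurd hk (Nat.not_lt_zero _)
  | succ k ih =>
    replace hk := Nat.lt_succ_iff.1 hk
    cases t with
    | var i hi => exact absurd (hi ▸ ht : T.Plain) hT
    | lam t =>
      rename_i U
      have hU : ¬ U.Plain := fun h => hT ⟨ht.1, h⟩
      refine ⟨t, .refl _, ht.2, hl, ?_⟩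
      rw [Tm.skel, Ty.weight_of_not_plain hU]
      exact Nat.lt_succ_self _
    | lamI t =>
      rename_i T
      have hT' : ¬ T.Plain := hT
      refine ⟨t, .refl _, ht, hl, ?_⟩
      rw [Tm.skel, Ty.weight_of_not_plain hT']
      exact Nat.lt_succ_self _
    | app f u =>
      rw [Tm.skel, Ty.weight_of_not_plain hT] at hk
      obtain ⟨t', h1, h2, h3, h4⟩ := ih f ht.1 hl.1 (fun h => hT h.2) hk
      have hs : (t'.inst u).skel = t'.skel := Tm.skel_sub h2 _
      refine (ih (t'.inst u) (h2.inst ht.2) (h3.inst hl.2) hT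
        (by rw [hs]; exact h4.trans hk)).of_rewrites
        ((h1.app (.refl u)).trans (.step (.beta t' u))) ?_
      rw [hs, Tm.skel, Ty.weight_of_not_plain hT]
      exact h4.trans (Nat.lt_succ_self _)
    | appI f σ hU =>
      subst hU
      rw [Tm.skel, Ty.weight_of_not_plain hT] at hk
      obtain ⟨t', h1, h2, h3, h4⟩ := ih f ht hl (fun h => hT ((Ty.plain_subst _ _).2 h)) hk
      have hs : (t'.instIdx σ).skel = t'.skel := Tm.skel_substI t' _ _ _
      refine (ih (t'.instIdx σ) (h2.instIdx σ) (h3.substI _ _ _) hT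
        (by rw [hs]; exact h4.trans hk)).of_rewrites
        ((h1.appI σ rfl).trans (.step (.betaI t' σ))) ?_
      rw [hs, Tm.skel, Ty.weight_of_not_plain hT]
      exact h4.trans (Nat.lt_succ_self _)
    | sum M f =>
      rename_i L
      rw [Tm.skel, Ty.weight_of_not_plain hT] at hk
      obtain ⟨t', h1, h2, h3, h4⟩ := ih f ht.2 hl.2 (fun h => hT h.2) hk
      cases L with
      | D s s' =>
        obtain ⟨X, hX, h⟩ : HasNormal t' := ih t' h2 h3 id (h4.trans hk)
        exact (hX.bigSum M).of_rewrites (.sum (.refl M) (h1.trans h.lam))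
      | _ => trivial
    | const c =>
      cases c with
      | lone hs hs' => exact ⟨_, .summand (.body (.one hs hs')), .refl _⟩
      | _ => trivial
    | un o t =>
      rw [Tm.skel, Ty.weight_of_not_plain hT] at hk
      cases o with
      | adjD s s' =>
        obtain ⟨X, hX, h⟩ : HasNormal t := ih t ht hl.2 id hk
        exact hX.adj.of_rewrites (h.un _)
      | lket r hr hs hs' => exact ⟨_, .summand (.body (.ket r hr hs hs' t)), .refl _⟩
      | lbra r hr hs hs' => exact ⟨_, .summand (.body (.bra r hr hs hs' t)), .refl _⟩
      | liftK => exact hl.1.elim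
      | liftB => exact hl.1.elim
      | liftO => exact hl.1.elim
      | _ => trivial
    | bin o t u =>
      rw [Tm.skel, Ty.weight_of_not_plain hT] at hk
      have hk1 : t.skel < k := by omega
      have hk2 : u.skel < k := by omega
      cases o with
      | add L =>
        cases L with
        | D s s' => exact HasNormal.add (ih t ht.1 hl.1 id hk1) (ih u ht.2 hl.2 id hk2)
        | _ => trivial
      | @smul L hL =>
        cases L with
        | D s s' =>
          obtain ⟨X, hX, h⟩ : HasNormal u := ih u ht.2 hl.2 id hk2
          exact (hX.smul_left t).of_rewrites (.bin _ (.refl _) h)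
        | _ => trivial
      | ltsr h =>
        obtain ⟨X, hX, h1⟩ : HasNormal t := ih t ht.1 hl.1 id hk1
        obtain ⟨Y, hY, h2⟩ : HasNormal u := ih u ht.2 hl.2 id hk2
        exact (hX.tsr h hY).of_rewrites (.bin _ h1 h2)
      | ldot h =>
        obtain ⟨X, hX, h1⟩ : HasNormal t := ih t ht.1 hl.1 id hk1
        obtain ⟨Y, hY, h2⟩ : HasNormal u := ih u ht.2 hl.2 id hk2
        exact (hX.dot h hY).of_rewrites (.bin _ h1 h2)
      | _ => trivial

end

/-! ### Sorting normal forms -/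

section

variable {Q : Type} [LinearOrder Q] {n : ℕ} {q : Q → Idx n} {m : ℕ} {Γ : Fin m → Ty Q n}
  {s₁ s₁' s₂ s₂' s s' : Finset Q}

theorem IsBasisTensor.rearranges_lone {X : Tm q Γ (.lin (.D s s'))} (hX : IsBasisTensor X)
    (hs : s = ∅) (hs' : s' = ∅) : X.Rearranges (.lone hs hs') := by
  induction hX with
  | one => exact .refl _
  | ket r hr h _ i => simp [hs] at h
  | bra r hr _ h' i => simp [hs'] at h'
  | @tsr t t' u u' _ _ h X Y hX hY ih1 ih2 =>
    have h1 := h.2.2.1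
    have h2 := h.2.2.2
    subst hs hs'
    obtain ⟨rfl, rfl⟩ := Finset.union_eq_empty.1 h1.symm
    obtain ⟨rfl, rfl⟩ := Finset.union_eq_empty.1 h2.symm
    exact (Reduces.bin _ (ih1 rfl rfl) (ih2 rfl rfl)).trans (.step (.one _ _ _ _))

theorem IsKet.sets {r : Q} {X : Tm q Γ (.lin (.D s s'))} (h : IsKet r X) : s = {r} ∧ s' = ∅ := by
  cases h with
  | mk hs hs' i => exact ⟨hs, hs'⟩

theorem IsBra.sets {r : Q} {X : Tm q Γ (.lin (.D s s'))} (h : IsBra r X) : s = ∅ ∧ s' = {r} := by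
  cases h with
  | mk hs hs' i => exact ⟨hs, hs'⟩

theorem IsKet.isBasisTensor {r : Q} {X : Tm q Γ (.lin (.D s s'))} (h : IsKet r X) :
    IsBasisTensor X := by
  cases h with
  | mk hs hs' i => exact .ket _ _ _ _ _

/-- The kets of a tensor of labelled bases can be moved in front of its bras. -/
theorem IsBasisTensor.split {X : Tm q Γ (.lin (.D s s'))} (hX : IsBasisTensor X)
    (hs : s.Nonempty) (hs' : s'.Nonempty) :
    ∃ (h : TsrOK s ∅ ∅ s' s s') (A : Tm q Γ (.lin (.D s ∅))) (B : Tm q Γ (.lin (.D ∅ s'))),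
      IsBasisTensor A ∧ IsBasisTensor B ∧ X.Rearranges (.tsr h A B) := by
  obtain ⟨k, hk⟩ : ∃ k, s.card < k := ⟨_, Nat.lt_succ_self _⟩
  induction k generalizing s s' with
  | zero => exact absurd hk (Nat.not_lt_zero _)
  | succ k ih =>
    obtain ⟨r, hr⟩ := hs
    have h0 : TsrOK s ∅ ∅ s' s s' := by simp [TsrOK]
    cases hX.hasFactor_ket hr with
    | only hA h => exact absurd hA.sets.2 hs'.ne_empty
    | @first t t' u u' _ _ _ A Y hA hY hT h =>
      obtain ⟨rfl, rfl⟩ := hA.sets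
      obtain rfl : s' = u' := by simpa using hT.2.2.2
      rcases u.eq_empty_or_nonempty with rfl | hu
      · obtain rfl : s = {r} := by simpa using hT.2.2.1
        exact ⟨h0, A, Y, hA.isBasisTensor, hY, h⟩
      · have hlt : u.card < k := by
          have := Finset.card_union_of_disjoint hT.1
          rw [← hT.2.2.1, Finset.card_singleton] at this
          omega
        obtain ⟨h', A', B, hA', hB, hY'⟩ := ih hY hu hs' hlt
        have h1 : TsrOK {r} ∅ u ∅ s ∅ := ⟨hT.1, by simp, hT.2.2.1, by simp⟩
        exact ⟨h0, _, B, .tsr h1 hA.isBasisTensor hA', hB,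
          h.trans ((Reduces.bin _ (.refl _) hY').trans
            (Tm.Rearranges.assoc_symm h1 h0 h' hT A A' B))⟩

theorem eq_of_insert_eq {r : Q} {u v : Finset Q} (hu : r ∉ u) (hv : r ∉ v)
    (h : insert r u = insert r v) : u = v := by
  rw [← Finset.erase_insert hu, h, Finset.erase_insert hv]

theorem IsBasisTensor.exists_dropKets (r : Q) (l : List Q) (hl : (r :: l).Nodup)
    {X : Tm q Γ (.lin (.D s s'))} (hX : IsBasisTensor X) (hs : s = (r :: l).toFinset)
    (hs' : s' = ∅) : ∃ X' e, X.Rearranges X' ∧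
      DropKets r l X' (e : Tm q Γ (.lin (.K (prodIdx q r l)))) := by
  induction l generalizing r s s' with
  | nil =>
    have hs₀ : s = {r} := by simpa using hs
    cases hX.hasFactor_ket (r := r) (by simp [hs]) with
    | only hA h =>
      cases hA with
      | mk h1 h2 i => exact ⟨_, _, h, .one r rfl h1 h2 i⟩
    | @first t t' u u' _ _ _ A Y hA hY hT h =>
      obtain ⟨rfl, rfl⟩ := hA.sets
      obtain rfl : u = ∅ := by
        have := hT.2.2.1
        have := hT.1
        grind
      obtain rfl : u' = ∅ := by simpa [hs'] using hT.2.2.2.symm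
      subst hs₀ hs'
      cases hA with
      | mk h1 h2 i =>
        exact ⟨_, _, h.trans ((Reduces.bin _ (.refl _) (hY.rearranges_lone rfl rfl)).trans
          ((Tm.Rearranges.comm _ _ _).trans (.step (.one _ _ _ _)))), .one r rfl h1 h2 i⟩
  | cons r' l ih =>
    rw [List.nodup_cons] at hl
    cases hX.hasFactor_ket (r := r) (by simp [hs]) with
    | only hA h =>
      have := hA.sets.1
      have : r' ∈ s := by simp [hs]
      grind
    | @first t t' u u' _ _ _ A Y hA hY hT h =>
      obtain ⟨rfl, rfl⟩ := hA.sets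
      have hu : u = (r' :: l).toFinset := by
        have h1 := hT.2.2.1
        rw [hs, List.toFinset_cons, ← Finset.insert_eq] at h1
        exact (eq_of_insert_eq (by simpa using hl.1) (by simpa using hT.1) h1).symm
      have hu' : u' = ∅ := by simpa [hs'] using hT.2.2.2.symm
      obtain ⟨Y', e, hY', he⟩ := ih r' hl.2 hY hu hu'
      cases hA with
      | mk h1 h2 i => exact ⟨_, _, h.trans (.bin _ (.refl _) hY'), .cons r r' l rfl h1 h2 hT i he⟩

theorem IsBasisTensor.exists_dropBras (r : Q) (l : List Q) (hl : (r :: l).Nodup)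
    {X : Tm q Γ (.lin (.D s s'))} (hX : IsBasisTensor X) (hs : s = ∅)
    (hs' : s' = (r :: l).toFinset) : ∃ X' e, X.Rearranges X' ∧
      DropBras r l X' (e : Tm q Γ (.lin (.B (prodIdx q r l)))) := by
  induction l generalizing r s s' with
  | nil =>
    have hs₀ : s' = {r} := by simpa using hs'
    cases hX.hasFactor_bra (r := r) (by simp [hs']) with
    | only hA h =>
      cases hA with
      | mk h1 h2 i => exact ⟨_, _, h, .one r rfl h1 h2 i⟩
    | @first t t' u u' _ _ _ A Y hA hY hT h =>
      obtain ⟨rfl, rfl⟩ := hA.sets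
      obtain rfl : u' = ∅ := by
        have := hT.2.2.2
        have := hT.2.1
        grind
      obtain rfl : u = ∅ := by simpa [hs] using hT.2.2.1.symm
      subst hs₀ hs
      cases hA with
      | mk h1 h2 i =>
        exact ⟨_, _, h.trans ((Reduces.bin _ (.refl _) (hY.rearranges_lone rfl rfl)).trans
          ((Tm.Rearranges.comm _ _ _).trans (.step (.one _ _ _ _)))), .one r rfl h1 h2 i⟩
  | cons r' l ih =>
    rw [List.nodup_cons] at hl
    cases hX.hasFactor_bra (r := r) (by simp [hs']) with
    | only hA h =>
      have := hA.sets.2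
      have : r' ∈ s' := by simp [hs']
      grind
    | @first t t' u u' _ _ _ A Y hA hY hT h =>
      obtain ⟨rfl, rfl⟩ := hA.sets
      have hu' : u' = (r' :: l).toFinset := by
        have h1 := hT.2.2.2
        rw [hs', List.toFinset_cons, ← Finset.insert_eq] at h1
        exact (eq_of_insert_eq (by simpa using hl.1) (by simpa using hT.2.1) h1).symm
      have hu : u = ∅ := by simpa [hs] using hT.2.2.1.symm
      obtain ⟨Y', e, hY', he⟩ := ih r' hl.2 hY hu hu'
      cases hA with
      | mk h1 h2 i => exact ⟨_, _, h.trans (.bin _ (.refl _) hY'), .cons r r' l rfl h1 h2 hT i he⟩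

theorem sort_eq_nil (h : s.sort = []) : s = ∅ := by
  have := Finset.sort_toFinset s (· ≤ ·)
  rw [h] at this
  exact this.symm

theorem sort_eq_cons {r : Q} {l : List Q} (h : s.sort = r :: l) :
    s = (r :: l).toFinset ∧ (r :: l).Nodup := by
  rw [← h]
  exact ⟨(Finset.sort_toFinset s _).symm, Finset.sort_nodup s _⟩

theorem nonempty_of_sort_eq_cons {r : Q} {l : List Q} (h : s.sort = r :: l) : s.Nonempty :=
  ⟨r, by rw [(sort_eq_cons h).1]; simp⟩

theorem IsBasisTensor.exists_dropBody {X : Tm q Γ (.lin (.D s s'))} (hX : IsBasisTensor X) :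
    ∃ X' e, X.Rearranges X' ∧ DropBody X' (e : Tm q Γ (.lin (plainTy q s s'))) := by
  rcases h1 : s.sort with _ | ⟨r, l⟩ <;> rcases h2 : s'.sort with _ | ⟨r', l'⟩
  · rw [show plainTy q s s' = .S by simp only [plainTy, h1, h2]]
    exact ⟨_, _, hX.rearranges_lone (sort_eq_nil h1) (sort_eq_nil h2), .one _ _⟩
  · rw [show plainTy q s s' = .B (prodIdx q r' l') by simp only [plainTy, h1, h2]]
    obtain ⟨X', e, h, he⟩ := hX.exists_dropBras r' l' (sort_eq_cons h2).2 (sort_eq_nil h1)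
      (sort_eq_cons h2).1
    exact ⟨X', e, h, .bra (sort_eq_nil h1) h2 he⟩
  · rw [show plainTy q s s' = .K (prodIdx q r l) by simp only [plainTy, h1, h2]]
    obtain ⟨X', e, h, he⟩ := hX.exists_dropKets r l (sort_eq_cons h1).2 (sort_eq_cons h1).1
      (sort_eq_nil h2)
    exact ⟨X', e, h, .ket h1 (sort_eq_nil h2) he⟩
  · rw [show plainTy q s s' = .O (prodIdx q r l) (prodIdx q r' l') by simp only [plainTy, h1, h2]]
    obtain ⟨hT, A, B, hA, hB, h⟩ :=
      hX.split (nonempty_of_sort_eq_cons h1) (nonempty_of_sort_eq_cons h2)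
    obtain ⟨A', K, hA', hK⟩ := hA.exists_dropKets r l (sort_eq_cons h1).2 (sort_eq_cons h1).1 rfl
    obtain ⟨B', C, hB', hC⟩ := hB.exists_dropBras r' l' (sort_eq_cons h2).2 rfl (sort_eq_cons h2).1
    exact ⟨_, _, h.trans (.bin _ hA' hB'), .ketBra h1 h2 hT hK hC⟩

theorem plainTy_eq_S (h : plainTy q s s' = .S) : s = ∅ ∧ s' = ∅ := by
  rcases h1 : s.sort with _ | ⟨r, l⟩ <;> rcases h2 : s'.sort with _ | ⟨r', l'⟩ <;>
    simp only [plainTy, h1, h2, reduceCtorEq] at h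
  exact ⟨sort_eq_nil h1, sort_eq_nil h2⟩

theorem IsSummand.exists_drop {X : Tm q Γ (.lin (.D s s'))} (hX : IsSummand X) :
    ∃ X' e, X.Rearranges X' ∧ Drop X' (e : Tm q Γ (.lin (plainTy q s s'))) := by
  induction hX with
  | body hX =>
    obtain ⟨X', e, h, he⟩ := hX.exists_dropBody
    exact ⟨X', e, h, .body he⟩
  | @smul _ _ s s' a X hX =>
    by_cases hL : plainTy q s s' = .S
    · obtain ⟨hs, hs'⟩ := plainTy_eq_S hL
      rw [hL]
      exact ⟨_, a, .bin _ (.refl _) (hX.rearranges_lone hs hs'), .scalar a hs hs'⟩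
    · obtain ⟨X', e, h, he⟩ := hX.exists_dropBody
      exact ⟨_, _, .bin _ (.refl _) h, .smul a hL he⟩
  | sum M hX ih =>
    obtain ⟨X', e, h, he⟩ := ih
    exact ⟨_, _, .bigSum M h, .sum M he⟩

theorem IsNormal.exists_drop {X : Tm q Γ (.lin (.D s s'))} (hX : IsNormal X) :
    ∃ X' e, X.Rearranges X' ∧ Drop X' (e : Tm q Γ (.lin (plainTy q s s'))) := by
  induction hX with
  | summand hX => exact hX.exists_drop
  | add hX hY ih1 ih2 =>
    obtain ⟨X', e, h, he⟩ := ih1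
    obtain ⟨Y', e', h', he'⟩ := ih2
    exact ⟨_, _, .bin _ h h', .add he he'⟩

/-- The normalization procedure can be carried out. -/
theorem Tm.exists_normalizes {D : Tm q Γ (.lin (.D s s'))} (h : D.NoLabelledVars) :
    ∃ e, Normalizes D e := by
  obtain ⟨D₁, h₁, hl⟩ := D.exists_expand
  have hD₁ : HasNormal D₁ :=
    D₁.normalizable (h₁.noLabelledVars (fun _ _ _ _ _ _ _ => Expand.noLabelledVars) h) hl id
  obtain ⟨D₂, hn, h₂⟩ := hD₁
  obtain ⟨D₃, e, h₃, he⟩ := hn.exists_drop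
  exact ⟨e, D₁, D₂, D₃, h₁, h₂, hn, h₃, he⟩

end

/-! ### Semantics of the elimination of labels -/

section

variable {Q : Type} [LinearOrder Q] {n : ℕ} {q : Q → Idx n} {m : ℕ} {Γ : Fin m → Ty Q n}
  {s s' : Finset Q} {r : Q} {l : List Q} {σ : Idx n} {L : LTy Q n}

theorem DropKets.noLabelledVars {X : Tm q Γ (.lin (.D s s'))} {e : Tm q Γ (.lin (.K σ))}
    (h : DropKets r l X e) (hX : X.NoLabelledVars) : e.NoLabelledVars := by
  induction h with
  | one => exact hX
  | cons r r' l hr hs hs' hT i h ih => exact ⟨hX.1, ih hX.2⟩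

theorem DropBras.noLabelledVars {X : Tm q Γ (.lin (.D s s'))} {e : Tm q Γ (.lin (.B σ))}
    (h : DropBras r l X e) (hX : X.NoLabelledVars) : e.NoLabelledVars := by
  induction h with
  | one => exact hX
  | cons r r' l hr hs hs' hT i h ih => exact ⟨hX.1, ih hX.2⟩

theorem DropBody.noLabelledVars {X : Tm q Γ (.lin (.D s s'))} {e : Tm q Γ (.lin L)}
    (h : DropBody X e) (hX : X.NoLabelledVars) : e.NoLabelledVars := by
  cases h with
  | ketBra _ _ hT h h' => exact ⟨h.noLabelledVars hX.1, h'.noLabelledVars hX.2⟩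
  | ket _ _ h => exact h.noLabelledVars hX
  | bra _ _ h => exact h.noLabelledVars hX
  | one => trivial

theorem Drop.noLabelledVars {X : Tm q Γ (.lin (.D s s'))} {e : Tm q Γ (.lin L)}
    (h : Drop X e) (hX : X.NoLabelledVars) : e.NoLabelledVars := by
  induction h with
  | body h => exact h.noLabelledVars hX
  | smul a hL h => exact ⟨hX.1, h.noLabelledVars hX.2⟩
  | scalar => exact hX.1
  | sum M h ih => exact ⟨hX.1, trivial, ih hX.2.2⟩
  | add h h' ih1 ih2 => exact ⟨ih1 hX.1, ih2 hX.2⟩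

theorem plainTy_plain (q : Q → Idx n) (s s' : Finset Q) : (Ty.lin (plainTy q s s')).Plain := by
  unfold plainTy
  split <;> trivial

/-- The tuple of the values of the quantum variables `r :: l`. -/
def listTuple (q : Q → Idx n) (ρ : Fin n → FinSet) : (r : Q) → (l : List Q) →
    ((x : Q) → x ∈ r :: l → denQ q ρ x) → (prodIdx q r l).den ρ
  | r, [], f => f r List.mem_cons_self
  | r, r' :: l, f =>
      (f r List.mem_cons_self, listTuple q ρ r' l fun x hx => f x (List.mem_cons_of_mem r hx))

theorem listTuple_surjective (q : Q → Idx n) (ρ : Fin n → FinSet) (r : Q) (l : List Q)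
    (hl : (r :: l).Nodup) : Function.Surjective (listTuple q ρ r l) := by
  induction l generalizing r with
  | nil =>
    intro p
    refine ⟨fun x hx => (List.mem_singleton.1 hx).symm ▸ (p : denQ q ρ r), rfl⟩
  | cons r' l ih =>
    rintro ⟨a, b⟩
    rw [List.nodup_cons] at hl
    obtain ⟨f, rfl⟩ := ih r' hl.2 b
    refine ⟨fun x hx => if h : x = r then h.symm ▸ (a : denQ q ρ r)
      else f x ((List.mem_cons.1 hx).resolve_left h), Prod.ext (dif_pos rfl) ?_⟩
    refine congrArg (listTuple q ρ r' l) (funext fun x => funext fun hx => dif_neg ?_)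
    rintro rfl
    exact hl.1 hx

/-- The tuple of the values of all quantum variables of a basis element, in increasing order. -/
def Cfg.tuple {ρ : Fin n → FinSet} (f : Cfg (denQ q ρ) s) (hs : s.sort = r :: l) :
    (prodIdx q r l).den ρ :=
  listTuple q ρ r l fun x hx => f ⟨x, (Finset.mem_sort (· ≤ ·)).1 (hs ▸ hx)⟩

theorem Cfg.tuple_surjective {ρ : Fin n → FinSet} (hs : s.sort = r :: l) :
    Function.Surjective fun f : Cfg (denQ q ρ) s => f.tuple hs := by
  intro p
  obtain ⟨f, hf⟩ := listTuple_surjective q ρ r l (sort_eq_cons hs).2 p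
  exact ⟨fun x => f x.1 (hs ▸ (Finset.mem_sort (· ≤ ·)).2 x.2), hf⟩

theorem DropKets.subset {X : Tm q Γ (.lin (.D s s'))} {e : Tm q Γ (.lin (.K σ))}
    (h : DropKets r l X e) {x : Q} (hx : x ∈ r :: l) : x ∈ s := by
  induction h with
  | one r hr hs hs' i => rw [hs]; simpa using hx
  | cons r r' l hr hs hs' hT i h ih =>
    rw [hT.2.2.1, Finset.mem_union, hs]
    exact (List.mem_cons.1 hx).imp Finset.mem_singleton.2 ih

theorem DropBras.subset {X : Tm q Γ (.lin (.D s s'))} {e : Tm q Γ (.lin (.B σ))}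
    (h : DropBras r l X e) {x : Q} (hx : x ∈ r :: l) : x ∈ s' := by
  induction h with
  | one r hr hs hs' i => rw [hs']; simpa using hx
  | cons r r' l hr hs hs' hT i h ih =>
    rw [hT.2.2.2, Finset.mem_union, hs']
    exact (List.mem_cons.1 hx).imp Finset.mem_singleton.2 ih

/-- Dropping the labels of a sorted tensor of kets only renames its basis elements. -/
theorem DropKets.mat_apply {X : Tm q Γ (.lin (.D s s'))} {e : Tm q Γ (.lin (.K σ))}
    (h : DropKets r l X e) (ρ : Fin n → FinSet) (v : Env q ρ Γ) :
    ∃ hσ : prodIdx q r l = σ, ∀ (f : Cfg (denQ q ρ) s) (g : Cfg (denQ q ρ) s')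
      (hm : ∀ x, x ∈ r :: l → x ∈ s),
      X.mat ρ v f g = e.kvec ρ v (hσ ▸ listTuple q ρ r l fun x hx => f ⟨x, hm x hx⟩) := by
  induction h with
  | one r hr hs hs' i =>
    subst hr
    exact ⟨rfl, fun f g hm => rfl⟩
  | cons r r' l hr hs hs' hT i h ih =>
    subst hr
    obtain ⟨rfl, ih⟩ := ih
    exact ⟨rfl, fun f g hm => congrArg₂ (· * ·) rfl (ih _ _ fun x hx => h.subset hx)⟩

/-- Dropping the labels of a sorted tensor of bras only renames its basis elements. -/
theorem DropBras.mat_apply {X : Tm q Γ (.lin (.D s s'))} {e : Tm q Γ (.lin (.B σ))}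
    (h : DropBras r l X e) (ρ : Fin n → FinSet) (v : Env q ρ Γ) :
    ∃ hσ : prodIdx q r l = σ, ∀ (f : Cfg (denQ q ρ) s) (g : Cfg (denQ q ρ) s')
      (hm : ∀ x, x ∈ r :: l → x ∈ s'),
      X.mat ρ v f g = e.bvec ρ v (hσ ▸ listTuple q ρ r l fun x hx => g ⟨x, hm x hx⟩) := by
  induction h with
  | one r hr hs hs' i =>
    subst hr
    exact ⟨rfl, fun f g hm => rfl⟩
  | cons r r' l hr hs hs' hT i h ih =>
    subst hr
    obtain ⟨rfl, ih⟩ := ih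
    exact ⟨rfl, fun f g hm => congrArg₂ (· * ·) rfl (ih _ _ fun x hx => h.subset hx)⟩

/-- The value of a term that can be added and summed. -/
noncomputable def Tm.lval (t : Tm q Γ (.lin L)) (ρ : Fin n → FinSet) (v : Env q ρ Γ) :
    L.den (denQ q ρ) ρ := (t.eval ρ v).down

/-- A linear map that relates sorted tensors of labelled bases to the plain terms without labels
relates all sorted normal forms to the plain terms without labels. -/
theorem Drop.lval_eq {X : Tm q Γ (.lin (.D s s'))} {e : Tm q Γ (.lin L)} (h : Drop X e)
    (ρ : Fin n → FinSet)
    (ψ : L.den (denQ q ρ) ρ →ₗ[ℂ] (LTy.D s s' : LTy Q n).den (denQ q ρ) ρ)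
    (hψ : ∀ (m : ℕ) (Γ : Fin m → Ty Q n) (v : Env q ρ Γ) (X : Tm q Γ (.lin (.D s s')))
      (e : Tm q Γ (.lin L)), DropBody X e → X.lval ρ v = ψ (e.lval ρ v))
    (v : Env q ρ Γ) : X.lval ρ v = ψ (e.lval ρ v) := by
  induction h with
  | body h => exact hψ _ _ _ _ _ h
  | @smul m Γ a X L e hL h =>
    exact (congrArg (fun A => a.scalar ρ v • A) (hψ _ _ v _ _ h)).trans
      (map_smul ψ (a.scalar ρ v) (e.lval ρ v)).symm
  | @scalar m Γ a hs hs' =>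
    refine (congrArg (fun A => a.scalar ρ v • A) (hψ m Γ v _ _ (.one hs hs'))).trans
      ((map_smul ψ (a.scalar ρ v) (1 : ℂ)).symm.trans ?_)
    exact congrArg ψ (mul_one (a.scalar ρ v))
  | @sum m Γ σ M X L e h ih =>
    refine Eq.trans ?_ (map_sum ψ (fun x => e.lval ρ (Env.cons ρ x v)) (M.finset ρ v)).symm
    exact Finset.sum_congr rfl fun x _ => ih ψ hψ _
  | @add m Γ X Y L e e' h h' ih1 ih2 =>
    exact (congrArg₂ (· + ·) (ih1 ψ hψ v) (ih2 ψ hψ v)).trans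
      (map_add ψ (e.lval ρ v) (e'.lval ρ v)).symm

/-- The unique basis element of the space of no quantum variables. -/
def Cfg.ofEmpty {κ : Q → FinSet} (hs : s = ∅) : Cfg κ s :=
  fun r => absurd (hs ▸ r.2) (Finset.notMem_empty r.1)

/-- The elimination of labels is the inverse of an injective linear map: the reordering of tensor
factors that identifies the plain type with the labelled type. -/
theorem exists_label (q : Q → Idx n) (s s' : Finset Q) (ρ : Fin n → FinSet) :
    ∃ ψ : (plainTy q s s').den (denQ q ρ) ρ →ₗ[ℂ] (LTy.D s s' : LTy Q n).den (denQ q ρ) ρ,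
      Function.Injective ψ ∧
      ∀ (m : ℕ) (Γ : Fin m → Ty Q n) (v : Env q ρ Γ) (X : Tm q Γ (.lin (.D s s')))
        (e : Tm q Γ (.lin (plainTy q s s'))), DropBody X e → X.lval ρ v = ψ (e.lval ρ v) := by
  rcases h1 : s.sort with _ | ⟨r, l⟩ <;> rcases h2 : s'.sort with _ | ⟨r', l'⟩
  · rw [show plainTy q s s' = .S by simp only [plainTy, h1, h2]]
    refine ⟨{ toFun := fun a => Matrix.of fun _ _ => a
              map_add' := fun _ _ => rfl
              map_smul' := fun _ _ => rfl }, fun a b h => ?_, fun m Γ v X e h => ?_⟩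
    · exact congrFun (congrFun h (Cfg.ofEmpty (sort_eq_nil h1))) (Cfg.ofEmpty (sort_eq_nil h2))
    · cases h
      rfl
  · rw [show plainTy q s s' = .B (prodIdx q r' l') by simp only [plainTy, h1, h2]]
    refine ⟨{ toFun := fun w => Matrix.of fun _ (g : Cfg (denQ q ρ) s') => w (g.tuple h2)
              map_add' := fun _ _ => rfl
              map_smul' := fun _ _ => rfl }, fun a b h => ?_, fun m Γ v X e h => ?_⟩
    · funext y
      obtain ⟨g, rfl⟩ := Cfg.tuple_surjective h2 y
      exact congrFun (congrFun h (Cfg.ofEmpty (sort_eq_nil h1))) g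
    · cases h with
      | bra hs hs' hX =>
        obtain ⟨rfl, rfl⟩ := List.cons.inj (h2.symm.trans hs')
        obtain ⟨hσ, h⟩ := hX.mat_apply ρ v
        funext f g
        exact h f g _
  · rw [show plainTy q s s' = .K (prodIdx q r l) by simp only [plainTy, h1, h2]]
    refine ⟨{ toFun := fun w => Matrix.of fun (f : Cfg (denQ q ρ) s) _ => w (f.tuple h1)
              map_add' := fun _ _ => rfl
              map_smul' := fun _ _ => rfl }, fun a b h => ?_, fun m Γ v X e h => ?_⟩
    · funext x
      obtain ⟨f, rfl⟩ := Cfg.tuple_surjective h1 x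
      exact congrFun (congrFun h f) (Cfg.ofEmpty (sort_eq_nil h2))
    · cases h with
      | ket hs hs' hX =>
        obtain ⟨rfl, rfl⟩ := List.cons.inj (h1.symm.trans hs)
        obtain ⟨hσ, h⟩ := hX.mat_apply ρ v
        funext f g
        exact h f g _
  · rw [show plainTy q s s' = .O (prodIdx q r l) (prodIdx q r' l') by
      simp only [plainTy, h1, h2]]
    refine ⟨{ toFun := fun A => Matrix.of fun (f : Cfg (denQ q ρ) s) (g : Cfg (denQ q ρ) s') =>
                A (f.tuple h1) (g.tuple h2)
              map_add' := fun _ _ => rfl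
              map_smul' := fun _ _ => rfl }, fun a b h => ?_, fun m Γ v X e h => ?_⟩
    · funext x y
      obtain ⟨f, rfl⟩ := Cfg.tuple_surjective h1 x
      obtain ⟨g, rfl⟩ := Cfg.tuple_surjective h2 y
      exact congrFun (congrFun h f) g
    · cases h with
      | ketBra hs hs' hT hX hY =>
        obtain ⟨rfl, rfl⟩ := List.cons.inj (h1.symm.trans hs)
        obtain ⟨rfl, rfl⟩ := List.cons.inj (h2.symm.trans hs')
        obtain ⟨hσ, h⟩ := hX.mat_apply ρ v
        obtain ⟨hτ, h'⟩ := hY.mat_apply ρ v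
        funext f g
        exact congrArg₂ (· * ·) (h _ _ fun x hx => hX.subset hx) (h' _ _ fun x hx => hY.subset hx)

theorem Normalizes.isPlain {D : Tm q Γ (.lin (.D s s'))} {e : Tm q Γ (.lin (plainTy q s s'))}
    (h : Normalizes D e) (hD : D.NoLabelledVars) : e.IsPlain := by
  obtain ⟨D₁, D₂, D₃, h₁, h₂, -, h₃, he⟩ := h
  refine (he.noLabelledVars ?_).isPlain (plainTy_plain q s s')
  exact h₃.noLabelledVars (fun _ _ _ _ _ _ _ => TsrAC.noLabelledVars) <|
    h₂.noLabelledVars (fun _ _ _ _ _ _ _ => Rewrite.noLabelledVars) <|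
    h₁.noLabelledVars (fun _ _ _ _ _ _ _ => Expand.noLabelledVars) hD

/-- A labelled term and its normalization have the same value up to the identification of the plain
type with the labelled type. -/
theorem Normalizes.lval_eq {D : Tm q Γ (.lin (.D s s'))} {e : Tm q Γ (.lin (plainTy q s s'))}
    (h : Normalizes D e) (ρ : Fin n → FinSet)
    (ψ : (plainTy q s s').den (denQ q ρ) ρ →ₗ[ℂ] (LTy.D s s' : LTy Q n).den (denQ q ρ) ρ)
    (hψ : ∀ (m : ℕ) (Γ : Fin m → Ty Q n) (v : Env q ρ Γ) (X : Tm q Γ (.lin (.D s s')))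
      (e : Tm q Γ (.lin (plainTy q s s'))), DropBody X e → X.lval ρ v = ψ (e.lval ρ v))
    (v : Env q ρ Γ) : D.lval ρ v = ψ (e.lval ρ v) := by
  obtain ⟨D₁, D₂, D₃, h₁, h₂, -, h₃, he⟩ := h
  have h₁ := h₁.eval_eq (fun _ _ _ _ _ _ _ h ρ v => h.eval_eq ρ v) ρ v
  have h₂ := h₂.eval_eq (fun _ _ _ _ _ _ _ h ρ v => h.eval_eq ρ v) ρ v
  have h₃ := h₃.eval_eq (fun _ _ _ _ _ _ _ h ρ v => h.eval_eq ρ v) ρ v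
  exact (congrArg ULift.down ((h₁.trans h₂).trans h₃)).trans (he.lval_eq ρ ψ hψ v)

end

end LabelledDirac

theorem mainTheorem2 {Q : Type} [LinearOrder Q] {n m : ℕ} (q : Q → Idx n) (Γ : Fin m → Ty Q n)
    (Δ : Decls q Γ) (s s' : Finset Q) (D₁ D₂ : Tm q Γ (.lin (.D s s')))
    (h₁ : D₁.NoLabelledVars) (h₂ : D₂.NoLabelledVars) :
    (∃ e₁, Normalizes D₁ e₁) ∧ (∃ e₂, Normalizes D₂ e₂) ∧
      ∀ e₁ e₂, Normalizes D₁ e₁ → Normalizes D₂ e₂ →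
        e₁.IsPlain ∧ e₂.IsPlain ∧ (Δ.Entails D₁ D₂ ↔ Δ.Entails e₁ e₂) := by
  refine ⟨Tm.exists_normalizes h₁, Tm.exists_normalizes h₂, fun e₁ e₂ he₁ he₂ =>
    ⟨he₁.isPlain h₁, he₂.isPlain h₂, forall_congr' fun ρ => forall_congr' fun v =>
      imp_congr_right fun _ => ?_⟩⟩
  obtain ⟨ψ, hinj, hψ⟩ := exists_label q s s' ρ
  calc
    D₁.eval ρ v = D₂.eval ρ v ↔ D₁.lval ρ v = D₂.lval ρ v := ULift.down_injective.eq_iff.symm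
    _ ↔ ψ (e₁.lval ρ v) = ψ (e₂.lval ρ v) := by
      rw [he₁.lval_eq ρ ψ hψ v, he₂.lval_eq ρ ψ hψ v]
    _ ↔ e₁.lval ρ v = e₂.lval ρ v := hinj.eq_iff
    _ ↔ e₁.eval ρ v = e₂.eval ρ v := ULift.down_injective.eq_iff
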